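/- Let $d\in\{2,3\}$ and let $\mathcal O\subset\mathbb R^d$ be an open set in which the Poincaré inequality holds: for some $\lambda_1>0$, $\lambda_1\int_{\mathcal O}|\psi|^2\,dx\le\int_{\mathcal O}|\nabla\psi|^2\,dx$ for all $\psi\in H^1_0(\mathcal O)$. Let $\mathcal V$ be the space of divergence-free fields in $C_0^\infty(\mathcal O;\mathbb R^d)$, and let $\mathbb H$, $\mathbb V$, $\widetilde{\mathbb L}^p$ be its closures in $L^2(\mathcal O;\mathbb R^d)$, $H^1_0(\mathcal O;\mathbb R^d)$, $L^p(\mathcal O;\mathbb R^d)$ (so $\widetilde{\mathbb L}^2=\mathbb H$). Put $\langle \mathrm A u,\psi\rangle=\int_{\mathcal O}\nabla u:\nabla\psi\,dx$, $\langle \mathrm B(u),\psi\rangle=-\sum_{i,j}\int_{\mathcal O}u_i\,\frac{\partial\psi_j}{\partial x_i}\,u_j\,dx$ (which equals $\int_{\mathcal O}(u\cdot\nabla)u\cdot\psi\,dx$ for $u\in\mathbb V$) and $\langle\mathcal C(u),\psi\rangle=\int_{\mathcal O}|u|^{r-1}u\cdot\psi\,dx$. Let $\mu,\alpha,\beta>0$,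 $\chi\ge0$, $T>0$, and assume that one of the following holds: $d=2$ and $r\ge1$; $d=3$ and $r>3$; $d=r=3$ and $2\beta\mu\ge1$. For $x\in\mathbb H$, $f\in L^2(0,T;\mathbb V')$ and $\Upsilon\in L^2(0,T;\mathbb H)\cap L^4(0,T;\widetilde{\mathbb L}^4)$ (if $r<3$), or $\Upsilon\in L^2(0,T;\mathbb H)\cap L^{r+1}(0,T;\widetilde{\mathbb L}^{r+1})$ (if $r\ge3$), a weak solution on $[0,T]$ of $$\frac{dv}{dt}=-\mu\mathrm Av-\mathrm B(v+\Upsilon)-\alpha v-\beta\,\mathcal C(v+\Upsilon)+(\chi-\alpha)\Upsilon+f,\qquad v(0)=x,\tag{1}$$ is a function $v\in C([0,T];\mathbb H)\cap L^2(0,T;\mathbb V)\cap L^{r+1}(0,T;\widetilde{\mathbb L}^{r+1})$ with weak time derivative in $L^{\frac{r+1}{r}}(0,T;(\mathbb V\cap\widetilde{\mathbb L}^{r+1})')$ (this dual is $\mathbb V'$ if $d=2$ or $r\le5$), such that $v(0)=x$, for every $\psi\in\mathbb V\cap\widetilde{\mathbb L}^{r+1}$ the first equation in (1) tested with $\psi$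 holds for a.e. $t\in(0,T)$, and for all $t\in[0,T]$ the energy equality holds: $$\|v(t)\|_{\mathbb H}^2+2\mu\int_0^t\|\nabla v\|_{L^2}^2ds+2\alpha\int_0^t\|v\|_{\mathbb H}^2ds=\|x\|_{\mathbb H}^2-2\int_0^t\langle\mathrm B(v+\Upsilon),v\rangle ds-2\beta\int_0^t\langle\mathcal C(v+\Upsilon),v\rangle ds+2\int_0^t\langle f,v\rangle ds+2(\chi-\alpha)\int_0^t(\Upsilon,v)\,ds .$$ **Theorem.** Suppose that $x_n\to x$ in $\mathbb H$, $f_n\to f$ in $L^2(0,T;\mathbb V')$, and $\Upsilon_n\to\Upsilon$ in $L^2(0,T;\mathbb H)\cap L^4(0,T;\widetilde{\mathbb L}^4)$ if $r<3$, respectively in $L^2(0,T;\mathbb H)\cap L^{r+1}(0,T;\widetilde{\mathbb L}^{r+1})$ if $r\ge3$. Let $v_n$ be a weak solution of (1) with data $(x_n,f_n,\Upsilon_n)$ and $v$ a weak solution of (1) with data $(x,f,\Upsilon)$. Then $v_n\to v$ in $C([0,T];\mathbb H)\cap L^2(0,T;\mathbb V)\cap L^{r+1}(0,T;\widetilde{\mathbb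 L}^{r+1})$. In particular $v_n(T)\to v(T)$ in $\mathbb H$. -/

import Mathlib

open MeasureTheory Filter Topology Set
open scoped ENNReal ContDiff

noncomputable section

namespace CBF

/-- Euclidean space `ℝ^d`. -/
abbrev E (d : ℕ) : Type := EuclideanSpace ℝ (Fin d)

/-- `d × d` real matrices with the Euclidean (Frobenius) norm; the values of velocity gradients. -/
abbrev M (d : ℕ) : Type := EuclideanSpace ℝ (Fin d × Fin d)

/-- Lebesgue measure on the domain `O`. -/
abbrev vol {d : ℕ} (O : Set (E d)) : Measure (E d) := volume.restrict O

/-- Lebesgue measure on the time interval `(0, T)`. -/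
abbrev timeVol (T : ℝ) : Measure ℝ := volume.restrict (Ioo 0 T)

/-- `div φ (x) = ∑ i, ∂φ_i/∂x_i (x)`. -/
def divergence {d : ℕ} (φ : E d → E d) (x : E d) : ℝ :=
  ∑ i, (fderiv ℝ φ x (EuclideanSpace.single i 1)) i

/-- The gradient matrix of `φ`: the entry `(i, j)` is `∂φ_j/∂x_i`. -/
def gradField {d : ℕ} (φ : E d → E d) (x : E d) : M d :=
  WithLp.toLp 2 fun ij => (fderiv ℝ φ x (EuclideanSpace.single ij.1 1)) ij.2

/-- The class `𝒱` of smooth divergence-free vector fields with compact support in `O`. -/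
structure IsTestField {d : ℕ} (O : Set (E d)) (φ : E d → E d) : Prop where
  smooth : ContDiff ℝ ∞ φ
  compact : HasCompactSupport φ
  support : tsupport φ ⊆ O
  div_free : ∀ x, divergence φ x = 0

/-- The Poincaré inequality `λ₁ ∫_O |ψ|² ≤ ∫_O |∇ψ|²` with some `λ₁ > 0`. It is stated on
`C_0^∞(O)`, which is dense in `H¹_0(O)`, both sides being continuous in the `H¹` norm. -/
def IsPoincareDomain {d : ℕ} (O : Set (E d)) : Prop :=
  ∃ lam : ℝ, 0 < lam ∧ ∀ ψ : E d → ℝ, ContDiff ℝ ∞ ψ → HasCompactSupport ψ → tsupport ψ ⊆ O →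
    lam * ∫ x in O, ψ x ^ 2 ≤ ∫ x in O, ‖fderiv ℝ ψ x‖ ^ 2

/-- The closure of `𝒱` in `L^p(O; ℝ^d)`. (`𝒱` is a linear space, so the span adds nothing.) -/
def solenoidal {d : ℕ} (O : Set (E d)) (p : ℝ≥0∞) [Fact (1 ≤ p)] :
    Submodule ℝ (Lp (E d) p (vol O)) :=
  (Submodule.span ℝ {u : Lp (E d) p (vol O) |
    ∃ φ, IsTestField O φ ∧ (u : E d → E d) =ᵐ[vol O] φ}).topologicalClosure

/-- The space `ℍ`: the closure of `𝒱` in `L²(O; ℝ^d)`, with the `L²` norm. -/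
abbrev H {d : ℕ} (O : Set (E d)) : Submodule ℝ (Lp (E d) 2 (vol O)) := solenoidal O 2

/-- A real number `p ≥ 1` as a Lebesgue exponent. -/
def lexp (p : ℝ) : ℝ≥0∞ := max 1 (ENNReal.ofReal p)

instance fact_lexp (p : ℝ) : Fact (1 ≤ lexp p) := ⟨le_max_left _ _⟩

/-- The space `L̃^p`, `1 ≤ p < ∞`: the closure of `𝒱` in `L^p(O; ℝ^d)`, with the `L^p` norm. -/
abbrev Ltilde {d : ℕ} (O : Set (E d)) (p : ℝ) : Submodule ℝ (Lp (E d) (lexp p) (vol O)) :=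
  solenoidal O (lexp p)

/-- The closure of `𝒱` in the Sobolev space `H¹_0(O; ℝ^d)`; an element of the Sobolev space is
recorded as the pair `(u, ∇u)`, with the `H¹` norm `(‖u‖² + ‖∇u‖²)^{1/2}`. -/
def VSub {d : ℕ} (O : Set (E d)) :
    Submodule ℝ (WithLp 2 (Lp (E d) 2 (vol O) × Lp (M d) 2 (vol O))) :=
  (Submodule.span ℝ {w : WithLp 2 (Lp (E d) 2 (vol O) × Lp (M d) 2 (vol O)) |
    ∃ φ, IsTestField O φ ∧ (w.fst : E d → E d) =ᵐ[vol O] φ ∧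
      (w.snd : E d → M d) =ᵐ[vol O] gradField φ}).topologicalClosure

/-- The space `𝕍`: the closure of `𝒱` in `H¹_0(O; ℝ^d)`. On a Poincaré domain its `H¹` norm is
equivalent to `‖∇u‖`, so that convergence in `L²(0,T; 𝕍)` and in `L²(0,T; 𝕍')` is the same for
both norms. -/
def V {d : ℕ} (O : Set (E d)) : Type := VSub O

instance {d : ℕ} (O : Set (E d)) : NormedAddCommGroup (V O) :=
  inferInstanceAs (NormedAddCommGroup (VSub O))

instance {d : ℕ} (O : Set (E d)) : InnerProductSpace ℝ (V O) :=
  inferInstanceAs (InnerProductSpace ℝ (VSub O))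

/-- The underlying `L²` function `u` of an element of `𝕍`. -/
def V.fn {d : ℕ} {O : Set (E d)} (w : V O) : Lp (E d) 2 (vol O) := (show VSub O from w).1.fst

/-- The gradient `∇u` of an element of `𝕍`, so that `‖V.grad w‖² = ∫_O |∇u|²`. -/
def V.grad {d : ℕ} {O : Set (E d)} (w : V O) : Lp (M d) 2 (vol O) := (show VSub O from w).1.snd

theorem V.fn_add {d : ℕ} {O : Set (E d)} (a b : V O) : V.fn (a + b) = V.fn a + V.fn b := rfl

theorem V.fn_zero {d : ℕ} {O : Set (E d)} : V.fn (0 : V O) = 0 := rfl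

theorem V.fn_smul {d : ℕ} {O : Set (E d)} (c : ℝ) (a : V O) : V.fn (c • a) = c • V.fn a := rfl

/-- The pairs of an element of `𝕍` and an element of `L̃^p` that are the same function. -/
def VLSub {d : ℕ} (O : Set (E d)) (p : ℝ) : Submodule ℝ (V O × Ltilde O p) where
  carrier := {ψ | (V.fn ψ.1 : E d → E d) =ᵐ[vol O] (ψ.2 : Lp (E d) (lexp p) (vol O))}
  add_mem' := by
    intro a b ha hb
    have h1 := Lp.coeFn_add (V.fn a.1) (V.fn b.1)
    have h2 := Lp.coeFn_add (a.2 : Lp (E d) (lexp p) (vol O)) (b.2 : Lp (E d) (lexp p) (vol O))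
    exact h1.trans ((EventuallyEq.add (mem_ofPred.mp ha) (mem_ofPred.mp hb)).trans h2.symm)
  zero_mem' := (Lp.coeFn_zero (E d) 2 (vol O)).trans (Lp.coeFn_zero (E d) (lexp p) (vol O)).symm
  smul_mem' := by
    intro c a ha
    have h1 := Lp.coeFn_smul c (V.fn a.1)
    have h2 := Lp.coeFn_smul c (a.2 : Lp (E d) (lexp p) (vol O))
    exact h1.trans ((EventuallyEq.const_smul (mem_ofPred.mp ha) c).trans h2.symm)

/-- The space `𝕍 ∩ L̃^p`, normed by the larger of the two norms (equivalent to their sum). -/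
def VL {d : ℕ} (O : Set (E d)) (p : ℝ) : Type := VLSub O p

instance {d : ℕ} (O : Set (E d)) (p : ℝ) : NormedAddCommGroup (VL O p) :=
  inferInstanceAs (NormedAddCommGroup (VLSub O p))

instance {d : ℕ} (O : Set (E d)) (p : ℝ) : NormedSpace ℝ (VL O p) :=
  inferInstanceAs (NormedSpace ℝ (VLSub O p))

/-- An element of `𝕍 ∩ L̃^p` as an element of `𝕍`. -/
def VL.toV {d : ℕ} {O : Set (E d)} {p : ℝ} (ψ : VL O p) : V O := (show VLSub O p from ψ).1.1

/-- The trilinear form `b(u, v, w) = ∑_{i,j} ∫_O u_i (∂v_j/∂x_i) w_j dx`, where `G = ∇v`. -/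
def trilinear {d : ℕ} (O : Set (E d)) (u : E d → E d) (G : E d → M d) (w : E d → E d) : ℝ :=
  ∫ x in O, ∑ i, ∑ j, u x i * G x (i, j) * w x j

/-- `⟨B(u), ψ⟩ = -b(u, ψ, u)` with `G = ∇ψ`. For `u ∈ 𝕍` this is `b(u, u, ψ)`; in this form it makes
sense for all divergence-free `u` in `L⁴`. -/
def convTerm {d : ℕ} (O : Set (E d)) (u : E d → E d) (G : E d → M d) : ℝ :=
  -trilinear O u G u

/-- `⟨𝒞(u), ψ⟩ = ∫_O |u|^{r-1} u · ψ dx`. -/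
def dampTerm {d : ℕ} (O : Set (E d)) (r : ℝ) (u ψ : E d → E d) : ℝ :=
  ∫ x in O, ‖u x‖ ^ (r - 1) * inner ℝ (u x) (ψ x)

/-- `z` represents the time-dependent field `v` as an element of `L^p(0, T; L̃^p)`. -/
def RepLtilde {d : ℕ} (O : Set (E d)) (T p : ℝ) (v : ℝ → H O) (z : ℝ → Ltilde O p) : Prop :=
  MemLp z (ENNReal.ofReal p) (timeVol T) ∧
    ∀ᵐ t ∂timeVol T, ((z t : Lp (E d) (lexp p) (vol O)) : E d → E d) =ᵐ[vol O]
      (v t : Lp (E d) 2 (vol O))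

/-- `w` represents the time-dependent field `v` as an element of `L²(0, T; 𝕍)`. -/
def RepV {d : ℕ} (O : Set (E d)) (T : ℝ) (v : ℝ → H O) (w : ℝ → V O) : Prop :=
  MemLp w 2 (timeVol T) ∧ ∀ᵐ t ∂timeVol T, V.fn (w t) = (v t : Lp (E d) 2 (vol O))

/-- Convergence `vₙ → v` in the Bochner space `L^q(0, T; X)`, for a normed space `X`. -/
def TendstoBochner {X : Type*} [NormedAddCommGroup X] (T : ℝ) (q : ℝ≥0∞)
    (vn : ℕ → ℝ → X) (v : ℝ → X) : Prop :=
  (∀ n, MemLp (vn n) q (timeVol T)) ∧ MemLp v q (timeVol T) ∧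
    Tendsto (fun n => eLpNorm (vn n - v) q (timeVol T)) atTop (𝓝 0)

/-- Convergence `vₙ → v` in `L^p(0, T; L̃^p)` for `ℍ`-valued functions of time. -/
def TendstoLtilde {d : ℕ} (O : Set (E d)) (T p : ℝ) (vn : ℕ → ℝ → H O) (v : ℝ → H O) : Prop :=
  ∃ (zn : ℕ → ℝ → Ltilde O p) (z : ℝ → Ltilde O p),
    (∀ n, RepLtilde O T p (vn n) (zn n)) ∧ RepLtilde O T p v z ∧
      TendstoBochner T (ENNReal.ofReal p) zn z

/-- Convergence `vₙ → v` in `L²(0, T; 𝕍)` for `ℍ`-valued functions of time. -/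
def TendstoV {d : ℕ} (O : Set (E d)) (T : ℝ) (vn : ℕ → ℝ → H O) (v : ℝ → H O) : Prop :=
  ∃ (wn : ℕ → ℝ → V O) (w : ℝ → V O),
    (∀ n, RepV O T (vn n) (wn n)) ∧ RepV O T v w ∧ TendstoBochner T 2 wn w

/-- `g`, with values in the dual of `𝕍 ∩ L̃^p`, is the weak time derivative of `v` on `(0, T)`:
`∫ θ'(t) (v(t), ψ) dt = -∫ θ(t) ⟨g(t), ψ⟩ dt` for all `θ ∈ C_0^∞(0, T)` and `ψ ∈ 𝕍 ∩ L̃^p`. -/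
def IsWeakTimeDeriv {d : ℕ} (O : Set (E d)) (T p : ℝ) (v : ℝ → H O)
    (g : ℝ → StrongDual ℝ (VL O p)) : Prop :=
  ∀ θ : ℝ → ℝ, ContDiff ℝ ∞ θ → HasCompactSupport θ → tsupport θ ⊆ Ioo 0 T →
    ∀ ψ : VL O p,
      ∫ t in Ioo 0 T, deriv θ t * inner ℝ (v t : Lp (E d) 2 (vol O)) (V.fn ψ.toV) =
        -∫ t in Ioo 0 T, θ t * g t ψ

/-- `v` is a weak solution on `[0, T]` of
`dv/dt = -μ A v - B(v + Υ) - α v - β 𝒞(v + Υ) + (χ - α) Υ + f`, `v(0) = x`: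
`v ∈ C([0,T]; ℍ) ∩ L²(0,T; 𝕍) ∩ L^{r+1}(0,T; L̃^{r+1})`, its time derivative is in
`L^{(r+1)/r}(0,T; (𝕍 ∩ L̃^{r+1})')`, the equation holds when tested with every
`ψ ∈ 𝕍 ∩ L̃^{r+1}` for a.e. `t`, and the energy equality holds. -/
def IsWeakSolution {d : ℕ} (O : Set (E d)) (T μ α β χ r : ℝ) (x : H O)
    (f : ℝ → StrongDual ℝ (V O)) (Υ : ℝ → H O) (v : ℝ → H O) : Prop :=
  ContinuousOn v (Icc 0 T) ∧ v 0 = x ∧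
  ∃ (w : ℝ → V O) (z : ℝ → Ltilde O (r + 1)) (g : ℝ → StrongDual ℝ (VL O (r + 1))),
    RepV O T v w ∧ RepLtilde O T (r + 1) v z ∧
    MemLp g (ENNReal.ofReal ((r + 1) / r)) (timeVol T) ∧
    IsWeakTimeDeriv O T (r + 1) v g ∧
    (∀ ψ : VL O (r + 1), ∀ᵐ t ∂timeVol T,
      g t ψ =
        - μ * inner ℝ (V.grad (w t)) (V.grad ψ.toV)
        - convTerm O ((v t + Υ t : H O) : Lp (E d) 2 (vol O)) (V.grad ψ.toV)
        - α * inner ℝ (v t : Lp (E d) 2 (vol O)) (V.fn ψ.toV)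
        - β * dampTerm O r ((v t + Υ t : H O) : Lp (E d) 2 (vol O)) (V.fn ψ.toV)
        + (χ - α) * inner ℝ (Υ t : Lp (E d) 2 (vol O)) (V.fn ψ.toV)
        + f t ψ.toV) ∧
    (∀ t ∈ Icc 0 T,
      ‖v t‖ ^ 2 + 2 * μ * (∫ s in (0 : ℝ)..t, ‖V.grad (w s)‖ ^ 2)
          + 2 * α * (∫ s in (0 : ℝ)..t, ‖v s‖ ^ 2) =
        ‖x‖ ^ 2
          - 2 * (∫ s in (0 : ℝ)..t,
              convTerm O ((v s + Υ s : H O) : Lp (E d) 2 (vol O)) (V.grad (w s)))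
          - 2 * β * (∫ s in (0 : ℝ)..t,
              dampTerm O r ((v s + Υ s : H O) : Lp (E d) 2 (vol O)) (v s : Lp (E d) 2 (vol O)))
          + 2 * (∫ s in (0 : ℝ)..t, f s (w s))
          + 2 * (χ - α) * (∫ s in (0 : ℝ)..t, inner ℝ (Υ s) (v s)))

end CBF

end

noncomputable section

namespace CBF

/-! Write `y = v + Υ`, `yₙ = vₙ + Υₙ`, `w = vₙ - v`, `η = Υₙ - Υ`, so that `yₙ - y = w + η`. The
theorem is an energy estimate for `w` whose coefficients involve the limit solution and the
differences of the data, but no bound on `vₙ`. Testing the difference of the two equations with `w`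
gives, up to linear terms, `½ d/dt ‖w‖² + μ ‖∇w‖² + α ‖w‖² = b(yₙ, w, yₙ) - b(y, w, y) - β ⟨𝒞(yₙ) -
𝒞(y), w⟩ + …`. The field `η` has no gradient and is not an admissible test function; it may enter
only through integrals of its powers.

Convection: `b(m, w, w) = 0` for every `m` in `ℍ ∩ L⁴` (`trilinear_self_eq_zero`), so this term may
be subtracted for a convenient `m`. Damping: monotonicity yields a multiple of `(|yₙ|^{r-1} +
|y|^{r-1}) |w + η|²`. If `r > 3`, or `r = 3` and `2βμ ≥ 1`, the choice `m = (yₙ + y)/2` lets this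
damping dominate the convection pointwise (`exists_difference_le_of_three_le`). Otherwise `d = 2`,
the choice is `m = yₙ`, and the leftover `|w|² (|y|² + |η|²)` is controlled after integration by
Ladyzhenskaya's inequality. Either way (`exists_nonlinear_le`) the nonlinear terms are at most a
part of the dissipation plus `C (1 + Q + S) ‖w‖² + ε Q + C_ε S`, where `Q(t)` bounds the powers of
`y(t)`, `S(t)` those of `η(t)`, and `ε` is arbitrary.

Grönwall's inequality with an integrable coefficient then bounds `sup ‖w‖²` and the time integral of
the dissipation by a quantity whose limit in `n` is a constant times `ε ∫ Q`. Since `Q` does not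
depend on `n`, letting `ε → 0` finishes the proof.

Testing with `w` needs justification, because `dw/dt` lies only in the dual of `𝕍 ∩ L̃^{r+1}`, with
exponent `(r+1)/r` in time. The chain rule `norm_sq_sub_eq_integral` supplies it; it rests on the
continuity of translations in Bochner spaces. -/

/-! ### Chain rule for `‖w(t)‖²` by translation in time. -/

theorem tendsto_eLpNorm_translate_sub {X : Type*} [NormedAddCommGroup X] {q : ℝ≥0∞} (hq1 : 1 ≤ q)
    (hq : q ≠ ⊤) {f : ℝ → X} (hf : MemLp f q volume) :
    Tendsto (fun h : ℝ => eLpNorm (fun t => f (h + t) - f t) q volume) (𝓝 0) (𝓝 0) := by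
  have : Fact (1 ≤ q) := ⟨hq1⟩
  have : Fact (q ≠ ⊤) := ⟨hq⟩
  set F : Lp X q volume := hf.toLp f
  have : ContinuousVAdd ℝᵈᵃᵃ (Lp X q (volume : Measure ℝ)) :=
    Lp.instContinuousVAddDomAddAct
  have hc : Continuous fun h : ℝ => DomAddAct.mk h +ᵥ F :=
    Continuous.vadd (DomAddAct.continuous_mk) continuous_const
  have h0 : Tendsto (fun h : ℝ => edist (DomAddAct.mk h +ᵥ F) F) (𝓝 0) (𝓝 0) := by
    have := (hc.edist (continuous_const (y := F))).tendsto 0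
    simpa using this
  refine h0.congr fun h => ?_
  rw [DomAddAct.mk_vadd_toLp, Lp.edist_toLp_toLp]
  rfl

theorem lintegral_translate_mul_le {X : Type*} [NormedAddCommGroup X] [NormedSpace ℝ X]
    {p q : ℝ≥0∞} [ENNReal.HolderTriple q p 1] {a : ℝ → ℝ} {f : ℝ → X} (ha : Measurable a)
    (hf : StronglyMeasurable f) (s σ : ℝ) :
    ∫⁻ t, ‖a (s + t)‖ₑ * ‖f (σ + (s + t)) - f (s + t)‖ₑ ≤
      eLpNorm a q volume * eLpNorm (fun t => f (σ + t) - f t) p volume := by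
  rw [lintegral_add_left_eq_self (fun t => ‖a t‖ₑ * ‖f (σ + t) - f t‖ₑ) s]
  have hm : AEStronglyMeasurable (fun t => f (σ + t) - f t) volume :=
    ((hf.comp_measurable (measurable_const_add σ)).sub hf).aestronglyMeasurable
  have := eLpNorm_smul_le_mul_eLpNorm (p := q) (q := p) (r := 1) hm ha.aestronglyMeasurable
  rw [eLpNorm_one_eq_lintegral_enorm] at this
  simpa [enorm_smul] using this

theorem lintegral_translate_eq {X : Type*} [NormedAddCommGroup X] (a : ℝ → ℝ) (f : ℝ → X)
    (h t : ℝ) :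
    ∫⁻ τ in Ioc t (t + h), ‖a τ‖ₑ * (‖f (t + h) - f τ‖ₑ + ‖f t - f τ‖ₑ) =
      ∫⁻ s in Ioc 0 h, ‖a (s + t)‖ₑ * (‖f (t + h) - f (s + t)‖ₑ + ‖f t - f (s + t)‖ₑ) := by
  rw [← lintegral_indicator measurableSet_Ioc, ← lintegral_indicator measurableSet_Ioc,
    ← lintegral_add_right_eq_self _ t]
  refine lintegral_congr fun s => ?_
  simp only [indicator, mem_Ioc, add_comm t h]
  congr 1
  simp

theorem measurable_lintegral_translate {X : Type*} [NormedAddCommGroup X] {a : ℝ → ℝ} {f : ℝ → X}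
    (ha : Measurable a) (hf : StronglyMeasurable f) (h : ℝ) :
    Measurable fun t => ∫⁻ τ in Ioc t (t + h), ‖a τ‖ₑ * (‖f (t + h) - f τ‖ₑ + ‖f t - f τ‖ₑ) := by
  simp_rw [lintegral_translate_eq]
  refine Measurable.lintegral_prod_right' (f := fun z : ℝ × ℝ =>
    ‖a (z.2 + z.1)‖ₑ * (‖f (z.1 + h) - f (z.2 + z.1)‖ₑ + ‖f z.1 - f (z.2 + z.1)‖ₑ)) ?_
  refine (ha.comp (measurable_snd.add measurable_fst)).enorm.mul (Measurable.fun_add ?_ ?_)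
  · exact ((hf.comp_measurable (measurable_fst.add_const h)).sub
      (hf.comp_measurable (measurable_snd.add measurable_fst))).enorm
  · exact ((hf.comp_measurable measurable_fst).sub
      (hf.comp_measurable (measurable_snd.add measurable_fst))).enorm

/-- After Tonelli, for each fixed offset `s ∈ (0, h]` both differences are translates of `f` by
amounts `h - s` and `-s`, of modulus at most `h`. Hölder costs `‖a‖ δ` for each, and integrating
over `s` contributes the factor `h`. With `δ` small this is the `o(h)` bound behind the chain rule.
-/
theorem lintegral_lintegral_translate_mul_le {X : Type*} [NormedAddCommGroup X] [NormedSpace ℝ X]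
    {p q : ℝ≥0∞} [ENNReal.HolderTriple q p 1] {a : ℝ → ℝ} {f : ℝ → X} (ha : Measurable a)
    (hf : StronglyMeasurable f) {h : ℝ} {δ : ℝ≥0∞}
    (hδ : ∀ σ, |σ| ≤ h → eLpNorm (fun t => f (σ + t) - f t) p volume ≤ δ) :
    ∫⁻ t, ∫⁻ τ in Ioc t (t + h), ‖a τ‖ₑ * (‖f (t + h) - f τ‖ₑ + ‖f t - f τ‖ₑ) ≤
      ENNReal.ofReal h * (eLpNorm a q volume * δ + eLpNorm a q volume * δ) := by
  simp_rw [lintegral_translate_eq]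
  have hm1 : Measurable fun z : ℝ × ℝ => ‖a (z.2 + z.1)‖ₑ :=
    (ha.comp (measurable_snd.add measurable_fst)).enorm
  have hm2 : Measurable fun z : ℝ × ℝ => ‖f (z.1 + h) - f (z.2 + z.1)‖ₑ :=
    ((hf.comp_measurable (measurable_fst.add_const h)).sub
      (hf.comp_measurable (measurable_snd.add measurable_fst))).enorm
  have hm3 : Measurable fun z : ℝ × ℝ => ‖f z.1 - f (z.2 + z.1)‖ₑ :=
    ((hf.comp_measurable measurable_fst).sub
      (hf.comp_measurable (measurable_snd.add measurable_fst))).enorm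
  rw [lintegral_lintegral_swap ((hm1.mul (hm2.add hm3)).aemeasurable)]
  calc _ ≤ ∫⁻ s in Ioc 0 h, (eLpNorm a q volume * δ + eLpNorm a q volume * δ) := by
        refine setLIntegral_mono' measurableSet_Ioc fun s hs => ?_
        simp_rw [mul_add]
        rw [lintegral_add_left]
        · refine add_le_add ?_ ?_
          · refine le_trans (le_of_eq ?_) ((lintegral_translate_mul_le (p := p) (q := q) ha hf s
              (h - s)).trans (by gcongr; apply hδ; rw [abs_le]; constructor <;> linarith [hs.1, hs.2]))
            refine lintegral_congr fun t => ?_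
            congr 4; ring
          · refine le_trans (le_of_eq ?_) ((lintegral_translate_mul_le (p := p) (q := q) ha hf s
              (-s)).trans (by gcongr; apply hδ; rw [abs_le]; constructor <;> linarith [hs.1, hs.2]))
            refine lintegral_congr fun t => ?_
            congr 4; ring
        · exact (hm1.mul hm2).comp (measurable_id.prodMk measurable_const)
    _ = _ := by simp [mul_comm]

/-- The integral telescopes to `∫_b^{b+h} Φ - ∫_0^h Φ`, which divided by `h` tends to `Φ b - Φ 0`.
An `o(h)` bound for the increments averaged over `t` is therefore enough; no single increment has to
be estimated. -/
theorem eq_of_abs_integral_translate_sub_le {Φ : ℝ → ℝ} {T b : ℝ} (hΦ : ContinuousOn Φ (Icc 0 T))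
    (hb : 0 ≤ b) (hbT : b < T)
    (H : ∀ ε > 0, ∀ᶠ h in 𝓝[>] (0 : ℝ), |∫ t in (0 : ℝ)..b, (Φ (t + h) - Φ t)| ≤ ε * h) :
    Φ b = Φ 0 := by
  have hT : (0 : ℝ) ≤ T := hb.trans hbT.le
  set Ψ : ℝ → ℝ := IccExtend hT (domRestrict (Icc 0 T) Φ)
  have hΨ : Continuous Ψ := hΦ.domRestrict.Icc_extend'
  have hΨΦ : ∀ t ∈ Icc 0 T, Ψ t = Φ t := fun t ht => by
    simp [Ψ, IccExtend_of_mem _ _ ht, domRestrict_apply]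
  have key : ∀ h, 0 < h → h < T - b → ∫ t in (0 : ℝ)..b, (Φ (t + h) - Φ t) =
      (∫ t in b..(b + h), Ψ t) - ∫ t in (0 : ℝ)..h, Ψ t := by
    intro h h0 h1
    have : ∫ t in (0 : ℝ)..b, (Φ (t + h) - Φ t) = ∫ t in (0 : ℝ)..b, (Ψ (t + h) - Ψ t) := by
      refine intervalIntegral.integral_congr fun t ht => ?_
      rw [uIcc_of_le hb] at ht
      show Φ (t + h) - Φ t = Ψ (t + h) - Ψ t
      rw [hΨΦ, hΨΦ] <;> constructor <;> linarith [ht.1, ht.2]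
    rw [this, intervalIntegral.integral_sub
      (Continuous.intervalIntegrable (by fun_prop) _ _) (hΨ.intervalIntegrable _ _),
      intervalIntegral.integral_comp_add_right (fun t => Ψ t) h, zero_add]
    have e1 := intervalIntegral.integral_add_adjacent_intervals (μ := volume)
      (hΨ.intervalIntegrable 0 h) (hΨ.intervalIntegrable h (b + h))
    have e2 := intervalIntegral.integral_add_adjacent_intervals (μ := volume)
      (hΨ.intervalIntegrable 0 b) (hΨ.intervalIntegrable b (b + h))
    linarith
  have lim : ∀ c : ℝ, Tendsto (fun h => h⁻¹ * ∫ t in c..(c + h), Ψ t) (𝓝[>] 0) (𝓝 (Ψ c)) := by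
    intro c
    have hd : HasDerivAt (fun x => ∫ t in c..x, Ψ t) (Ψ c) c :=
      intervalIntegral.integral_hasDerivAt_right (hΨ.intervalIntegrable _ _)
        (hΨ.stronglyMeasurableAtFilter _ _) hΨ.continuousAt
    have := hd.tendsto_slope_zero_right
    simpa using this
  have l1 : Tendsto (fun h => h⁻¹ * ∫ t in (0 : ℝ)..b, (Φ (t + h) - Φ t)) (𝓝[>] 0)
      (𝓝 (Ψ b - Ψ 0)) := by
    refine ((lim b).sub (lim 0)).congr' ?_
    filter_upwards [self_mem_nhdsWithin,
      mem_nhdsWithin_of_mem_nhds (Iio_mem_nhds (sub_pos.2 hbT))] with h h0 h1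
    rw [key h h0 h1, zero_add, mul_sub]
  have l2 : |Ψ b - Ψ 0| ≤ 0 := by
    refine le_of_forall_pos_le_add fun ε hε => ?_
    rw [zero_add]
    refine le_of_tendsto l1.abs ?_
    filter_upwards [self_mem_nhdsWithin, H ε hε] with h h0 h1
    have h0 : 0 < h := h0
    rw [abs_mul, abs_of_pos (inv_pos.2 h0), inv_mul_le_iff₀ h0, mul_comm]
    exact h1
  have := sub_eq_zero.1 (abs_nonpos_iff.1 l2)
  rwa [hΨΦ b ⟨hb, hbT.le⟩, hΨΦ 0 ⟨le_rfl, hT⟩] at this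

/-- A Lions–Magenes type formula. The bound on `G` is split along `P₁` and `P₂` because the two
parts have different time exponents, each dual to that of the corresponding component of `W`; a
single dual norm of `G` would not pair with `W`. The function `Φ = ‖w‖² - 2 ∫ G(W)` is shown to be
constant by averaging its increments. -/
theorem norm_sq_sub_eq_integral {K X X₁ X₂ : Type*} [NormedAddCommGroup K] [InnerProductSpace ℝ K]
    [NormedAddCommGroup X] [NormedSpace ℝ X] [NormedAddCommGroup X₁] [NormedSpace ℝ X₁]
    [NormedAddCommGroup X₂] [NormedSpace ℝ X₂] (ι : X →ₗ[ℝ] K) (P₁ : X →L[ℝ] X₁) (P₂ : X →L[ℝ] X₂)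
    {p₁ q₁ p₂ q₂ : ℝ≥0∞} [ENNReal.HolderTriple q₁ p₁ 1] [ENNReal.HolderTriple q₂ p₂ 1]
    (hp₁ : 1 ≤ p₁) (hp₁' : p₁ ≠ ⊤) (hp₂ : 1 ≤ p₂) (hp₂' : p₂ ≠ ⊤) {T : ℝ} {w : ℝ → K} {W : ℝ → X}
    {G : ℝ → StrongDual ℝ X} {a c : ℝ → ℝ} (hw : ContinuousOn w (Icc 0 T))
    (hW : AEStronglyMeasurable W (timeVol T)) (hWw : ∀ᵐ t ∂timeVol T, ι (W t) = w t)
    (hW₁ : MemLp (fun t => P₁ (W t)) p₁ (timeVol T))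
    (hW₂ : MemLp (fun t => P₂ (W t)) p₂ (timeVol T))
    (hG : AEStronglyMeasurable G (timeVol T)) (ha : MemLp a q₁ (timeVol T))
    (hc : MemLp c q₂ (timeVol T))
    (hGb : ∀ᵐ t ∂timeVol T, ∀ ψ, |G t ψ| ≤ a t * ‖P₁ ψ‖ + c t * ‖P₂ ψ‖)
    (hGi : ∀ ψ, IntegrableOn (fun t => G t ψ) (Ioo 0 T))
    (hder : ∀ ψ, ∀ s ∈ Icc 0 T, ∀ t ∈ Icc 0 T,
      inner ℝ (w t) (ι ψ) - inner ℝ (w s) (ι ψ) = ∫ τ in s..t, G τ ψ) :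
    IntegrableOn (fun t => G t (W t)) (Ioo 0 T) ∧
      ∀ t ∈ Icc 0 T, ‖w t‖ ^ 2 - ‖w 0‖ ^ 2 = 2 * ∫ τ in (0 : ℝ)..t, G τ (W τ) := by
  have hint : IntegrableOn (fun t => G t (W t)) (Ioo 0 T) := by
    have h1 : Integrable (fun t => a t * ‖P₁ (W t)‖) (timeVol T) := ha.integrable_mul hW₁.norm
    have h2 : Integrable (fun t => c t * ‖P₂ (W t)‖) (timeVol T) := hc.integrable_mul hW₂.norm
    refine (h1.add h2).mono' ?_ ?_
    · exact (ContinuousLinearMap.id ℝ (StrongDual ℝ X)).aestronglyMeasurable_comp₂ hG hW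
    · filter_upwards [hGb] with t ht using ht _
  refine ⟨hint, ?_⟩
  rcases le_or_gt T 0 with hT | hT
  · intro t ht
    have h0 : t = 0 := le_antisymm (ht.2.trans hT) ht.1
    simp [h0]
  have hii : ∀ s ∈ Icc 0 T, ∀ t ∈ Icc 0 T,
      IntervalIntegrable (fun τ => G τ (W τ)) volume s t := fun s hs t ht => by
    refine (((integrableOn_Icc_iff_integrableOn_Ioo (by simp) (by simp)).2 hint).mono_set ?_).intervalIntegrable
    exact uIcc_subset_Icc hs ht
  have hiiψ : ∀ ψ, ∀ s ∈ Icc 0 T, ∀ t ∈ Icc 0 T,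
      IntervalIntegrable (fun τ => G τ ψ) volume s t := fun ψ s hs t ht => by
    refine (((integrableOn_Icc_iff_integrableOn_Ioo (by simp) (by simp)).2 (hGi ψ)).mono_set ?_).intervalIntegrable
    exact uIcc_subset_Icc hs ht
  set Φ : ℝ → ℝ := fun t => ‖w t‖ ^ 2 - 2 * ∫ τ in (0 : ℝ)..t, G τ (W τ) with hΦdef
  have h00 : (0 : ℝ) ∈ Icc 0 T := ⟨le_rfl, hT.le⟩
  have hΦ : ContinuousOn Φ (Icc 0 T) := by
    refine (hw.norm.pow 2).sub (continuousOn_const.mul ?_)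
    have := intervalIntegral.continuousOn_primitive_interval
      (f := fun τ => G τ (W τ)) (a := 0) (b := T) (μ := volume)
      (by rw [uIcc_of_le hT.le]; exact (integrableOn_Icc_iff_integrableOn_Ioo (by simp) (by simp)).2 hint)
    rwa [uIcc_of_le hT.le] at this
  -- measurable extensions by zero
  have mI : MeasurableSet (Ioo (0 : ℝ) T) := measurableSet_Ioo
  set f : ℝ → X := (Ioo 0 T).indicator (hW.mk W) with hfdef
  have hf : StronglyMeasurable f := hW.stronglyMeasurable_mk.indicator mI
  set a' : ℝ → ℝ := (Ioo 0 T).indicator (ha.1.mk a) with hadef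
  have ha' : Measurable a' := ha.1.stronglyMeasurable_mk.measurable.indicator mI
  set c' : ℝ → ℝ := (Ioo 0 T).indicator (hc.1.mk c) with hcdef
  have hc' : Measurable c' := hc.1.stronglyMeasurable_mk.measurable.indicator mI
  have hfW : ∀ᵐ t ∂timeVol T, W t = f t := by
    filter_upwards [hW.ae_eq_mk, ae_restrict_mem mI] with t h1 h2
    rw [h1, hfdef, indicator_of_mem h2]
  have haa : ∀ᵐ t ∂timeVol T, a t = a' t := by
    filter_upwards [ha.1.ae_eq_mk, ae_restrict_mem mI] with t h1 h2
    rw [h1, hadef, indicator_of_mem h2]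
  have hcc : ∀ᵐ t ∂timeVol T, c t = c' t := by
    filter_upwards [hc.1.ae_eq_mk, ae_restrict_mem mI] with t h1 h2
    rw [h1, hcdef, indicator_of_mem h2]
  have ha'L : MemLp a' q₁ volume :=
    (memLp_indicator_iff_restrict mI).2 ((memLp_congr_ae ha.1.ae_eq_mk).1 ha)
  have hc'L : MemLp c' q₂ volume :=
    (memLp_indicator_iff_restrict mI).2 ((memLp_congr_ae hc.1.ae_eq_mk).1 hc)
  have hf₁ : StronglyMeasurable fun t => P₁ (f t) := P₁.continuous.comp_stronglyMeasurable hf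
  have hf₂ : StronglyMeasurable fun t => P₂ (f t) := P₂.continuous.comp_stronglyMeasurable hf
  have hf₁L : MemLp (fun t => P₁ (f t)) p₁ volume := by
    have : (fun t => P₁ (f t)) = (Ioo 0 T).indicator fun t => P₁ (hW.mk W t) := by
      ext t; by_cases h : t ∈ Ioo 0 T <;> simp [hfdef, h]
    rw [this, memLp_indicator_iff_restrict mI]
    exact (memLp_congr_ae (hW.ae_eq_mk.fun_comp P₁)).1 hW₁
  have hf₂L : MemLp (fun t => P₂ (f t)) p₂ volume := by
    have : (fun t => P₂ (f t)) = (Ioo 0 T).indicator fun t => P₂ (hW.mk W t) := by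
      ext t; by_cases h : t ∈ Ioo 0 T <;> simp [hfdef, h]
    rw [this, memLp_indicator_iff_restrict mI]
    exact (memLp_congr_ae (hW.ae_eq_mk.fun_comp P₂)).1 hW₂
  have hwf : ∀ᵐ t, t ∈ Ioo 0 T → ι (f t) = w t := by
    rw [← ae_restrict_iff' mI]
    filter_upwards [hWw, hfW] with t h1 h2
    rw [← h2, h1]
  have key : ∀ t ∈ Ioo 0 T, ∀ h, 0 < h → t + h ∈ Ioo 0 T → ι (f t) = w t →
      ι (f (t + h)) = w (t + h) → ‖Φ (t + h) - Φ t‖ₑ ≤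
      (∫⁻ τ in Ioc t (t + h), ‖a' τ‖ₑ * (‖P₁ (f (t + h)) - P₁ (f τ)‖ₑ + ‖P₁ (f t) - P₁ (f τ)‖ₑ)) +
      ∫⁻ τ in Ioc t (t + h), ‖c' τ‖ₑ * (‖P₂ (f (t + h)) - P₂ (f τ)‖ₑ + ‖P₂ (f t) - P₂ (f τ)‖ₑ) := by
    intro t ht h h0 hth e1 e2
    have ht' := Ioo_subset_Icc_self ht
    have hth' := Ioo_subset_Icc_self hth
    have hle : t ≤ t + h := by linarith
    -- Uses `‖w(t+h)‖² - ‖w(t)‖² = (w(t+h) - w(t), w(t+h) + w(t))`: the second factor is fixed in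
    -- `τ`, so the weak derivative may be tested with it.
    have E : Φ (t + h) - Φ t =
        ∫ τ in t..(t + h), (G τ (f (t + h) + f t) - 2 * G τ (W τ)) := by
      rw [intervalIntegral.integral_sub (hiiψ _ t ht' _ hth') ((hii t ht' _ hth').const_mul 2),
        ← hder _ t ht' _ hth', map_add, e1, e2, intervalIntegral.integral_const_mul,
        ← intervalIntegral.integral_interval_sub_left (hii 0 h00 _ hth') (hii 0 h00 _ ht'),
        ← inner_sub_left]
      simp only [hΦdef]
      have : inner ℝ (w (t + h) - w t) (w (t + h) + w t) = ‖w (t + h)‖ ^ 2 - ‖w t‖ ^ 2 := by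
        rw [inner_sub_left, inner_add_right, inner_add_right, real_inner_self_eq_norm_sq,
          real_inner_self_eq_norm_sq, real_inner_comm (w t)]
        ring
      rw [this]; ring
    rw [E, intervalIntegral.integral_of_le hle]
    have mes : ∀ (Y : Type _) [NormedAddCommGroup Y] (b : ℝ → ℝ) (g : ℝ → Y), Measurable b →
        StronglyMeasurable g → Measurable fun τ => ‖b τ‖ₑ *
          (‖g (t + h) - g τ‖ₑ + ‖g t - g τ‖ₑ) := by
      intro Y _ b g hb hg
      exact hb.enorm.mul (((stronglyMeasurable_const.sub hg).enorm).add
        ((stronglyMeasurable_const.sub hg).enorm))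
    rw [← lintegral_add_left (mes _ _ _ ha' hf₁)]
    refine (enorm_integral_le_lintegral_enorm _).trans (lintegral_mono_ae ?_)
    have hsub : Ioc t (t + h) ⊆ Ioo 0 T := fun τ hτ => ⟨ht.1.trans hτ.1, hτ.2.trans_lt hth.2⟩
    filter_upwards [ae_restrict_of_ae_restrict_of_subset hsub hfW,
      ae_restrict_of_ae_restrict_of_subset hsub haa, ae_restrict_of_ae_restrict_of_subset hsub hcc,
      ae_restrict_of_ae_restrict_of_subset hsub hGb] with τ h1 h2 h3 h4
    -- Each remaining term contains a time difference of `f`, which is small on average by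
    -- continuity of translations.
    have h5 : G τ (f (t + h) + f t) - 2 * G τ (W τ) =
        G τ (f (t + h) - f τ) + G τ (f t - f τ) := by
      rw [h1]; simp only [map_add, map_sub]; ring
    have h6 : |G τ (f (t + h) - f τ) + G τ (f t - f τ)| ≤
        a' τ * (‖P₁ (f (t + h)) - P₁ (f τ)‖ + ‖P₁ (f t) - P₁ (f τ)‖) +
        c' τ * (‖P₂ (f (t + h)) - P₂ (f τ)‖ + ‖P₂ (f t) - P₂ (f τ)‖) := by
      have i1 := h4 (f (t + h) - f τ)
      have i2 := h4 (f t - f τ)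
      rw [h2, h3] at i1 i2
      simp only [map_sub] at i1 i2
      have := abs_add_le (G τ (f (t + h) - f τ)) (G τ (f t - f τ))
      simp only [map_sub] at this ⊢
      linarith
    rw [h5, ← ofReal_norm, Real.norm_eq_abs]
    refine (ENNReal.ofReal_le_ofReal (h6.trans (le_abs_self _))).trans ?_
    rw [← Real.norm_eq_abs, ofReal_norm]
    refine (enorm_add_le _ _).trans ?_
    rw [enorm_mul, enorm_mul]
    gcongr <;>
    · refine (enorm_add_le _ _).trans ?_
      rw [enorm_norm, enorm_norm]
  have eqb : ∀ b, 0 ≤ b → b < T → Φ b = Φ 0 := by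
    intro b hb hbT
    refine eq_of_abs_integral_translate_sub_le hΦ hb hbT fun ε hε => ?_
    obtain ⟨δ, hδ0, hδ⟩ : ∃ δ : ℝ≥0∞, 0 < δ ∧ (eLpNorm a' q₁ volume * δ + eLpNorm a' q₁ volume * δ) +
        (eLpNorm c' q₂ volume * δ + eLpNorm c' q₂ volume * δ) ≤ ENNReal.ofReal ε := by
      set N := eLpNorm a' q₁ volume + eLpNorm a' q₁ volume +
        (eLpNorm c' q₂ volume + eLpNorm c' q₂ volume)
      have hN : N ≠ ⊤ := by
        simp only [N, ne_eq, ENNReal.add_eq_top, ha'L.2.ne, hc'L.2.ne, or_self, not_false_eq_true]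
      refine ⟨ENNReal.ofReal ε / (N + 1), ENNReal.div_pos (by simpa using hε)
        (by simpa using hN), ?_⟩
      rw [← add_mul, ← add_mul, ← add_mul]
      calc N * (ENNReal.ofReal ε / (N + 1)) ≤ (N + 1) * (ENNReal.ofReal ε / (N + 1)) := by
            gcongr; exact le_self_add
        _ ≤ _ := ENNReal.mul_div_le
    have t1 := (tendsto_eLpNorm_translate_sub hp₁ hp₁' hf₁L).eventually (ge_mem_nhds hδ0)
    have t2 := (tendsto_eLpNorm_translate_sub hp₂ hp₂' hf₂L).eventually (ge_mem_nhds hδ0)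
    obtain ⟨ρ, hρ, hball⟩ := Metric.eventually_nhds_iff.1 (t1.and t2)
    filter_upwards [self_mem_nhdsWithin, mem_nhdsWithin_of_mem_nhds (Iio_mem_nhds hρ),
      mem_nhdsWithin_of_mem_nhds (Iio_mem_nhds (sub_pos.2 hbT))] with h h0 h1 h2
    have h0 : 0 < h := h0
    have h1 : h < ρ := h1
    have h2 : h < T - b := h2
    have hs : ∀ σ, |σ| ≤ h → dist σ 0 < ρ := fun σ hσ => by
      rw [Real.dist_0_eq_abs]; exact hσ.trans_lt h1
    have L1 := lintegral_lintegral_translate_mul_le (q := q₁) ha' hf₁ (h := h) (δ := δ)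
      fun σ hσ => (hball (hs σ hσ)).1
    have L2 := lintegral_lintegral_translate_mul_le (q := q₂) hc' hf₂ (h := h) (δ := δ)
      fun σ hσ => (hball (hs σ hσ)).2
    have hwf' : ∀ᵐ t, t + h ∈ Ioo 0 T → ι (f (t + h)) = w (t + h) :=
      (measurePreserving_add_right volume h).quasiMeasurePreserving.ae hwf
    rw [intervalIntegral.integral_of_le hb]
    have : ‖∫ t in Ioc 0 b, (Φ (t + h) - Φ t)‖ₑ ≤ ENNReal.ofReal (ε * h) := by
      refine (enorm_integral_le_lintegral_enorm _).trans ?_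
      set A : ℝ → ℝ≥0∞ := fun t => ∫⁻ τ in Ioc t (t + h),
        ‖a' τ‖ₑ * (‖P₁ (f (t + h)) - P₁ (f τ)‖ₑ + ‖P₁ (f t) - P₁ (f τ)‖ₑ) with hA
      set B : ℝ → ℝ≥0∞ := fun t => ∫⁻ τ in Ioc t (t + h),
        ‖c' τ‖ₑ * (‖P₂ (f (t + h)) - P₂ (f τ)‖ₑ + ‖P₂ (f t) - P₂ (f τ)‖ₑ) with hB
      calc _ ≤ ∫⁻ t in Ioc 0 b, (A t + B t) := by
            refine lintegral_mono_ae ?_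
            filter_upwards [ae_restrict_of_ae hwf, ae_restrict_of_ae hwf',
              ae_restrict_mem measurableSet_Ioc] with t e1 e2 ht
            have i1 : t ∈ Ioo 0 T := ⟨ht.1, ht.2.trans_lt hbT⟩
            have i2 : t + h ∈ Ioo 0 T := ⟨by linarith [ht.1], by linarith [ht.2]⟩
            exact key t i1 h h0 i2 (e1 i1) (e2 i2)
        _ ≤ ∫⁻ t, (A t + B t) := setLIntegral_le_lintegral _ _
        _ = (∫⁻ t, A t) + ∫⁻ t, B t :=
            lintegral_add_left (measurable_lintegral_translate ha' hf₁ h) _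
        _ ≤ ENNReal.ofReal h * ENNReal.ofReal ε := by
            refine (add_le_add L1 L2).trans ?_
            rw [← mul_add]
            gcongr
        _ = _ := by rw [← ENNReal.ofReal_mul h0.le, mul_comm]
    rw [← ofReal_norm] at this
    exact (ENNReal.ofReal_le_ofReal_iff (by positivity)).1 this
  have hΦ0 : Φ 0 = ‖w 0‖ ^ 2 := by simp [hΦdef]
  -- The averaging needs room for the shift, hence `b < T`; the endpoint follows by continuity.
  have fin : ∀ t ∈ Icc 0 T, Φ t = Φ 0 := by
    intro t ht
    refine Set.EqOn.of_subset_closure (g := fun _ => Φ 0) (s := Ico 0 T)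
      (fun b hb => eqb b hb.1 hb.2) hΦ continuousOn_const Ico_subset_Icc_self ?_ ht
    rw [closure_Ico hT.ne]
  intro t ht
  have := fin t ht
  rw [hΦ0] at this
  simp only [hΦdef] at this
  linarith

/-! ### Weak time derivatives and the fundamental theorem of calculus. -/

theorem deriv_smoothTransition_eq_zero {y : ℝ} (hy : y ∉ Ioc (0 : ℝ) 1) :
    deriv Real.smoothTransition y = 0 := by
  rw [mem_Ioc, not_and_or, not_lt, not_le] at hy
  have hd : HasDerivAt Real.smoothTransition (deriv Real.smoothTransition y) y :=
    ((Real.smoothTransition.contDiff (n := 1)).differentiable one_ne_zero y).hasDerivAt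
  rcases hy with hy | hy
  -- At `y = 0` the function is constant only on the left, so the derivative is identified as a
  -- one-sided one.
  · refine (uniqueDiffWithinAt_Iic y).eq_deriv _ hd.hasDerivWithinAt ?_
    exact (hasDerivWithinAt_const y _ (0 : ℝ)).congr
      (fun z hz => Real.smoothTransition.zero_of_nonpos (le_trans hz hy))
      (Real.smoothTransition.zero_of_nonpos hy)
  · refine (HasDerivAt.congr_of_eventuallyEq (hasDerivAt_const y (1 : ℝ)) ?_).deriv
    filter_upwards [Ioi_mem_nhds hy] with z hz using
      Real.smoothTransition.one_of_one_le (le_of_lt hz)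

/-- A continuous function whose distributional derivative vanishes is constant. -/
theorem eq_of_forall_integral_deriv_mul_eq_zero {F : ℝ → ℝ} (hF : Continuous F) {T : ℝ}
    (H : ∀ θ : ℝ → ℝ, ContDiff ℝ ∞ θ → HasCompactSupport θ → tsupport θ ⊆ Ioo 0 T →
      ∫ t in Ioo 0 T, deriv θ t * F t = 0) {s t : ℝ} (hs : 0 < s) (hst : s < t) (ht : t < T) :
    F t = F s := by
  set S := Real.smoothTransition
  have hS : ContDiff ℝ ∞ S := Real.smoothTransition.contDiff
  have hdS : Continuous (deriv S) := hS.continuous_deriv (by simp)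
  have cont : ∀ c : ℝ, Continuous fun ε : ℝ => ∫ y in (0 : ℝ)..1, deriv S y * F (c + ε * y) :=
    fun c => intervalIntegral.continuous_parametric_intervalIntegral_of_continuous'
      (by fun_prop) 0 1
  -- The rescaled derivative of `S` is an approximate identity concentrated on `(c, c + ε]`; its
  -- mass is `S 1 - S 0 = 1`.
  have scale : ∀ c ε : ℝ, 0 < ε → ∫ x, (ε⁻¹ * deriv S ((x - c) * ε⁻¹)) * F x =
      ∫ y in (0 : ℝ)..1, deriv S y * F (c + ε * y) := by
    intro c ε hε
    rw [intervalIntegral.integral_of_le zero_le_one,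
      setIntegral_eq_integral_of_forall_compl_eq_zero
        (fun y hy => by rw [deriv_smoothTransition_eq_zero hy, zero_mul])]
    have e1 := integral_sub_right_eq_self
      (fun x => (ε⁻¹ * deriv S (x * ε⁻¹)) * F (c + x)) c (μ := volume)
    simp only [add_sub_cancel] at e1
    rw [e1]
    have e2 := Measure.integral_comp_mul_right (fun y => deriv S y * F (c + ε * y)) ε⁻¹
    rw [inv_inv, abs_of_pos hε, smul_eq_mul] at e2
    rw [← mul_right_inj' hε.ne', ← e2, ← integral_const_mul]
    refine integral_congr_ae (Eventually.of_forall fun x => ?_)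
    have : ε * (x * ε⁻¹) = x := by field_simp
    simp only [this]
    field_simp
  have zero : ∀ ε : ℝ, 0 < ε → ε < T - t →
      (∫ y in (0 : ℝ)..1, deriv S y * F (s + ε * y)) -
        ∫ y in (0 : ℝ)..1, deriv S y * F (t + ε * y) = 0 := by
    intro ε hε hεT
    -- A smoothed indicator of `[s, t]`: its derivative is the approximate identity at `s` minus the
    -- one at `t`, so `ε → 0` gives `F s - F t = 0`.
    set θ : ℝ → ℝ := fun x => S ((x - s) * ε⁻¹) - S ((x - t) * ε⁻¹) with hθ
    have hsupp : Function.support θ ⊆ Icc s (t + ε) := by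
      intro x hx
      by_contra hx'
      rw [mem_Icc, not_and_or, not_le, not_le] at hx'
      refine hx ?_
      rcases hx' with h | h
      · have a1 : (x - s) * ε⁻¹ ≤ 0 :=
          mul_nonpos_of_nonpos_of_nonneg (by linarith) (inv_pos.2 hε).le
        have a2 : (x - t) * ε⁻¹ ≤ 0 :=
          mul_nonpos_of_nonpos_of_nonneg (by linarith) (inv_pos.2 hε).le
        simp [hθ, S, Real.smoothTransition.zero_of_nonpos a1,
          Real.smoothTransition.zero_of_nonpos a2]
      · have a1 : 1 ≤ (x - s) * ε⁻¹ := by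
          rw [← div_eq_mul_inv, one_le_div hε]; linarith
        have a2 : 1 ≤ (x - t) * ε⁻¹ := by
          rw [← div_eq_mul_inv, one_le_div hε]; linarith
        simp [hθ, S, Real.smoothTransition.one_of_one_le a1,
          Real.smoothTransition.one_of_one_le a2]
    have hts : tsupport θ ⊆ Icc s (t + ε) := closure_minimal hsupp isClosed_Icc
    have hsub : Icc s (t + ε) ⊆ Ioo 0 T := fun x hx => ⟨hs.trans_le hx.1, by linarith [hx.2]⟩
    have hsm : ContDiff ℝ ∞ θ := by
      refine ContDiff.sub (hS.comp ?_) (hS.comp ?_) <;> fun_prop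
    have hc : HasCompactSupport θ := isCompact_Icc.of_isClosed_subset (isClosed_tsupport _) hts
    have h := H θ hsm hc (hts.trans hsub)
    rw [setIntegral_eq_integral_of_forall_compl_eq_zero] at h
    · have hd : ∀ c x, HasDerivAt (fun x => S ((x - c) * ε⁻¹)) (ε⁻¹ * deriv S ((x - c) * ε⁻¹)) x := by
        intro c x
        have h1 : HasDerivAt S (deriv S ((x - c) * ε⁻¹)) ((x - c) * ε⁻¹) :=
          (hS.differentiable (by simp) _).hasDerivAt
        have h2 : HasDerivAt (fun x : ℝ => (x - c) * ε⁻¹) (1 * ε⁻¹) x :=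
          ((hasDerivAt_id x).sub_const c).mul_const _
        have := h1.comp x h2
        rw [one_mul, mul_comm] at this
        exact this
      have hi : ∀ c, Integrable fun x => (ε⁻¹ * deriv S ((x - c) * ε⁻¹)) * F x := by
        intro c
        refine Continuous.integrable_of_hasCompactSupport (by fun_prop) ?_
        refine HasCompactSupport.intro (isCompact_Icc (a := c) (b := c + ε)) fun x hx => ?_
        have : (x - c) * ε⁻¹ ∉ Ioc (0 : ℝ) 1 := by
          rw [← div_eq_mul_inv]
          rintro ⟨h1, h2⟩
          rw [div_le_one hε] at h2
          rw [div_pos_iff_of_pos_right hε] at h1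
          exact hx ⟨by linarith, by linarith⟩
        rw [deriv_smoothTransition_eq_zero this]; simp
      have : ∀ x, deriv θ x * F x = (ε⁻¹ * deriv S ((x - s) * ε⁻¹)) * F x -
          (ε⁻¹ * deriv S ((x - t) * ε⁻¹)) * F x := by
        intro x
        have := ((hd s x).fun_sub (hd t x)).deriv
        rw [hθ, this]; ring
      simp_rw [this] at h
      rwa [integral_sub (hi s) (hi t), scale s ε hε, scale t ε hε] at h
    · intro x hx
      have : x ∉ tsupport θ := fun h' => hx ((hts.trans hsub) h')
      rw [image_eq_zero_of_notMem_tsupport fun h' => this (tsupport_deriv_subset h'), zero_mul]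
  have lim := ((cont s).sub (cont t)).tendsto 0 |>.mono_left
    (nhdsWithin_le_nhds : 𝓝[>] (0 : ℝ) ≤ 𝓝 0)
  have lim0 : Tendsto (fun ε : ℝ => (∫ y in (0 : ℝ)..1, deriv S y * F (s + ε * y)) -
        ∫ y in (0 : ℝ)..1, deriv S y * F (t + ε * y)) (𝓝[>] 0) (𝓝 0) := by
    refine tendsto_const_nhds.congr' ?_
    filter_upwards [self_mem_nhdsWithin,
      mem_nhdsWithin_of_mem_nhds (Iio_mem_nhds (sub_pos.2 ht))] with ε h1 h2
    exact (zero ε h1 h2).symm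
  have e := tendsto_nhds_unique lim lim0
  have hS1 : ∫ y in (0 : ℝ)..1, deriv S y = 1 := by
    rw [intervalIntegral.integral_deriv_eq_sub
      (fun x _ => hS.differentiable (by simp) x) (hdS.intervalIntegrable _ _)]
    simp [S]
  have e' : (∫ y in (0 : ℝ)..1, deriv S y * F (s + 0 * y)) -
      ∫ y in (0 : ℝ)..1, deriv S y * F (t + 0 * y) = 0 := e
  simp only [zero_mul, add_zero, intervalIntegral.integral_mul_const, hS1, one_mul] at e'
  linarith

/-- The primitive of `k` is absolutely continuous and has the same weak derivative, by integration
by parts. The difference `φ - ∫ k` is continuous with vanishing weak derivative, hence constant. -/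
theorem sub_eq_integral_of_weak_deriv {φ k : ℝ → ℝ} {T : ℝ} (hφ : ContinuousOn φ (Icc 0 T))
    (hk : IntegrableOn k (Ioo 0 T))
    (H : ∀ θ : ℝ → ℝ, ContDiff ℝ ∞ θ → HasCompactSupport θ → tsupport θ ⊆ Ioo 0 T →
      ∫ t in Ioo 0 T, deriv θ t * φ t = -∫ t in Ioo 0 T, θ t * k t) :
    ∀ s ∈ Icc 0 T, ∀ t ∈ Icc 0 T, φ t - φ s = ∫ τ in s..t, k τ := by
  rcases le_or_gt T 0 with hT | hT
  · intro s hs t ht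
    rw [le_antisymm (ht.2.trans hT) ht.1, le_antisymm (hs.2.trans hT) hs.1]
    simp
  have hk' : IntegrableOn k (Icc 0 T) :=
    (integrableOn_Icc_iff_integrableOn_Ioo (by simp) (by simp)).2 hk
  have hki : IntervalIntegrable k volume 0 T :=
    (intervalIntegrable_iff_integrableOn_Icc_of_le hT.le).2 hk'
  set Kf : ℝ → ℝ := fun t => ∫ τ in (0 : ℝ)..t, k τ with hKf
  have hKac : AbsolutelyContinuousOnInterval Kf 0 T :=
    hki.absolutelyContinuousOnInterval_intervalIntegral (c := 0) (by simp)
  have hKc : ContinuousOn Kf (Icc 0 T) := by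
    have := hKac.continuousOn
    rwa [uIcc_of_le hT.le] at this
  have hFc : ContinuousOn (fun t => φ t - Kf t) (Icc 0 T) := hφ.sub hKc
  set F : ℝ → ℝ := IccExtend hT.le (domRestrict (Icc 0 T) fun t => φ t - Kf t) with hFdef
  have hF : Continuous F := hFc.domRestrict.Icc_extend'
  have hFe : ∀ t ∈ Icc 0 T, F t = φ t - Kf t := fun t ht => by
    simp [hFdef, IccExtend_of_mem _ _ ht, domRestrict_apply]
  have HF : ∀ θ : ℝ → ℝ, ContDiff ℝ ∞ θ → HasCompactSupport θ → tsupport θ ⊆ Ioo 0 T →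
      ∫ t in Ioo 0 T, deriv θ t * F t = 0 := by
    intro θ hθ hθc hθs
    have hθ0 : θ 0 = 0 := image_eq_zero_of_notMem_tsupport fun h => lt_irrefl _ (hθs h).1
    have hθT : θ T = 0 := image_eq_zero_of_notMem_tsupport fun h => lt_irrefl _ (hθs h).2
    have hdθ : Continuous (deriv θ) := hθ.continuous_deriv (by simp)
    have hθ1 : ContDiff ℝ 1 θ := hθ.of_le (mod_cast le_top)
    have hθac : AbsolutelyContinuousOnInterval θ 0 T :=
      ContDiffOn.absolutelyContinuousOnInterval (ContDiff.contDiffOn hθ1)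
    have parts := hθac.integral_deriv_mul_eq_sub hKac
    rw [hθ0, hθT, zero_mul, zero_mul, sub_zero] at parts
    have parts' : ∫ x in (0 : ℝ)..T, (deriv θ x * Kf x + θ x * k x) = 0 := by
      refine Eq.trans ?_ parts
      refine intervalIntegral.integral_congr_ae ?_
      filter_upwards [hki.ae_hasDerivAt_integral] with x hx hx'
      rw [(hx (uIoc_subset_uIcc hx') 0 (by simp)).deriv]
    have i1 : IntegrableOn (fun x => deriv θ x * Kf x) (Icc 0 T) :=
      (hdθ.continuousOn.mul hKc).integrableOn_Icc
    have i2 : IntegrableOn (fun x => deriv θ x * φ x) (Icc 0 T) :=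
      (hdθ.continuousOn.mul hφ).integrableOn_Icc
    have i3 : IntegrableOn (fun x => θ x * k x) (Icc 0 T) :=
      hk'.continuousOn_mul hθ.continuous.continuousOn isCompact_Icc
    rw [intervalIntegral.integral_of_le hT.le, ← integral_Icc_eq_integral_Ioc,
      integral_Icc_eq_integral_Ioo, integral_add (i1.mono_set Ioo_subset_Icc_self)
        (i3.mono_set Ioo_subset_Icc_self)] at parts'
    calc ∫ t in Ioo 0 T, deriv θ t * F t
        = ∫ t in Ioo 0 T, (deriv θ t * φ t - deriv θ t * Kf t) := by
          refine setIntegral_congr_fun measurableSet_Ioo fun t ht => ?_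
          simp only [hFe t (Ioo_subset_Icc_self ht)]; ring
      _ = 0 := by
          rw [integral_sub (i2.mono_set Ioo_subset_Icc_self) (i1.mono_set Ioo_subset_Icc_self),
            H θ hθ hθc hθs]
          linarith
  have hconst : ∀ t ∈ Ioo 0 T, F t = F (T / 2) := by
    intro t ht
    rcases lt_trichotomy t (T / 2) with h | h | h
    · exact (eq_of_forall_integral_deriv_mul_eq_zero hF HF ht.1 h (by linarith)).symm
    · rw [h]
    · exact eq_of_forall_integral_deriv_mul_eq_zero hF HF (by linarith) h ht.2
  have hconst' : ∀ t ∈ Icc 0 T, F t = F (T / 2) := by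
    intro t ht
    refine Set.EqOn.of_subset_closure (g := fun _ => F (T / 2)) (s := Ioo 0 T)
      hconst hF.continuousOn continuousOn_const Ioo_subset_Icc_self ?_ ht
    rw [closure_Ioo hT.ne]
  intro s hs t ht
  have e := (hconst' t ht).trans (hconst' s hs).symm
  rw [hFe t ht, hFe s hs] at e
  have h0 : ∀ x ∈ Icc 0 T, IntervalIntegrable k volume 0 x := fun x hx =>
    hki.mono_set (by rw [uIcc_of_le hT.le, uIcc_of_le hx.1]; exact Icc_subset_Icc_right hx.2)
  rw [← intervalIntegral.integral_interval_sub_left (h0 t ht) (h0 s hs)]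
  simp only [hKf] at e
  linarith


/-! ### Grönwall's inequality. -/

theorem absolutelyContinuousOnInterval_comp {f g : ℝ → ℝ} {a b : ℝ} {K : NNReal}
    (hg : LipschitzOnWith K g (f '' uIcc a b)) (hf : AbsolutelyContinuousOnInterval f a b) :
    AbsolutelyContinuousOnInterval (fun x => g (f x)) a b := by
  rw [absolutelyContinuousOnInterval_iff] at hf ⊢
  intro ε hε
  obtain ⟨δ, hδ, H⟩ := hf (ε / (K + 1)) (by positivity)
  refine ⟨δ, hδ, fun E hE hEδ => ?_⟩
  have h1 : ∑ i ∈ Finset.range E.1, dist (g (f (E.2 i).1)) (g (f (E.2 i).2)) ≤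
      ∑ i ∈ Finset.range E.1, (K + 1) * dist (f (E.2 i).1) (f (E.2 i).2) := by
    refine Finset.sum_le_sum fun i hi => ?_
    refine (hg.dist_le_mul _ (mem_image_of_mem f (hE.1 i hi).1) _
      (mem_image_of_mem f (hE.1 i hi).2)).trans ?_
    gcongr
    linarith
  rw [← Finset.mul_sum] at h1
  have h2 := H E hE hEδ
  rw [lt_div_iff₀ (by positivity)] at h2
  linarith

/-- **Grönwall's inequality** with an integrable coefficient. -/
theorem le_mul_exp_integral {X k : ℝ → ℝ} {T A : ℝ} (hT : 0 ≤ T) (hX : ContinuousOn X (Icc 0 T))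
    (hk : IntegrableOn k (Ioo 0 T)) (hk0 : ∀ᵐ t ∂timeVol T, 0 ≤ k t)
    (H : ∀ t ∈ Icc 0 T, X t ≤ A + ∫ s in (0 : ℝ)..t, k s * X s) :
    ∀ t ∈ Icc 0 T, A + (∫ s in (0 : ℝ)..t, k s * X s) ≤ A * Real.exp (∫ s in (0 : ℝ)..t, k s) := by
  have hk' : IntegrableOn k (Icc 0 T) :=
    (integrableOn_Icc_iff_integrableOn_Ioo (by simp) (by simp)).2 hk
  have hki : IntervalIntegrable k volume 0 T :=
    (intervalIntegrable_iff_integrableOn_Icc_of_le hT).2 hk'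
  have hkXi : IntervalIntegrable (fun s => k s * X s) volume 0 T :=
    (intervalIntegrable_iff_integrableOn_Icc_of_le hT).2 (hk'.mul_continuousOn hX isCompact_Icc)
  set Kf : ℝ → ℝ := fun t => ∫ τ in (0 : ℝ)..t, k τ with hKf
  set Y : ℝ → ℝ := fun t => A + ∫ τ in (0 : ℝ)..t, k τ * X τ with hY
  set Z : ℝ → ℝ := fun t => Real.exp (-Kf t) with hZ
  have hKac : AbsolutelyContinuousOnInterval Kf 0 T :=
    hki.absolutelyContinuousOnInterval_intervalIntegral (c := 0) (by simp)
  have hZac : AbsolutelyContinuousOnInterval Z 0 T := by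
    obtain ⟨B, hB⟩ := hKac.exists_bound
    have hL : ∃ K, LipschitzOnWith K (fun x => Real.exp (-x)) (Icc (-B) B) :=
      ContDiffOn.exists_lipschitzOnWith (n := 1)
        (ContDiff.contDiffOn (by fun_prop)) (by simp) (convex_Icc _ _) isCompact_Icc
    obtain ⟨K, hK⟩ := hL
    refine absolutelyContinuousOnInterval_comp (f := Kf) (g := fun x => Real.exp (-x))
      (hK.mono ?_) hKac
    rintro _ ⟨x, hx, rfl⟩
    exact abs_le.1 (hB x hx)
  have hYac : AbsolutelyContinuousOnInterval Y 0 T := by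
    have := hkXi.absolutelyContinuousOnInterval_intervalIntegral (c := 0) (by simp)
    have hc : AbsolutelyContinuousOnInterval (fun _ : ℝ => A) 0 T :=
      ContDiffOn.absolutelyContinuousOnInterval contDiffOn_const
    exact hc.add this
  intro t ht
  have hsub : uIcc 0 t ⊆ uIcc 0 T := by
    rw [uIcc_of_le hT, uIcc_of_le ht.1]; exact Icc_subset_Icc_right ht.2
  have parts := (hYac.mono hsub).integral_deriv_mul_eq_sub (hZac.mono hsub)
  -- Almost everywhere `Y' = k X ≤ k Y`, so `Y e^{-∫k}` has nonpositive derivative; absolute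
  -- continuity turns this into monotonicity.
  have hneg : ∫ x in (0 : ℝ)..t, (deriv Y x * Z x + Y x * deriv Z x) ≤ 0 := by
    rw [intervalIntegral.integral_of_le ht.1]
    refine integral_nonpos_of_ae ?_
    rw [EventuallyLE, ae_restrict_iff' measurableSet_Ioc]
    -- The sign of `k` is known on the open interval only, while `(0, t]` may contain `T`.
    have hne : ∀ᵐ x : ℝ, x ≠ T := by simp [ae_iff]
    filter_upwards [hki.ae_hasDerivAt_integral, hkXi.ae_hasDerivAt_integral,
      (ae_restrict_iff' measurableSet_Ioo).1 hk0, hne] with x h1 h2 h3 h4 hx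
    have hx' : x ∈ uIcc 0 T := by
      rw [uIcc_of_le hT]; exact ⟨hx.1.le, hx.2.trans ht.2⟩
    have d1 : HasDerivAt Kf (k x) x := h1 hx' 0 (by simp)
    have d2 : HasDerivAt Y (k x * X x) x := (h2 hx' 0 (by simp)).const_add A
    have d3 : HasDerivAt Z (Real.exp (-Kf x) * -k x) x := d1.neg.exp
    have hxT : x ∈ Icc 0 T := ⟨hx.1.le, hx.2.trans ht.2⟩
    have hkx : 0 ≤ k x := h3 ⟨hx.1, lt_of_le_of_ne hxT.2 h4⟩
    have hXY : X x ≤ Y x := H x hxT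
    rw [d2.deriv, d3.deriv]
    have : 0 ≤ k x * (Y x - X x) * Real.exp (-Kf x) := by
      have := sub_nonneg.2 hXY
      positivity
    simp only [hZ, Pi.zero_apply]
    linarith
  rw [parts] at hneg
  have hZ0 : Z 0 = 1 := by simp [hZ, hKf]
  have hY0 : Y 0 = A := by simp [hY]
  rw [hZ0, hY0, mul_one, sub_nonpos] at hneg
  have : Y t = Y t * Z t * Real.exp (Kf t) := by
    rw [hZ, mul_assoc, ← Real.exp_add, neg_add_cancel, Real.exp_zero, mul_one]
  calc Y t = Y t * Z t * Real.exp (Kf t) := this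
    _ ≤ A * Real.exp (Kf t) := by gcongr

/-! ### Pointwise algebra of the convection and of the damping. -/

section

/-- The integrand `∑_{i,j} u_i G_{ij} w_j` of the trilinear form. -/
def tri {d : ℕ} (u : E d) (G : M d) (w : E d) : ℝ := ∑ i, ∑ j, u i * G (i, j) * w j

section tri

variable {d : ℕ}

theorem tri_eq_inner (u : E d) (G : M d) (w : E d) :
    tri u G w = inner ℝ (WithLp.toLp 2 (fun ij : Fin d × Fin d => u ij.1 * w ij.2) : M d) G := by
  simp only [tri, PiLp.inner_apply, Fintype.sum_prod_type, RCLike.inner_apply, conj_trivial]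
  refine Finset.sum_congr rfl fun i _ => Finset.sum_congr rfl fun j _ => ?_
  ring

theorem norm_outer (u w : E d) :
    ‖(WithLp.toLp 2 (fun ij : Fin d × Fin d => u ij.1 * w ij.2) : M d)‖ = ‖u‖ * ‖w‖ := by
  rw [EuclideanSpace.norm_eq, EuclideanSpace.norm_eq, EuclideanSpace.norm_eq,
    ← Real.sqrt_mul (by positivity), Fintype.sum_prod_type, Finset.sum_mul_sum]
  congr 1
  refine Finset.sum_congr rfl fun i _ => Finset.sum_congr rfl fun j _ => ?_
  simp [mul_pow]

theorem abs_tri_le (u : E d) (G : M d) (w : E d) : |tri u G w| ≤ ‖u‖ * ‖w‖ * ‖G‖ := by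
  rw [tri_eq_inner, ← norm_outer]
  exact abs_real_inner_le_norm _ _

theorem tri_add_left (u u' : E d) (G : M d) (w : E d) :
    tri (u + u') G w = tri u G w + tri u' G w := by
  simp [tri, add_mul, Finset.sum_add_distrib]

theorem tri_add_right (u : E d) (G : M d) (w w' : E d) :
    tri u G (w + w') = tri u G w + tri u G w' := by
  simp [tri, mul_add, Finset.sum_add_distrib]

theorem tri_smul_left (c : ℝ) (u : E d) (G : M d) (w : E d) :
    tri (c • u) G w = c * tri u G w := by
  simp [tri, Finset.mul_sum, mul_assoc]

theorem tri_smul_right (c : ℝ) (u : E d) (G : M d) (w : E d) :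
    tri u G (c • w) = c * tri u G w := by
  simp only [tri, Finset.mul_sum, PiLp.smul_apply, smul_eq_mul]
  refine Finset.sum_congr rfl fun i _ => Finset.sum_congr rfl fun j _ => ?_
  ring

end tri

section scalar

theorem add_rpow_le_two_rpow {x y p : ℝ} (hx : 0 ≤ x) (hy : 0 ≤ y) (hp : 0 ≤ p) :
    (x + y) ^ p ≤ 2 ^ p * (x ^ p + y ^ p) := by
  wlog h : x ≤ y generalizing x y
  · rw [add_comm x, add_comm (x ^ p)]; exact this hy hx (le_of_not_ge h)
  calc (x + y) ^ p ≤ (2 * y) ^ p := by gcongr; linarith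
    _ = 2 ^ p * y ^ p := Real.mul_rpow (by norm_num) hy
    _ ≤ _ := by gcongr; linarith [Real.rpow_nonneg hx p]

/-- Young's inequality by comparing `h` with `ε s`: the smaller of the two is replaced by the
larger, whence the constant `ε^{-r}`. -/
theorem exists_rpow_mul_le {r ε : ℝ} (hr : 0 ≤ r) (hε : 0 < ε) :
    ∃ C, 0 ≤ C ∧ ∀ s h : ℝ, 0 ≤ s → 0 ≤ h → s ^ r * h ≤ ε * s ^ (r + 1) + C * h ^ (r + 1) := by
  refine ⟨ε⁻¹ ^ r, by positivity, fun s h hs hh => ?_⟩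
  have hr1 : r + 1 ≠ 0 := by positivity
  rw [Real.rpow_add_one' hs hr1, Real.rpow_add_one' hh hr1]
  have A : 0 ≤ ε⁻¹ ^ r * (h ^ r * h) := by positivity
  have B : 0 ≤ ε * (s ^ r * s) := by positivity
  rcases le_total h (ε * s) with H | H
  · have : s ^ r * h ≤ s ^ r * (ε * s) := by gcongr
    linarith
  · have h1 : s ≤ ε⁻¹ * h := by rw [inv_mul_eq_div, le_div_iff₀ hε]; linarith
    have : s ^ r * h ≤ (ε⁻¹ * h) ^ r * h := by gcongr
    rw [Real.mul_rpow (by positivity) hh] at this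
    linarith

theorem pow_four_le {s p : ℝ} (hs : 0 ≤ s) (hp : 4 ≤ p) : s ^ 4 ≤ s ^ 2 + s ^ p := by
  rcases le_total s 1 with h | h
  · have : s ^ 4 ≤ s ^ 2 := pow_le_pow_of_le_one hs h (by norm_num)
    linarith [Real.rpow_nonneg hs p]
  · have : s ^ (4 : ℝ) ≤ s ^ p := Real.rpow_le_rpow_of_exponent_le h hp
    have e : s ^ (4 : ℝ) = s ^ 4 := by norm_cast
    rw [e] at this
    nlinarith [sq_nonneg s]

theorem rpow_le_sq_add_rpow {s p q : ℝ} (hs : 0 ≤ s) (hp : 2 ≤ p) (hpq : p ≤ q) :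
    s ^ p ≤ s ^ 2 + s ^ q := by
  rcases le_total s 1 with h | h
  · rcases hs.eq_or_lt with rfl | h0
    · rw [Real.zero_rpow (by linarith), Real.zero_rpow (by linarith)]; norm_num
    have : s ^ p ≤ s ^ (2 : ℝ) := Real.rpow_le_rpow_of_exponent_ge h0 h hp
    have e : s ^ (2 : ℝ) = s ^ 2 := by norm_cast
    rw [e] at this
    linarith [Real.rpow_nonneg hs q]
  · have : s ^ p ≤ s ^ q := Real.rpow_le_rpow_of_exponent_le h hpq
    nlinarith [sq_nonneg s]

/-- The quadratic growth of the convection is dominated by the damping. -/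
theorem exists_sq_le_rpow {μ β r : ℝ} (hμ : 0 < μ) (hβ : 0 < β)
    (hr : 3 < r ∨ r = 3 ∧ 1 ≤ 2 * β * μ) :
    ∃ K, 0 ≤ K ∧ ∀ s : ℝ, 0 ≤ s → (6 * μ)⁻¹ * s ^ 2 ≤ β / 3 * s ^ (r - 1) + K := by
  rcases hr with hr | ⟨rfl, hr⟩
  -- Here `s₀^{r-3} = 1/(2μβ)` is the threshold beyond which the damping dominates; below it the
  -- left side is bounded by its value at `s₀`.
  · set s₀ : ℝ := ((2 * μ * β)⁻¹) ^ (r - 3)⁻¹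
    have hs₀ : 0 ≤ s₀ := by positivity
    refine ⟨(6 * μ)⁻¹ * s₀ ^ 2, by positivity, fun s hs => ?_⟩
    rcases le_total s s₀ with h | h
    · have : s ^ 2 ≤ s₀ ^ 2 := by gcongr
      have h2 : 0 ≤ β / 3 * s ^ (r - 1) := by positivity
      have h3 : (6 * μ)⁻¹ * s ^ 2 ≤ (6 * μ)⁻¹ * s₀ ^ 2 := by gcongr
      linarith
    · have h1 : (2 * μ * β)⁻¹ ≤ s ^ (r - 3) := by
        calc (2 * μ * β)⁻¹ = s₀ ^ (r - 3) := by
              rw [← Real.rpow_mul (by positivity), inv_mul_cancel₀ (by linarith), Real.rpow_one]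
          _ ≤ _ := Real.rpow_le_rpow hs₀ h (by linarith)
      have h2 : s ^ (r - 1) = s ^ (r - 3) * s ^ 2 := by
        rw [← Real.rpow_natCast s 2, ← Real.rpow_add' hs (by push_cast; linarith)]
        congr 1; push_cast; ring
      have h3 : (6 * μ)⁻¹ = β / 3 * (2 * μ * β)⁻¹ := by field_simp; norm_num
      have h4 : 0 ≤ (6 * μ)⁻¹ * s₀ ^ 2 := by positivity
      rw [h2, h3, mul_assoc]
      have : β / 3 * ((2 * μ * β)⁻¹ * s ^ 2) ≤ β / 3 * (s ^ (r - 3) * s ^ 2) := by gcongr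
      rw [h3] at h4
      linarith
  -- Both sides are quadratic, and `(6μ)⁻¹ ≤ β/3` is exactly `2βμ ≥ 1`.
  · refine ⟨0, le_rfl, fun s hs => ?_⟩
    have e : s ^ ((3 : ℝ) - 1) = s ^ 2 := by norm_num
    rw [e, add_zero]
    gcongr
    rw [inv_le_iff_one_le_mul₀ (by positivity)]
    linarith

end scalar

section damp

variable {d : ℕ}

/-- By polarization the right side equals the left side plus `½ (|a|^{r-1} - |b|^{r-1})(|a|² -
|b|²)`, a product of factors of equal sign. -/
theorem damp_monotone {r : ℝ} (hr : 1 ≤ r) (a b : E d) :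
    (‖a‖ ^ (r - 1) + ‖b‖ ^ (r - 1)) / 2 * ‖a - b‖ ^ 2 ≤
      ‖a‖ ^ (r - 1) * inner ℝ a (a - b) - ‖b‖ ^ (r - 1) * inner ℝ b (a - b) := by
  have h1 : 0 ≤ (‖a‖ ^ (r - 1) - ‖b‖ ^ (r - 1)) * (‖a‖ ^ 2 - ‖b‖ ^ 2) := by
    rcases le_total ‖a‖ ‖b‖ with h | h
    · refine mul_nonneg_of_nonpos_of_nonpos (sub_nonpos.2 ?_) (sub_nonpos.2 ?_)
      · exact Real.rpow_le_rpow (norm_nonneg _) h (by linarith)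
      · gcongr
    · refine mul_nonneg (sub_nonneg.2 ?_) (sub_nonneg.2 ?_)
      · exact Real.rpow_le_rpow (norm_nonneg _) h (by linarith)
      · gcongr
  rw [norm_sub_sq_real, inner_sub_right, inner_sub_right, real_inner_self_eq_norm_sq,
    real_inner_self_eq_norm_sq, real_inner_comm a b]
  linarith

theorem abs_damp_le {r : ℝ} (hr : 1 ≤ r) (a h : E d) :
    |‖a‖ ^ (r - 1) * inner ℝ a h| ≤ ‖a‖ ^ r * ‖h‖ := by
  rw [abs_mul, abs_of_nonneg (by positivity)]
  have e : ‖a‖ ^ r = ‖a‖ ^ (r - 1) * ‖a‖ := by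
    rw [← Real.rpow_add_one' (norm_nonneg _) (by linarith)]; congr 1; ring
  rw [e, mul_assoc]
  gcongr
  exact abs_real_inner_le_norm _ _

/-- The damping controls the `(r+1)`-th power of the difference. -/
theorem exists_damp_le {β r : ℝ} (hβ : 0 < β) (hr : 1 ≤ r) :
    ∃ c, 0 < c ∧ ∀ ρ > 0, ∀ ε > 0, ∃ C, 0 ≤ C ∧ ∀ a b w η : E d, a - b = w + η →
      -β * (‖a‖ ^ (r - 1) * inner ℝ a w - ‖b‖ ^ (r - 1) * inner ℝ b w) ≤
        -(β / 3) * ((‖a‖ ^ (r - 1) + ‖b‖ ^ (r - 1)) * ‖w + η‖ ^ 2) - c * ‖w + η‖ ^ (r + 1)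
        + ρ * ‖w + η‖ ^ (r + 1) + ε * ‖b‖ ^ (r + 1) + C * ‖η‖ ^ (r + 1) := by
  -- Monotonicity provides `β/2 = β/3 + β/6` times the weighted square. The share `β/3` is kept to
  -- absorb the convection; the share `β/6` becomes `|w + η|^{r+1}`, using `|a - b|^{r-1} ≤ 2^{r-1}
  -- (|a|^{r-1} + |b|^{r-1})`. Replacing `w + η` by `w` in the test direction costs terms `|a|^r
  -- |η|` and `|b|^r |η|`, split by Young. The constant `c` must not depend on `ρ` and `ε`.
  refine ⟨β / 6 * (2 ^ (r - 1))⁻¹, by positivity, fun ρ hρ ε hε => ?_⟩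
  set L : ℝ := β * (2 ^ r + 1)
  have hL : 0 < L := by positivity
  obtain ⟨C₁, hC₁, H₁⟩ := exists_rpow_mul_le (r := r) (by linarith) (div_pos hρ hL)
  obtain ⟨C₂, hC₂, H₂⟩ := exists_rpow_mul_le (r := r) (by linarith) (div_pos hε hL)
  refine ⟨L * C₁ + L * C₂, by positivity, fun a b w η hab => ?_⟩
  have hw : w = (a - b) - η := by rw [hab]; abel
  have h1 := damp_monotone hr a b
  rw [hab] at h1
  have hS : ‖w + η‖ ^ (r + 1) ≤
      2 ^ (r - 1) * (‖a‖ ^ (r - 1) + ‖b‖ ^ (r - 1)) * ‖w + η‖ ^ 2 := by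
    have e : ‖w + η‖ ^ (r + 1) = ‖w + η‖ ^ (r - 1) * ‖w + η‖ ^ 2 := by
      rw [← Real.rpow_natCast ‖w + η‖ 2, ← Real.rpow_add' (norm_nonneg _) (by push_cast; linarith)]
      congr 1; push_cast; ring
    rw [e]
    gcongr
    refine le_trans ?_ (add_rpow_le_two_rpow (norm_nonneg a) (norm_nonneg b) (by linarith))
    rw [← hab]
    exact Real.rpow_le_rpow (norm_nonneg _) (norm_sub_le _ _) (by linarith)
  have hS' : (2 ^ (r - 1))⁻¹ * ‖w + η‖ ^ (r + 1) ≤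
      (‖a‖ ^ (r - 1) + ‖b‖ ^ (r - 1)) * ‖w + η‖ ^ 2 := by
    rw [inv_mul_le_iff₀ (by positivity), ← mul_assoc]; exact hS
  have ha : ‖a‖ ^ r ≤ 2 ^ r * (‖b‖ ^ r + ‖w + η‖ ^ r) := by
    refine le_trans ?_ (add_rpow_le_two_rpow (norm_nonneg b) (norm_nonneg _) (by linarith))
    refine Real.rpow_le_rpow (norm_nonneg _) ?_ (by linarith)
    calc ‖a‖ = ‖b + (w + η)‖ := by rw [← hab]; congr 1; abel
      _ ≤ _ := norm_add_le _ _
  have i1 := abs_le.1 (abs_damp_le hr a η)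
  have i2 := abs_le.1 (abs_damp_le hr b η)
  have j1 := H₁ ‖w + η‖ ‖η‖ (norm_nonneg _) (norm_nonneg _)
  have j2 := H₂ ‖b‖ ‖η‖ (norm_nonneg _) (norm_nonneg _)
  have k1 : L * (‖w + η‖ ^ r * ‖η‖) ≤ ρ * ‖w + η‖ ^ (r + 1) + L * C₁ * ‖η‖ ^ (r + 1) := by
    calc _ ≤ L * (ρ / L * ‖w + η‖ ^ (r + 1) + C₁ * ‖η‖ ^ (r + 1)) := by gcongr
      _ = _ := by field_simp
  have k2 : L * (‖b‖ ^ r * ‖η‖) ≤ ε * ‖b‖ ^ (r + 1) + L * C₂ * ‖η‖ ^ (r + 1) := by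
    calc _ ≤ L * (ε / L * ‖b‖ ^ (r + 1) + C₂ * ‖η‖ ^ (r + 1)) := by gcongr
      _ = _ := by field_simp
  have l1 : β * (‖a‖ ^ r * ‖η‖ + ‖b‖ ^ r * ‖η‖) ≤
      L * (‖w + η‖ ^ r * ‖η‖) + L * (‖b‖ ^ r * ‖η‖) := by
    have : ‖a‖ ^ r * ‖η‖ ≤ 2 ^ r * (‖b‖ ^ r + ‖w + η‖ ^ r) * ‖η‖ := by gcongr
    have p1 : 0 ≤ ‖w + η‖ ^ r * ‖η‖ := by positivity
    have : ‖a‖ ^ r * ‖η‖ + ‖b‖ ^ r * ‖η‖ ≤ (2 ^ r + 1) * (‖w + η‖ ^ r * ‖η‖ + ‖b‖ ^ r * ‖η‖) := by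
      nlinarith
    calc _ ≤ β * ((2 ^ r + 1) * (‖w + η‖ ^ r * ‖η‖ + ‖b‖ ^ r * ‖η‖)) := by gcongr
      _ = _ := by simp only [L]; ring
  have m1 : -β * (‖a‖ ^ (r - 1) * inner ℝ a w - ‖b‖ ^ (r - 1) * inner ℝ b w) =
      -β * (‖a‖ ^ (r - 1) * inner ℝ a (w + η) - ‖b‖ ^ (r - 1) * inner ℝ b (w + η)) +
      β * (‖a‖ ^ (r - 1) * inner ℝ a η - ‖b‖ ^ (r - 1) * inner ℝ b η) := by
    rw [inner_add_right, inner_add_right]; ring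
  have m2 : β * (‖a‖ ^ (r - 1) * inner ℝ a η - ‖b‖ ^ (r - 1) * inner ℝ b η) ≤
      β * (‖a‖ ^ r * ‖η‖ + ‖b‖ ^ r * ‖η‖) := by gcongr; linarith
  have m3 : β * ((‖a‖ ^ (r - 1) + ‖b‖ ^ (r - 1)) / 2 * ‖w + η‖ ^ 2) ≤
    β * (‖a‖ ^ (r - 1) * inner ℝ a (w + η) - ‖b‖ ^ (r - 1) * inner ℝ b (w + η)) := by gcongr
  have m4 : β / 6 * ((2 ^ (r - 1))⁻¹ * ‖w + η‖ ^ (r + 1)) ≤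
    β / 6 * ((‖a‖ ^ (r - 1) + ‖b‖ ^ (r - 1)) * ‖w + η‖ ^ 2) := by gcongr
  rw [m1]
  linarith

end damp

end

/-! ### Pointwise estimate of the difference of the nonlinear terms. -/

theorem mul_le_mul_sq_add {ε : ℝ} (hε : 0 < ε) (p q : ℝ) : p * q ≤ ε * p ^ 2 + (4 * ε)⁻¹ * q ^ 2 := by
  have h : 0 ≤ ε * (p - (2 * ε)⁻¹ * q) ^ 2 := by positivity
  have e : ε * (p - (2 * ε)⁻¹ * q) ^ 2 = ε * p ^ 2 - p * q + (4 * ε)⁻¹ * q ^ 2 := by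
    field_simp; ring
  linarith

theorem norm_rpow_le_of_add {F : Type*} [NormedAddCommGroup F] {p : ℝ} (hp : 0 ≤ p) (w η : F) :
    (2 ^ p)⁻¹ * ‖w‖ ^ p - ‖η‖ ^ p ≤ ‖w + η‖ ^ p := by
  have h1 : ‖w‖ ≤ ‖w + η‖ + ‖η‖ := by
    simpa using norm_sub_le (w + η) η
  have h2 : ‖w‖ ^ p ≤ 2 ^ p * (‖w + η‖ ^ p + ‖η‖ ^ p) :=
    (Real.rpow_le_rpow (norm_nonneg _) h1 hp).trans
      (add_rpow_le_two_rpow (norm_nonneg _) (norm_nonneg _) hp)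
  rw [← inv_mul_le_iff₀ (by positivity)] at h2
  linarith

theorem norm_add_sq_le_two {F : Type*} [NormedAddCommGroup F] (w η : F) :
    ‖w + η‖ ^ 2 ≤ 2 * ‖w‖ ^ 2 + 2 * ‖η‖ ^ 2 := by
  have h := norm_add_le w η
  have : ‖w + η‖ ^ 2 ≤ (‖w‖ + ‖η‖) ^ 2 := by gcongr
  nlinarith [sq_nonneg (‖w‖ - ‖η‖)]

/-- With `m = (a + b)/2` and `δ = a - b` one has `a ⊗ a - b ⊗ b = δ ⊗ m + m ⊗ δ`, and subtracting
`tri m D w` leaves `tri δ D m + tri m D η`. The midpoint matters at `r = 3`: since `|m|² ≤ (|a|² +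
|b|²)/2`, both damping weights are used, which leaves slack even for `2βμ = 1`. With `b` instead of
`m`, this argument would spend all of the viscosity and of the damping there. -/
theorem exists_difference_le_of_three_le {d : ℕ} {μ β r : ℝ} (hμ : 0 < μ) (hβ : 0 < β)
    (hr : 3 < r ∨ r = 3 ∧ 1 ≤ 2 * β * μ) :
    ∃ c C, 0 < c ∧ 0 ≤ C ∧ ∀ ε > 0, ∃ Cε, 0 ≤ Cε ∧ ∀ (a b w η : E d) (D : M d), a - b = w + η →
      tri a D a - tri b D b - tri (b + (1 / 2 : ℝ) • (a - b)) D w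
          - β * (‖a‖ ^ (r - 1) * inner ℝ a w - ‖b‖ ^ (r - 1) * inner ℝ b w) ≤
        7 / 8 * μ * ‖D‖ ^ 2 - c * ‖w‖ ^ (r + 1) + C * ‖w‖ ^ 2
          + ε * (‖b‖ ^ 4 + ‖b‖ ^ (r + 1))
          + Cε * (‖η‖ ^ 2 + ‖η‖ ^ 4 + ‖η‖ ^ (r + 1)) := by
  have hr3 : 3 ≤ r := by rcases hr with h | h <;> linarith [h]
  obtain ⟨K, hK, HK⟩ := exists_sq_le_rpow hμ hβ hr
  obtain ⟨c, hc, H⟩ := exists_damp_le (d := d) (r := r) hβ (by linarith)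
  refine ⟨c / 2 * (2 ^ (r + 1))⁻¹, 2 * (2 * K + c / 4), by positivity, by positivity,
    fun ε hε => ?_⟩
  obtain ⟨C₁, hC₁, H₁⟩ := H (c / 4) (by positivity) ε hε
  set N : ℝ := (4 * ε)⁻¹ * (4 / μ) ^ 2 + (4 * (c / 4))⁻¹ * (1 / μ) ^ 2
  have hN : 0 ≤ N := by positivity
  refine ⟨C₁ + c / 2 + N + 2 * (2 * K + c / 4), by positivity, fun a b w η D hab => ?_⟩
  have h1 := H₁ a b w η hab
  set δ := w + η with hδ
  set m := b + (1 / 2 : ℝ) • (a - b) with hm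
  have hsplit : tri a D a - tri b D b - tri m D w = tri δ D m + tri m D η := by
    have ha : a = m + (1 / 2 : ℝ) • δ := by rw [hm, ← hab]; module
    have hb : b = m + (-(1 / 2) : ℝ) • δ := by rw [hm, ← hab]; module
    have hw : tri m D w = tri m D δ - tri m D η := by rw [hδ, tri_add_right]; ring
    rw [hw]
    conv_lhs => rw [ha, hb]
    simp only [tri_add_left, tri_add_right, tri_smul_left, tri_smul_right]
    ring
  have hm1 : ‖m‖ ^ 2 ≤ (‖a‖ ^ 2 + ‖b‖ ^ 2) / 2 := by
    have : m = (1 / 2 : ℝ) • (a + b) := by rw [hm]; module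
    rw [this, norm_smul, mul_pow]
    have := norm_add_sq_le_two a b
    norm_num
    linarith
  have hm2 : ‖m‖ ^ 2 ≤ 2 * ‖b‖ ^ 2 + ‖δ‖ ^ 2 / 2 := by
    have := norm_add_sq_le_two b ((1 / 2 : ℝ) • (a - b))
    rw [norm_smul, mul_pow, hab] at this
    norm_num at this
    rw [hm, hab]
    norm_num
    linarith
  -- Young with `3μ/4`: after the midpoint bound the factor is `(6μ)⁻¹` on each of `|a|²` and
  -- `|b|²`, the coefficient of `exists_sq_le_rpow`. The next step spends another `μ/8`, in total
  -- `7μ/8`.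
  have t1 : tri δ D m ≤ 3 / 4 * μ * ‖D‖ ^ 2 + (3 * μ)⁻¹ * (‖δ‖ ^ 2 * ‖m‖ ^ 2) := by
    have := mul_le_mul_sq_add (by positivity : 0 < 3 / 4 * μ) ‖D‖ (‖δ‖ * ‖m‖)
    have e : (4 * (3 / 4 * μ))⁻¹ = (3 * μ)⁻¹ := by congr 1; ring
    rw [e, mul_pow ‖δ‖] at this
    linarith [le_of_abs_le (abs_tri_le δ D m)]
  have t2 : tri m D η ≤ 1 / 8 * μ * ‖D‖ ^ 2 + 2 / μ * (‖m‖ ^ 2 * ‖η‖ ^ 2) := by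
    have := mul_le_mul_sq_add (by positivity : 0 < 1 / 8 * μ) ‖D‖ (‖m‖ * ‖η‖)
    have e : (4 * (1 / 8 * μ))⁻¹ = 2 / μ := by field_simp; norm_num
    rw [e, mul_pow ‖m‖] at this
    linarith [le_of_abs_le (abs_tri_le m D η)]
  have t3 : (3 * μ)⁻¹ * (‖δ‖ ^ 2 * ‖m‖ ^ 2) ≤
      β / 3 * ((‖a‖ ^ (r - 1) + ‖b‖ ^ (r - 1)) * ‖δ‖ ^ 2) + 2 * K * ‖δ‖ ^ 2 := by
    have k1 := HK ‖a‖ (norm_nonneg _)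
    have k2 := HK ‖b‖ (norm_nonneg _)
    calc _ ≤ (3 * μ)⁻¹ * (‖δ‖ ^ 2 * ((‖a‖ ^ 2 + ‖b‖ ^ 2) / 2)) := by gcongr
      _ = ((6 * μ)⁻¹ * ‖a‖ ^ 2 + (6 * μ)⁻¹ * ‖b‖ ^ 2) * ‖δ‖ ^ 2 := by field_simp; ring
      _ ≤ ((β / 3 * ‖a‖ ^ (r - 1) + K) + (β / 3 * ‖b‖ ^ (r - 1) + K)) * ‖δ‖ ^ 2 := by gcongr
      _ = _ := by ring
  have t4 : 2 / μ * (‖m‖ ^ 2 * ‖η‖ ^ 2) ≤ ε * ‖b‖ ^ 4 + c / 4 * ‖δ‖ ^ 4 + N * ‖η‖ ^ 4 := by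
    have k1 := mul_le_mul_sq_add hε (‖b‖ ^ 2) (4 / μ * ‖η‖ ^ 2)
    have k2 := mul_le_mul_sq_add (by positivity : 0 < c / 4) (‖δ‖ ^ 2) (1 / μ * ‖η‖ ^ 2)
    calc _ ≤ 2 / μ * ((2 * ‖b‖ ^ 2 + ‖δ‖ ^ 2 / 2) * ‖η‖ ^ 2) := by gcongr
      _ = ‖b‖ ^ 2 * (4 / μ * ‖η‖ ^ 2) + ‖δ‖ ^ 2 * (1 / μ * ‖η‖ ^ 2) := by field_simp; ring
      _ ≤ _ := add_le_add k1 k2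
      _ = _ := by simp only [N]; ring
  have t5 : c / 4 * ‖δ‖ ^ 4 ≤ c / 4 * ‖δ‖ ^ 2 + c / 4 * ‖δ‖ ^ (r + 1) := by
    rw [← mul_add]
    gcongr
    exact pow_four_le (norm_nonneg _) (by linarith)
  have t6 : (2 * K + c / 4) * ‖δ‖ ^ 2 ≤ (2 * K + c / 4) * (2 * ‖w‖ ^ 2 + 2 * ‖η‖ ^ 2) := by
    gcongr; exact norm_add_sq_le_two w η
  have t7 : c / 2 * ((2 ^ (r + 1))⁻¹ * ‖w‖ ^ (r + 1) - ‖η‖ ^ (r + 1)) ≤ c / 2 * ‖δ‖ ^ (r + 1) := by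
    gcongr; exact norm_rpow_le_of_add (by linarith) w η
  rw [hsplit]
  have p1 : 0 ≤ (C₁ + c / 2 + N + 2 * (2 * K + c / 4)) * ‖η‖ ^ 2 -
    2 * (2 * K + c / 4) * ‖η‖ ^ 2 := by
    rw [← sub_mul]; apply mul_nonneg _ (by positivity); linarith
  have p2 : 0 ≤ (C₁ + c / 2 + N + 2 * (2 * K + c / 4)) * ‖η‖ ^ 4 - N * ‖η‖ ^ 4 := by
    rw [← sub_mul]; apply mul_nonneg _ (by positivity); linarith
  have p3 : 0 ≤ (C₁ + c / 2 + N + 2 * (2 * K + c / 4)) * ‖η‖ ^ (r + 1) -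
      (C₁ + c / 2) * ‖η‖ ^ (r + 1) := by
    rw [← sub_mul]; apply mul_nonneg _ (by positivity); linarith
  linarith

/-- No smallness or growth condition is needed if `C₂ |w|² (|b|² + |η|²)` is tolerated. Subtracting
`tri a D w` leaves `tri (w + η) D b + tri a D η`, which is estimated by Young; the damping only
supplies its good sign and the power `|w|^{r+1}`. -/
theorem exists_difference_le {d : ℕ} {μ β r : ℝ} (hμ : 0 < μ) (hβ : 0 < β) (hr : 1 ≤ r) :
    ∃ c C C₂, 0 < c ∧ 0 ≤ C ∧ 0 ≤ C₂ ∧ ∀ ε > 0, ∃ Cε, 0 ≤ Cε ∧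
      ∀ (a b w η : E d) (D : M d), a - b = w + η →
      tri a D a - tri b D b - tri a D w
          - β * (‖a‖ ^ (r - 1) * inner ℝ a w - ‖b‖ ^ (r - 1) * inner ℝ b w) ≤
        3 / 4 * μ * ‖D‖ ^ 2 - c * ‖w‖ ^ (r + 1) + C * ‖w‖ ^ 2
          + C₂ * (‖w‖ ^ 2 * (‖b‖ ^ 2 + ‖η‖ ^ 2))
          + ε * (‖b‖ ^ 4 + ‖b‖ ^ (r + 1))
          + Cε * (‖η‖ ^ 2 + ‖η‖ ^ 4 + ‖η‖ ^ (r + 1)) := by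
  obtain ⟨c, hc, H⟩ := exists_damp_le (d := d) (r := r) hβ hr
  refine ⟨c / 2 * (2 ^ (r + 1))⁻¹, 0, 4 * (3 * μ)⁻¹, by positivity, le_rfl, by positivity,
    fun ε hε => ?_⟩
  obtain ⟨C₁, hC₁, H₁⟩ := H (c / 2) (by positivity) ε hε
  set N : ℝ := (4 * ε)⁻¹ * (16 * (3 * μ)⁻¹) ^ 2 + 4 * (3 * μ)⁻¹
  have hN : 0 ≤ N := by positivity
  refine ⟨C₁ + c / 2 + N, by positivity, fun a b w η D hab => ?_⟩
  have h1 := H₁ a b w η hab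
  have ha : a = b + (w + η) := by rw [← hab]; abel
  have hsplit : tri a D a - tri b D b - tri a D w = tri (w + η) D b + tri a D η := by
    rw [ha]
    simp only [tri_add_left, tri_add_right]
    ring
  have na : ‖a‖ ≤ ‖b‖ + (‖w‖ + ‖η‖) := by
    rw [ha]; exact (norm_add_le _ _).trans (by gcongr; exact norm_add_le _ _)
  set q := ‖w‖ * ‖b‖ + 2 * (‖b‖ * ‖η‖) + ‖w‖ * ‖η‖ + ‖η‖ ^ 2 with hq
  have t1 : tri (w + η) D b + tri a D η ≤ ‖D‖ * q := by
    have i1 := le_of_abs_le (abs_tri_le (w + η) D b)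
    have i2 := le_of_abs_le (abs_tri_le a D η)
    have i3 : ‖w + η‖ * ‖b‖ * ‖D‖ ≤ (‖w‖ + ‖η‖) * ‖b‖ * ‖D‖ := by
      gcongr; exact norm_add_le _ _
    have i4 : ‖a‖ * ‖η‖ * ‖D‖ ≤ (‖b‖ + (‖w‖ + ‖η‖)) * ‖η‖ * ‖D‖ := by gcongr
    have : ‖D‖ * q = (‖w‖ + ‖η‖) * ‖b‖ * ‖D‖ + (‖b‖ + (‖w‖ + ‖η‖)) * ‖η‖ * ‖D‖ := by
      rw [hq]; ring
    linarith
  have t2 : ‖D‖ * q ≤ 3 / 4 * μ * ‖D‖ ^ 2 + (3 * μ)⁻¹ * q ^ 2 := by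
    have := mul_le_mul_sq_add (by positivity : 0 < 3 / 4 * μ) ‖D‖ q
    have e : (4 * (3 / 4 * μ))⁻¹ = (3 * μ)⁻¹ := by congr 1; ring
    rwa [e] at this
  have t3 : q ^ 2 ≤ 4 * (‖w‖ ^ 2 * (‖b‖ ^ 2 + ‖η‖ ^ 2)) + 16 * (‖b‖ ^ 2 * ‖η‖ ^ 2) +
      4 * ‖η‖ ^ 4 := by
    have : ∀ A B C D : ℝ, (A + B + C + D) ^ 2 ≤ 4 * (A ^ 2 + B ^ 2 + C ^ 2 + D ^ 2) := by
      intro A B C D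
      nlinarith [sq_nonneg (A - B), sq_nonneg (A - C), sq_nonneg (A - D), sq_nonneg (B - C),
        sq_nonneg (B - D), sq_nonneg (C - D)]
    refine (this _ _ _ _).trans (le_of_eq ?_)
    ring
  have t3' : (3 * μ)⁻¹ * q ^ 2 ≤ (3 * μ)⁻¹ * (4 * (‖w‖ ^ 2 * (‖b‖ ^ 2 + ‖η‖ ^ 2)) +
      16 * (‖b‖ ^ 2 * ‖η‖ ^ 2) + 4 * ‖η‖ ^ 4) := by gcongr
  have t4 := mul_le_mul_sq_add hε (‖b‖ ^ 2) (16 * (3 * μ)⁻¹ * ‖η‖ ^ 2)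
  have t4' : ‖b‖ ^ 2 * (16 * (3 * μ)⁻¹ * ‖η‖ ^ 2) + 4 * (3 * μ)⁻¹ * ‖η‖ ^ 4 ≤
      ε * ‖b‖ ^ 4 + N * ‖η‖ ^ 4 := by
    refine (add_le_add_left t4 _).trans (le_of_eq ?_)
    simp only [N]; ring
  have t7 : c / 2 * ((2 ^ (r + 1))⁻¹ * ‖w‖ ^ (r + 1) - ‖η‖ ^ (r + 1)) ≤
      c / 2 * ‖w + η‖ ^ (r + 1) := by
    gcongr; exact norm_rpow_le_of_add (by linarith) w η
  have t8 : 0 ≤ β / 3 * ((‖a‖ ^ (r - 1) + ‖b‖ ^ (r - 1)) * ‖w + η‖ ^ 2) := by positivity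
  rw [hsplit]
  have p1 : 0 ≤ (C₁ + c / 2 + N) * ‖η‖ ^ 2 := by positivity
  have p2 : 0 ≤ (C₁ + c / 2) * ‖η‖ ^ 4 := by positivity
  have p3 : 0 ≤ N * ‖η‖ ^ (r + 1) := by positivity
  linarith

/-! ### Ladyzhenskaya and Sobolev inequalities for test fields. -/

section

variable {d : ℕ} {O : Set (E d)}

theorem norm_fderiv_le_norm_gradField (φ : E d → E d) (x : E d) :
    ‖fderiv ℝ φ x‖ ≤ ‖gradField φ x‖ := by
  refine ContinuousLinearMap.opNorm_le_bound _ (norm_nonneg _) fun v => ?_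
  have hv : v = ∑ i, v i • (EuclideanSpace.single i (1 : ℝ) : E d) := by
    ext j; simp [Finset.sum_apply, Pi.single_apply]
  have hg : ‖gradField φ x‖ = √(∑ i, ‖fderiv ℝ φ x (EuclideanSpace.single i 1)‖ ^ 2) := by
    rw [EuclideanSpace.norm_eq, Fintype.sum_prod_type]
    congr 1
    refine Finset.sum_congr rfl fun i _ => ?_
    rw [EuclideanSpace.norm_sq_eq]
    rfl
  calc ‖fderiv ℝ φ x v‖ = ‖∑ i, v i • fderiv ℝ φ x (EuclideanSpace.single i 1)‖ := by
        conv_lhs => rw [hv]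
        simp only [map_sum, map_smul]
    _ ≤ ∑ i, ‖fderiv ℝ φ x (EuclideanSpace.single i 1)‖ * ‖v i‖ := by
        refine (norm_sum_le _ _).trans (le_of_eq ?_)
        refine Finset.sum_congr rfl fun i _ => ?_
        rw [norm_smul, mul_comm]
    _ ≤ √(∑ i, ‖fderiv ℝ φ x (EuclideanSpace.single i 1)‖ ^ 2) * √(∑ i, ‖v i‖ ^ 2) :=
        Real.sum_mul_le_sqrt_mul_sqrt _ _ _
    _ = _ := by rw [hg, EuclideanSpace.norm_eq v]

theorem lintegral_mul_sq_le {α : Type*} [MeasurableSpace α] {μ : Measure α} {f g : α → ℝ≥0∞}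
    (hf : AEMeasurable f μ) (hg : AEMeasurable g μ) :
    (∫⁻ x, f x * g x ∂μ) ^ 2 ≤ (∫⁻ x, f x ^ 2 ∂μ) * ∫⁻ x, g x ^ 2 ∂μ := by
  have h := ENNReal.lintegral_mul_le_Lp_mul_Lq μ Real.HolderConjugate.two_two hf hg
  have e : ∀ a : ℝ≥0∞, (a ^ (1 / (2 : ℝ))) ^ 2 = a := fun a => by
    rw [← ENNReal.rpow_natCast, ← ENNReal.rpow_mul]; norm_num
  calc _ ≤ ((∫⁻ x, f x ^ (2 : ℝ) ∂μ) ^ (1 / (2 : ℝ)) *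
        (∫⁻ x, g x ^ (2 : ℝ) ∂μ) ^ (1 / (2 : ℝ))) ^ 2 := by gcongr; exact h
    _ = _ := by simp only [mul_pow, e, ENNReal.rpow_two]

theorem gradField_add {φ ψ : E d → E d} (hφ : Differentiable ℝ φ) (hψ : Differentiable ℝ ψ)
    (x : E d) : gradField (φ + ψ) x = gradField φ x + gradField ψ x := by
  ext ij
  simp [gradField, fderiv_add (hφ x) (hψ x)]

theorem gradField_smul {φ : E d → E d} (hφ : Differentiable ℝ φ) (c : ℝ)
    (x : E d) : gradField (c • φ) x = c • gradField φ x := by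
  ext ij
  simp [gradField, fderiv_const_smul (hφ x)]

namespace IsTestField

theorem differentiable {φ : E d → E d} (h : IsTestField O φ) : Differentiable ℝ φ :=
  h.smooth.differentiable (by simp)

theorem zero : IsTestField O (0 : E d → E d) where
  smooth := contDiff_const
  compact := HasCompactSupport.zero
  support := by
    have : tsupport (0 : E d → E d) = ∅ := by rw [tsupport_eq_empty_iff]
    simp [this]
  div_free x := by simp [divergence]

theorem add {φ ψ : E d → E d} (h : IsTestField O φ) (h' : IsTestField O ψ) :
    IsTestField O (φ + ψ) where
  smooth := h.smooth.add h'.smooth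
  compact := h.compact.add h'.compact
  support := (tsupport_add _ _).trans (union_subset h.support h'.support)
  div_free x := by
    have e := h.div_free x
    have e' := h'.div_free x
    simp only [divergence] at e e' ⊢
    simp [fderiv_add (h.differentiable x) (h'.differentiable x), Finset.sum_add_distrib, e, e']

theorem smul {φ : E d → E d} (h : IsTestField O φ) (c : ℝ) : IsTestField O (c • φ) where
  smooth := contDiff_const.smul h.smooth
  compact := h.compact.smul_left (f := fun _ => c)
  support := (tsupport_smul_subset_right (fun _ => c) φ).trans h.support
  div_free x := by
    have e := h.div_free x
    simp only [divergence] at e ⊢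
    simp [fderiv_const_smul (h.differentiable x), ← Finset.mul_sum, e]

theorem continuous_gradField {φ : E d → E d} (h : IsTestField O φ) :
    Continuous (gradField φ) := by
  have : Continuous (fderiv ℝ φ) := h.smooth.continuous_fderiv (by simp)
  refine (PiLp.continuous_toLp 2 _).comp ?_
  refine continuous_pi fun ij => ?_
  fun_prop

theorem gradField_eq_zero {φ : E d → E d} (h : IsTestField O φ) {x : E d} (hx : x ∉ O) :
    gradField φ x = 0 := by
  have : fderiv ℝ φ x = 0 := by
    have : x ∉ tsupport (fderiv ℝ φ) := fun h' => hx (h.support (tsupport_fderiv_subset ℝ h'))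
    exact image_eq_zero_of_notMem_tsupport this
  ext ij; simp [gradField, this]

theorem eq_zero {φ : E d → E d} (h : IsTestField O φ) {x : E d} (hx : x ∉ O) : φ x = 0 :=
  image_eq_zero_of_notMem_tsupport fun h' => hx (h.support h')

/-- A test field and its gradient vanish off `O`, so inequalities on the whole space apply without
any regularity of the boundary. -/
theorem setLIntegral_eq (hO : IsOpen O) {φ : E d → E d} (h : IsTestField O φ)
    {F : E d → M d → ℝ≥0∞} (hF : F 0 0 = 0) :
    ∫⁻ x in O, F (φ x) (gradField φ x) = ∫⁻ x, F (φ x) (gradField φ x) := by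
  rw [← lintegral_add_compl (μ := volume) _ hO.measurableSet]
  have : ∫⁻ x in Oᶜ, F (φ x) (gradField φ x) = 0 := by
    rw [← lintegral_zero (μ := volume.restrict Oᶜ)]
    refine setLIntegral_congr_fun hO.measurableSet.compl fun x hx => ?_
    simp only [h.eq_zero hx, h.gradField_eq_zero hx, hF]
  rw [this, add_zero]

/-- **Ladyzhenskaya's inequality** in the plane. -/
theorem exists_lintegral_four_le_planar (hd : d = 2) (hO : IsOpen O) :
    ∃ C : ℝ≥0∞, C ≠ ⊤ ∧ ∀ φ : E d → E d, IsTestField O φ →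
      ∫⁻ x in O, ‖φ x‖ₑ ^ 4 ≤
        C * ((∫⁻ x in O, ‖φ x‖ₑ ^ 2) * ∫⁻ x in O, ‖gradField φ x‖ₑ ^ 2) := by
  subst hd
  refine ⟨lintegralPowLePowLIntegralFDerivConst (volume : Measure (E 2)) 2 * 4,
    by finiteness, fun φ h => ?_⟩
  rw [h.setLIntegral_eq hO (F := fun u _ => ‖u‖ₑ ^ 4) (by simp),
    h.setLIntegral_eq hO (F := fun u _ => ‖u‖ₑ ^ 2) (by simp),
    h.setLIntegral_eq hO (F := fun _ G => ‖G‖ₑ ^ 2) (by simp)]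
  have hconj : Real.HolderConjugate (Module.finrank ℝ (E 2)) 2 := by
    rw [finrank_euclideanSpace_fin]
    exact Real.HolderConjugate.two_two
  have hU : ContDiff ℝ 1 fun x => ‖φ x‖ ^ 2 := (h.smooth.of_le (mod_cast le_top)).norm_sq ℝ
  have hUc : HasCompactSupport fun x => ‖φ x‖ ^ 2 := by
    refine h.compact.mono ?_
    intro x hx h0
    exact hx (by simp [h0])
  -- The planar embedding of `W^{1,1}` in `L²` is applied to `|φ|²`. Since `|∇|φ|²| ≤ 2 |φ| |∇φ|`,
  -- Cauchy–Schwarz finishes, with `4 = 2²` in the constant.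
  have key := lintegral_pow_le_pow_lintegral_fderiv (volume : Measure (E 2)) hU hUc hconj
  have hfd : ∀ x, ‖fderiv ℝ (fun x => ‖φ x‖ ^ 2) x‖ₑ ≤ 2 * (‖φ x‖ₑ * ‖gradField φ x‖ₑ) := by
    intro x
    have hd := ((h.differentiable x).hasFDerivAt.norm_sq).fderiv
    have : ‖fderiv ℝ (fun x => ‖φ x‖ ^ 2) x‖ ≤ 2 * (‖φ x‖ * ‖gradField φ x‖) := by
      rw [hd, two_smul, two_mul]
      have : ‖(innerSL ℝ) (φ x) ∘L fderiv ℝ φ x‖ ≤ ‖φ x‖ * ‖gradField φ x‖ := by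
        refine (ContinuousLinearMap.opNorm_comp_le _ _).trans ?_
        rw [innerSL_apply_norm]
        gcongr
        exact norm_fderiv_le_norm_gradField φ x
      exact (norm_add_le _ _).trans (add_le_add this this)
    have h2 := ENNReal.ofReal_le_ofReal this
    rwa [ENNReal.ofReal_mul (by norm_num), ENNReal.ofReal_mul (norm_nonneg _), ofReal_norm,
      ofReal_norm, ofReal_norm, ENNReal.ofReal_ofNat] at h2
  calc ∫⁻ x, ‖φ x‖ₑ ^ 4 = ∫⁻ x, ‖‖φ x‖ ^ 2‖ₑ ^ (2 : ℝ) := by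
        refine lintegral_congr fun x => ?_
        rw [enorm_pow, enorm_norm, ENNReal.rpow_two, ← pow_mul]
    _ ≤ _ := key
    _ ≤ lintegralPowLePowLIntegralFDerivConst (volume : Measure (E 2)) 2 *
        (∫⁻ x, 2 * (‖φ x‖ₑ * ‖gradField φ x‖ₑ)) ^ (2 : ℝ) := by
        gcongr with x; exact hfd x
    _ = lintegralPowLePowLIntegralFDerivConst (volume : Measure (E 2)) 2 * 4 *
        (∫⁻ x, ‖φ x‖ₑ * ‖gradField φ x‖ₑ) ^ 2 := by
        rw [lintegral_const_mul' _ _ (by simp), ENNReal.rpow_two, mul_pow, ← mul_assoc]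
        norm_num
    _ ≤ _ := by
        gcongr
        exact lintegral_mul_sq_le h.smooth.continuous.enorm.measurable.aemeasurable
          h.continuous_gradField.enorm.measurable.aemeasurable

/-- Cauchy–Schwarz for `|φ|⁴ = |φ| |φ|³`, followed by the Sobolev embedding of `H¹` in `L⁶`. -/
theorem exists_lintegral_four_le_spatial (hd : d = 3) (hO : IsOpen O) :
    ∃ C : ℝ≥0∞, C ≠ ⊤ ∧ ∀ φ : E d → E d, IsTestField O φ →
      (∫⁻ x in O, ‖φ x‖ₑ ^ 4) ^ 2 ≤
        C * ((∫⁻ x in O, ‖φ x‖ₑ ^ 2) * (∫⁻ x in O, ‖gradField φ x‖ₑ ^ 2) ^ 3) := by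
  subst hd
  set K : NNReal := eLpNormLESNormFDerivOfEqInnerConst (volume : Measure (E 3)) (2 : NNReal)
  refine ⟨(K : ℝ≥0∞) ^ 6, by finiteness, fun φ h => ?_⟩
  rw [h.setLIntegral_eq hO (F := fun u _ => ‖u‖ₑ ^ 4) (by simp),
    h.setLIntegral_eq hO (F := fun u _ => ‖u‖ₑ ^ 2) (by simp),
    h.setLIntegral_eq hO (F := fun _ G => ‖G‖ₑ ^ 2) (by simp)]
  have key := eLpNorm_le_eLpNorm_fderiv_of_eq_inner (volume : Measure (E 3))
    (h.smooth.of_le (mod_cast le_top) : ContDiff ℝ 1 φ) h.compact (p := 2) (p' := 6)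
    (by norm_num) (by rw [finrank_euclideanSpace_fin]; norm_num)
    (by rw [finrank_euclideanSpace_fin]; norm_num)
  rw [eLpNorm_nnreal_eq_lintegral (by norm_num), eLpNorm_nnreal_eq_lintegral (by norm_num)] at key
  have e6 : ∀ a : ℝ≥0∞, (a ^ (1 / ((6 : NNReal) : ℝ))) ^ 6 = a := fun a => by
    rw [← ENNReal.rpow_natCast, ← ENNReal.rpow_mul]; norm_num
  have e2 : ∀ a : ℝ≥0∞, (a ^ (1 / ((2 : NNReal) : ℝ))) ^ 6 = a ^ 3 := fun a => by
    rw [← ENNReal.rpow_natCast, ← ENNReal.rpow_mul, ← ENNReal.rpow_natCast]; norm_num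
  have key6 := pow_le_pow_left₀ zero_le key 6
  rw [mul_pow, e6, e2] at key6
  calc (∫⁻ x, ‖φ x‖ₑ ^ 4) ^ 2 = (∫⁻ x, ‖φ x‖ₑ * ‖φ x‖ₑ ^ 3) ^ 2 := by
        congr 1; refine lintegral_congr fun x => ?_; ring
    _ ≤ (∫⁻ x, ‖φ x‖ₑ ^ 2) * ∫⁻ x, (‖φ x‖ₑ ^ 3) ^ 2 :=
        lintegral_mul_sq_le h.smooth.continuous.enorm.measurable.aemeasurable
          (h.smooth.continuous.enorm.measurable.pow_const 3).aemeasurable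
    _ ≤ (∫⁻ x, ‖φ x‖ₑ ^ 2) * ((K : ℝ≥0∞) ^ 6 * (∫⁻ x, ‖gradField φ x‖ₑ ^ 2) ^ 3) := by
        gcongr
        refine le_trans (le_of_eq ?_) (key6.trans ?_)
        · refine lintegral_congr fun x => ?_
          rw [← pow_mul]
          exact (ENNReal.rpow_natCast _ 6).symm
        · gcongr with x
          rw [show ((2 : NNReal) : ℝ) = 2 by norm_num, ENNReal.rpow_two]
          gcongr
          rw [← ofReal_norm, ← ofReal_norm]
          exact ENNReal.ofReal_le_ofReal (norm_fderiv_le_norm_gradField φ x)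
    _ = _ := by ring

end IsTestField

end

/-! ### Extension of the inequalities to `𝕍` by density. -/

section

variable {d : ℕ} {O : Set (E d)}

theorem lintegral_enorm_sq_eq {α F : Type*} [MeasurableSpace α] {μ : Measure α}
    [NormedAddCommGroup F] (u : Lp F 2 μ) : ∫⁻ x, ‖u x‖ₑ ^ 2 ∂μ = ENNReal.ofReal (‖u‖ ^ 2) := by
  rw [ENNReal.ofReal_pow (norm_nonneg _), ofReal_norm, Lp.enorm_def,
    eLpNorm_eq_lintegral_rpow_enorm_toReal (by norm_num) (by norm_num), ← ENNReal.rpow_natCast,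
    ← ENNReal.rpow_mul]
  norm_num

theorem V.norm_sq_eq (w : V O) : ‖w‖ ^ 2 = ‖V.fn w‖ ^ 2 + ‖V.grad w‖ ^ 2 :=
  WithLp.prod_norm_sq_eq_of_L2 (show VSub O from w).1

theorem V.norm_fn_le (w : V O) : ‖V.fn w‖ ≤ ‖w‖ :=
  abs_le_of_sq_le_sq' (by rw [V.norm_sq_eq]; nlinarith [sq_nonneg ‖V.grad w‖]) (norm_nonneg _) |>.2

theorem V.norm_grad_le (w : V O) : ‖V.grad w‖ ≤ ‖w‖ :=
  abs_le_of_sq_le_sq' (by rw [V.norm_sq_eq]; nlinarith [sq_nonneg ‖V.fn w‖]) (norm_nonneg _) |>.2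

theorem V.fn_sub (a b : V O) : V.fn (a - b) = V.fn a - V.fn b := rfl

theorem V.grad_sub (a b : V O) : V.grad (a - b) = V.grad a - V.grad b := rfl

/-- The underlying function, as a continuous linear map. -/
def V.fnL (O : Set (E d)) : V O →L[ℝ] Lp (E d) 2 (vol O) :=
  LinearMap.mkContinuous
    { toFun := V.fn, map_add' := fun _ _ => rfl, map_smul' := fun _ _ => rfl } 1
    fun w => by rw [one_mul]; exact V.norm_fn_le w

/-- The gradient, as a continuous linear map. -/
def V.gradL (O : Set (E d)) : V O →L[ℝ] Lp (M d) 2 (vol O) :=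
  LinearMap.mkContinuous
    { toFun := V.grad, map_add' := fun _ _ => rfl, map_smul' := fun _ _ => rfl } 1
    fun w => by rw [one_mul]; exact V.norm_grad_le w

theorem V.continuous_fn : Continuous (V.fn : V O → _) := (V.fnL O).continuous

theorem V.continuous_grad : Continuous (V.grad : V O → _) := (V.gradL O).continuous

/-- `w` is represented by the test field `φ`. -/
def V.IsTest (w : V O) (φ : E d → E d) : Prop :=
  IsTestField O φ ∧ (V.fn w : E d → E d) =ᵐ[vol O] φ ∧ (V.grad w : E d → M d) =ᵐ[vol O] gradField φ

/-- Test fields form a linear space, so every element of the span in the definition of `𝕍` is itself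
a test field, and `w` is a limit of such elements. -/
theorem V.exists_seq_isTest (w : V O) :
    ∃ wk : ℕ → V O, (∀ k, ∃ φ, V.IsTest (wk k) φ) ∧ Tendsto wk atTop (𝓝 w) := by
  have hspan : ∀ v ∈ Submodule.span ℝ {w : WithLp 2 (Lp (E d) 2 (vol O) × Lp (M d) 2 (vol O)) |
    ∃ φ, IsTestField O φ ∧ (w.fst : E d → E d) =ᵐ[vol O] φ ∧
      (w.snd : E d → M d) =ᵐ[vol O] gradField φ}, ∃ φ, IsTestField O φ ∧
      (v.fst : E d → E d) =ᵐ[vol O] φ ∧ (v.snd : E d → M d) =ᵐ[vol O] gradField φ := by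
    intro v hv
    induction hv using Submodule.span_induction with
    | mem x h => exact h
    | zero =>
      refine ⟨0, IsTestField.zero, Lp.coeFn_zero _ _ _, (Lp.coeFn_zero _ _ _).trans ?_⟩
      refine Eventually.of_forall fun x => ?_
      ext ij; simp [gradField]
    | add x y _ _ hx hy =>
      obtain ⟨φ, h, h1, h2⟩ := hx
      obtain ⟨ψ, h', h1', h2'⟩ := hy
      refine ⟨φ + ψ, h.add h', (Lp.coeFn_add _ _).trans (h1.add h1'),
        (Lp.coeFn_add _ _).trans ((h2.add h2').trans ?_)⟩
      exact Eventually.of_forall fun x => (gradField_add h.differentiable h'.differentiable x).symm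
    | smul c x _ hx =>
      obtain ⟨φ, h, h1, h2⟩ := hx
      refine ⟨c • φ, h.smul c, (Lp.coeFn_smul _ _).trans (h1.const_smul c),
        (Lp.coeFn_smul _ _).trans ((h2.const_smul c).trans ?_)⟩
      exact Eventually.of_forall fun x => (gradField_smul h.differentiable c x).symm
  have hw := (show VSub O from w).2
  obtain ⟨x, hx, hlim⟩ := mem_closure_iff_seq_limit.1 hw
  have hx' : ∀ k, x k ∈ VSub O := fun k => subset_closure (hx k)
  refine ⟨fun k => (⟨x k, hx' k⟩ : VSub O), fun k => hspan _ (hx k), ?_⟩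
  exact tendsto_subtype_rng.2 hlim

/-- Fatou's lemma along a subsequence of test fields converging almost everywhere; membership of `w`
in `L⁴` is thereby a conclusion. -/
theorem V.lintegral_four_le_of_isTest {Ψ : V O → ℝ} (hΨ : Continuous Ψ)
    (H : ∀ w φ, V.IsTest w φ → ∫⁻ x in O, ‖φ x‖ₑ ^ 4 ≤ ENNReal.ofReal (Ψ w)) (w : V O) :
    ∫⁻ x in O, ‖V.fn w x‖ₑ ^ 4 ≤ ENNReal.ofReal (Ψ w) := by
  obtain ⟨wk, hk, hlim⟩ := V.exists_seq_isTest w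
  have h1 : Tendsto (fun k => V.fn (wk k)) atTop (𝓝 (V.fn w)) :=
    (V.continuous_fn.tendsto w).comp hlim
  obtain ⟨ns, hns, hae⟩ := (tendstoInMeasure_of_tendsto_Lp h1).exists_seq_tendsto_ae
  have h2 : Tendsto (fun k => ENNReal.ofReal (Ψ (wk (ns k)))) atTop (𝓝 (ENNReal.ofReal (Ψ w))) :=
    (ENNReal.continuous_ofReal.tendsto _).comp ((hΨ.tendsto w).comp (hlim.comp hns.tendsto_atTop))
  calc ∫⁻ x in O, ‖V.fn w x‖ₑ ^ 4
      ≤ ∫⁻ x in O, liminf (fun k => ‖V.fn (wk (ns k)) x‖ₑ ^ 4) atTop := by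
        refine lintegral_mono_ae ?_
        filter_upwards [hae] with x hx
        exact ((ENNReal.continuous_pow 4).tendsto _ |>.comp hx.enorm).liminf_eq.ge
    _ ≤ liminf (fun k => ∫⁻ x in O, ‖V.fn (wk (ns k)) x‖ₑ ^ 4) atTop :=
        lintegral_liminf_le' fun k => ((Lp.aestronglyMeasurable _).enorm.pow_const 4)
    _ ≤ liminf (fun k => ENNReal.ofReal (Ψ (wk (ns k)))) atTop := by
        refine liminf_le_liminf (Eventually.of_forall fun k => ?_)
        obtain ⟨φ, hφ⟩ := hk (ns k)
        refine le_trans (le_of_eq ?_) (H _ φ hφ)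
        refine lintegral_congr_ae ?_
        filter_upwards [hφ.2.1] with x hx
        rw [hx]
    _ = _ := h2.liminf_eq

theorem V.IsTest.lintegral_fn {w : V O} {φ : E d → E d} (h : V.IsTest w φ) :
    ∫⁻ x in O, ‖φ x‖ₑ ^ 2 = ENNReal.ofReal (‖V.fn w‖ ^ 2) := by
  rw [← lintegral_enorm_sq_eq]
  refine lintegral_congr_ae ?_
  filter_upwards [h.2.1] with x hx
  rw [hx]

theorem V.IsTest.lintegral_grad {w : V O} {φ : E d → E d} (h : V.IsTest w φ) :
    ∫⁻ x in O, ‖gradField φ x‖ₑ ^ 2 = ENNReal.ofReal (‖V.grad w‖ ^ 2) := by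
  rw [← lintegral_enorm_sq_eq]
  refine lintegral_congr_ae ?_
  filter_upwards [h.2.2] with x hx
  rw [hx]

theorem V.exists_lintegral_four_le_planar (hd : d = 2) (hO : IsOpen O) :
    ∃ C : ℝ, 0 ≤ C ∧ ∀ w : V O, ∫⁻ x in O, ‖V.fn w x‖ₑ ^ 4 ≤
      ENNReal.ofReal (C * (‖V.fn w‖ ^ 2 * ‖V.grad w‖ ^ 2)) := by
  obtain ⟨C, hC, H⟩ := IsTestField.exists_lintegral_four_le_planar hd hO
  refine ⟨C.toReal, by positivity, V.lintegral_four_le_of_isTest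
    (Ψ := fun w => C.toReal * (‖V.fn w‖ ^ 2 * ‖V.grad w‖ ^ 2)) ?_ ?_⟩
  · exact continuous_const.mul ((V.continuous_fn.norm.pow 2).mul (V.continuous_grad.norm.pow 2))
  · intro w φ h
    refine (H φ h.1).trans (le_of_eq ?_)
    rw [h.lintegral_fn, h.lintegral_grad, ENNReal.ofReal_mul (by positivity),
      ENNReal.ofReal_mul (by positivity), ENNReal.ofReal_toReal hC]

theorem V.exists_lintegral_four_le (hd : d = 2 ∨ d = 3) (hO : IsOpen O) :
    ∃ C : ℝ, 0 ≤ C ∧ ∀ w : V O, ∫⁻ x in O, ‖V.fn w x‖ₑ ^ 4 ≤ ENNReal.ofReal (C * ‖w‖ ^ 4) := by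
  rcases hd with hd | hd
  · obtain ⟨C, hC, H⟩ := V.exists_lintegral_four_le_planar hd hO
    refine ⟨C, hC, fun w => (H w).trans (ENNReal.ofReal_le_ofReal ?_)⟩
    have h1 := V.norm_fn_le w
    have h2 := V.norm_grad_le w
    calc _ ≤ C * (‖w‖ ^ 2 * ‖w‖ ^ 2) := by gcongr
      _ = _ := by ring
  · obtain ⟨C, hC, H⟩ := IsTestField.exists_lintegral_four_le_spatial hd hO
    -- The inequality for test fields is squared; `C ≤ (C + 1)²` avoids a square root of the
    -- constant.
    refine ⟨C.toReal + 1, by positivity, V.lintegral_four_le_of_isTest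
      (Ψ := fun w => (C.toReal + 1) * ‖w‖ ^ 4) (by fun_prop) ?_⟩
    intro w φ h
    have h0 := H φ h.1
    rw [h.lintegral_fn, h.lintegral_grad, ← ENNReal.ofReal_toReal hC] at h0
    rw [← ENNReal.pow_le_pow_left_iff two_ne_zero]
    refine h0.trans ?_
    rw [← ENNReal.ofReal_pow (by positivity), ← ENNReal.ofReal_pow (by positivity),
      ← ENNReal.ofReal_mul (by positivity), ← ENNReal.ofReal_mul (by positivity)]
    refine ENNReal.ofReal_le_ofReal ?_
    have h1 := V.norm_fn_le w
    have h2 := V.norm_grad_le w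
    have hC0 : 0 ≤ C.toReal := by positivity
    calc C.toReal * (‖V.fn w‖ ^ 2 * (‖V.grad w‖ ^ 2) ^ 3)
        ≤ (C.toReal + 1) ^ 2 * (‖w‖ ^ 2 * (‖w‖ ^ 2) ^ 3) := by
          gcongr; nlinarith
      _ = _ := by ring

end

/-! ### The trilinear form: continuity and antisymmetry. -/

section

variable {d : ℕ} {O : Set (E d)}

/-- The outer product of two vectors. -/
def outer (u w : E d) : M d := WithLp.toLp 2 fun ij : Fin d × Fin d => u ij.1 * w ij.2

theorem continuous_outer : Continuous fun z : E d × E d => outer z.1 z.2 := by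
  refine (PiLp.continuous_toLp 2 _).comp (continuous_pi fun ij => ?_)
  fun_prop

theorem eLpNorm_outer_le {μ : Measure (E d)} {u w : E d → E d} (hu : AEStronglyMeasurable u μ)
    (hw : AEStronglyMeasurable w μ) :
    eLpNorm (fun x => outer (u x) (w x)) 2 μ ≤ eLpNorm u 4 μ * eLpNorm w 4 μ := by
  have : ENNReal.HolderTriple 4 4 2 := ⟨by
    rw [← two_mul, show (4 : ℝ≥0∞) = 2 * 2 by norm_num, ENNReal.mul_inv (by simp) (by simp),
      ← mul_assoc, ENNReal.mul_inv_cancel (by simp) (by simp), one_mul]⟩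
  refine (eLpNorm_le_eLpNorm_mul_eLpNorm_of_nnnorm (p := 4) (q := 4) hu hw outer 1
    (Eventually.of_forall fun x => ?_)).trans (by simp)
  rw [one_mul, ← NNReal.coe_le_coe]
  exact (norm_outer _ _).le

theorem memLp_outer {μ : Measure (E d)} {u w : E d → E d} (hu : MemLp u 4 μ) (hw : MemLp w 4 μ) :
    MemLp (fun x => outer (u x) (w x)) 2 μ :=
  ⟨continuous_outer.comp_aestronglyMeasurable (hu.1.prodMk hw.1),
    (eLpNorm_outer_le hu.1 hw.1).trans_lt (ENNReal.mul_lt_top hu.2 hw.2)⟩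

theorem integrable_tri {μ : Measure (E d)} {u w : E d → E d} {G : E d → M d} (hu : MemLp u 4 μ)
    (hw : MemLp w 4 μ) (hG : MemLp G 2 μ) : Integrable (fun x => tri (u x) (G x) (w x)) μ := by
  have h := memLp_outer hu hw
  refine (L2.integrable_inner (𝕜 := ℝ) (h.toLp _) (hG.toLp _)).congr ?_
  filter_upwards [h.coeFn_toLp, hG.coeFn_toLp] with x h1 h2
  rw [h1, h2, tri_eq_inner]
  rfl

/-- As an `L²` inner product with `u ⊗ w`, the form is visibly continuous in the gradient in `L²`
and in `u`, `w` in `L⁴`. -/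
theorem trilinear_eq_inner {u w : E d → E d} (hu : MemLp u 4 (vol O)) (hw : MemLp w 4 (vol O))
    (G : Lp (M d) 2 (vol O)) :
    trilinear O u G w = inner ℝ ((memLp_outer hu hw).toLp _) G := by
  rw [L2.inner_def]
  refine integral_congr_ae ?_
  filter_upwards [(memLp_outer hu hw).coeFn_toLp] with x hx
  rw [hx]
  exact tri_eq_inner _ _ _

theorem abs_trilinear_le {u w : E d → E d} (hu : MemLp u 4 (vol O)) (hw : MemLp w 4 (vol O))
    (G : Lp (M d) 2 (vol O)) :
    |trilinear O u G w| ≤ (eLpNorm u 4 (vol O)).toReal * (eLpNorm w 4 (vol O)).toReal * ‖G‖ := by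
  rw [trilinear_eq_inner hu hw]
  refine (abs_real_inner_le_norm _ _).trans ?_
  gcongr
  rw [Lp.norm_toLp, ← ENNReal.toReal_mul]
  exact ENNReal.toReal_mono (ENNReal.mul_ne_top hu.2.ne hw.2.ne) (eLpNorm_outer_le hu.1 hw.1)

theorem trilinear_congr {u u' w w' : E d → E d} {G G' : E d → M d} (hu : u =ᵐ[vol O] u')
    (hG : G =ᵐ[vol O] G') (hw : w =ᵐ[vol O] w') : trilinear O u G w = trilinear O u' G' w' := by
  refine integral_congr_ae ?_
  filter_upwards [hu, hG, hw] with x h1 h2 h3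
  rw [h1, h2, h3]

theorem V.exists_memLp_four (hd : d = 2 ∨ d = 3) (hO : IsOpen O) :
    ∃ C : ℝ, 0 ≤ C ∧ ∀ w : V O, MemLp (V.fn w) 4 (vol O) ∧
      (eLpNorm (V.fn w) 4 (vol O)).toReal ≤ C * ‖w‖ := by
  obtain ⟨C, hC, H⟩ := V.exists_lintegral_four_le hd hO
  have e : ∀ w : V O, eLpNorm (V.fn w) 4 (vol O) = (∫⁻ x in O, ‖V.fn w x‖ₑ ^ 4) ^ (1 / (4 : ℝ)) := by
    intro w
    rw [eLpNorm_eq_lintegral_rpow_enorm_toReal (by norm_num) (by norm_num)]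
    simp only [ENNReal.toReal_ofNat]
    congr 1
    refine lintegral_congr fun x => ?_
    exact_mod_cast ENNReal.rpow_natCast _ 4
  have bd : ∀ w : V O, eLpNorm (V.fn w) 4 (vol O) ≤ ENNReal.ofReal (C ^ (1 / (4 : ℝ)) * ‖w‖) := by
    intro w
    rw [e w]
    refine (ENNReal.rpow_le_rpow (H w) (by norm_num)).trans (le_of_eq ?_)
    rw [ENNReal.ofReal_rpow_of_nonneg (by positivity) (by norm_num),
      Real.mul_rpow hC (by positivity), ← Real.rpow_natCast, ← Real.rpow_mul (norm_nonneg _)]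
    norm_num
  refine ⟨C ^ (1 / (4 : ℝ)), by positivity, fun w => ⟨⟨Lp.aestronglyMeasurable _,
    (bd w).trans_lt ENNReal.ofReal_lt_top⟩, ?_⟩⟩
  exact ENNReal.toReal_le_of_le_ofReal (by positivity) (bd w)

/-- The integrand is `½ Y · ∇|φ|²`; integration by parts moves the derivative onto `Y`, whose
divergence vanishes. -/
theorem IsTestField.integral_tri_eq_zero {Y φ : E d → E d} (hY : IsTestField O Y)
    (hφ : IsTestField O φ) : ∫ x, tri (Y x) (gradField φ x) (φ x) = 0 := by
  have hYd := hY.differentiable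
  have hφd := hφ.differentiable
  have cY : Continuous Y := hY.smooth.continuous
  have cφ : Continuous φ := hφ.smooth.continuous
  have cY' : Continuous (fderiv ℝ Y) := hY.smooth.continuous_fderiv (by simp)
  have cφ' : Continuous (fderiv ℝ φ) := hφ.smooth.continuous_fderiv (by simp)
  set e : Fin d → E d := fun i => EuclideanSpace.single i 1
  set N : E d → ℝ := fun x => ‖φ x‖ ^ 2 with hN
  have hNd : ∀ x, HasFDerivAt N (2 • (innerSL ℝ (φ x)).comp (fderiv ℝ φ x)) x := fun x =>
    (hφd x).hasFDerivAt.norm_sq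
  have hYi : ∀ i x, HasFDerivAt (fun x => Y x i) ((EuclideanSpace.proj i : E d →L[ℝ] ℝ).comp
      (fderiv ℝ Y x)) x := fun i x =>
    (EuclideanSpace.proj i : E d →L[ℝ] ℝ).hasFDerivAt.comp x (hYd x).hasFDerivAt
  have hpt : ∀ x, tri (Y x) (gradField φ x) (φ x) =
      ∑ i, 2⁻¹ * (Y x i * fderiv ℝ N x (e i)) := by
    intro x
    rw [tri]
    refine Finset.sum_congr rfl fun i _ => ?_
    have : fderiv ℝ N x (e i) = 2 * inner ℝ (φ x) (fderiv ℝ φ x (e i)) := by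
      rw [(hNd x).fderiv]; simp [two_smul, two_mul]
    rw [this, PiLp.inner_apply, Finset.mul_sum, Finset.mul_sum, Finset.mul_sum]
    refine Finset.sum_congr rfl fun j _ => ?_
    simp only [gradField, RCLike.inner_apply, conj_trivial, e]
    ring
  have hcY : ∀ {F : E d → ℝ}, (∀ x, Y x = 0 → F x = 0) → HasCompactSupport F := fun {F} h =>
    hY.compact.mono fun x hx h0 => hx (h x h0)
  have hcφ : ∀ {F : E d → ℝ}, (∀ x, φ x = 0 → F x = 0) → HasCompactSupport F := fun {F} h =>
    hφ.compact.mono fun x hx h0 => hx (h x h0)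
  have cN : Continuous N := cφ.norm.pow 2
  have cN' : Continuous (fderiv ℝ N) := by
    have : ContDiff ℝ ∞ N := hφ.smooth.norm_sq ℝ
    exact this.continuous_fderiv (by simp)
  have cYi : ∀ i, Continuous fun x => fderiv ℝ (fun x => Y x i) x (e i) := by
    intro i
    simp_rw [fun x => (hYi i x).fderiv]
    simp only [ContinuousLinearMap.comp_apply]
    fun_prop
  have i1 : ∀ i, Integrable fun x => Y x i * fderiv ℝ N x (e i) := fun i =>
    Continuous.integrable_of_hasCompactSupport (by fun_prop) (hcY fun x h => by simp [h])
  have i2 : ∀ i, Integrable fun x => fderiv ℝ (fun x => Y x i) x (e i) * N x := fun i =>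
    Continuous.integrable_of_hasCompactSupport ((cYi i).mul cN) (hcφ fun x h => by simp [hN, h])
  have i3 : ∀ i, Integrable fun x => Y x i * N x := fun i =>
    Continuous.integrable_of_hasCompactSupport (by fun_prop) (hcY fun x h => by simp [h])
  have parts : ∀ i, ∫ x, Y x i * fderiv ℝ N x (e i) =
      -∫ x, fderiv ℝ (fun x => Y x i) x (e i) * N x := fun i =>
    integral_mul_fderiv_eq_neg_fderiv_mul_of_integrable (i2 i) (i1 i) (i3 i)
      (fun x _ => (hYi i x).differentiableAt) (fun x _ => (hNd x).differentiableAt)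
  simp_rw [hpt]
  rw [integral_finsetSum _ fun i _ => (i1 i).const_mul _]
  simp_rw [integral_const_mul, parts]
  rw [← Finset.mul_sum, Finset.sum_neg_distrib, ← integral_finsetSum _ fun i _ => i2 i]
  have : ∀ x, ∑ i, fderiv ℝ (fun x => Y x i) x (e i) * N x = 0 := by
    intro x
    rw [← Finset.sum_mul]
    have := hY.div_free x
    rw [divergence] at this
    simp_rw [fun i => (hYi i x).fderiv]
    change (∑ i, (fderiv ℝ Y x (e i)) i) * N x = 0
    rw [this, zero_mul]
  simp_rw [this]
  simp

/-- The vector `∑_j G_{ij} w_j`. -/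
def contract (G : M d) (w : E d) : E d := WithLp.toLp 2 fun i => ∑ j, G (i, j) * w j

theorem continuous_contract : Continuous fun z : M d × E d => contract z.1 z.2 := by
  refine (PiLp.continuous_toLp 2 _).comp (continuous_pi fun i => ?_)
  fun_prop

theorem tri_eq_inner_contract (u : E d) (G : M d) (w : E d) :
    tri u G w = inner ℝ (contract G w) u := by
  simp only [tri, contract, PiLp.inner_apply, RCLike.inner_apply, conj_trivial, Finset.mul_sum]
  refine Finset.sum_congr rfl fun i _ => Finset.sum_congr rfl fun j _ => ?_
  ring

/-- For a fixed test field `φ` the form is an `L²`-continuous functional of its first argument, with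
density `∑_j (∂_i φ_j) φ_j`. It vanishes on test fields, hence on their closure `ℍ`; integrability
of `y` beyond `L²` plays no role at this stage. -/
theorem trilinear_gradField_eq_zero (y : H O) {φ : E d → E d} (hφ : IsTestField O φ) :
    trilinear O (y : Lp (E d) 2 (vol O)) (gradField φ) φ = 0 := by
  obtain ⟨k, hk⟩ : ∃ k : E d → E d, ∀ x, k x = contract (gradField φ x) (φ x) := ⟨_, fun _ => rfl⟩
  have ck : Continuous k := by
    rw [funext hk]
    exact continuous_contract.comp (hφ.continuous_gradField.prodMk hφ.smooth.continuous)
  have hkc : HasCompactSupport k := by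
    refine hφ.compact.mono fun x hx h0 => hx ?_
    rw [hk, h0]; ext i; simp [contract]
  have hkL : MemLp k 2 (vol O) := (ck.memLp_of_hasCompactSupport hkc)
  have htri : ∀ u x, tri u (gradField φ x) (φ x) = inner ℝ (k x) u := by
    intro u x; rw [hk, tri_eq_inner_contract]
  have hL : ∀ u : Lp (E d) 2 (vol O), trilinear O u (gradField φ) φ =
      innerSL ℝ (hkL.toLp k) u := by
    intro u
    rw [innerSL_apply_apply, L2.inner_def]
    refine integral_congr_ae ?_
    filter_upwards [hkL.coeFn_toLp] with x hx
    rw [hx]; exact htri _ _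
  rw [hL]
  have hle : solenoidal O 2 ≤ (innerSL ℝ (hkL.toLp k) : _ →L[ℝ] ℝ).ker := by
    refine Submodule.topologicalClosure_minimal _ (Submodule.span_le.2 ?_)
      (ContinuousLinearMap.isClosed_ker _)
    rintro u ⟨Y, hY, hu⟩
    change innerSL ℝ (hkL.toLp k) u = 0
    rw [← hL, trilinear_congr hu EventuallyEq.rfl EventuallyEq.rfl]
    refine Eq.trans ?_ (hY.integral_tri_eq_zero hφ)
    refine setIntegral_eq_integral_of_forall_compl_eq_zero fun x hx => ?_
    change tri (Y x) (gradField φ x) (φ x) = 0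
    rw [htri, hY.eq_zero hx, inner_zero_right]
  exact hle y.2

theorem outer_add_right (u w w' : E d) : outer u (w + w') = outer u w + outer u w' := by
  ext ij; simp [outer, mul_add]

theorem outer_smul_right (c : ℝ) (u w : E d) : outer u (c • w) = c • outer u w := by
  ext ij; simp [outer]; ring

/-- The trilinear form is antisymmetric in the last two arguments: `b(y, w, w) = 0`. -/
theorem trilinear_self_eq_zero (hd : d = 2 ∨ d = 3) (hO : IsOpen O) {y : H O}
    (hy : MemLp (y : Lp (E d) 2 (vol O)) 4 (vol O)) (w : V O) :
    trilinear O (y : Lp (E d) 2 (vol O)) (V.grad w) (V.fn w) = 0 := by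
  obtain ⟨C, hC, H⟩ := V.exists_memLp_four hd hO
  -- Since `𝕍 ⊂ L⁴`, the map `w ↦ y ⊗ w` is bounded from `𝕍` to `L²`. Hence `b(y, w, w)` is
  -- continuous in `w` and the density of test fields suffices.
  set L : V O →L[ℝ] Lp (M d) 2 (vol O) := LinearMap.mkContinuous
    { toFun := fun w => (memLp_outer hy (H w).1).toLp _
      map_add' := fun a b => by
        rw [← MemLp.toLp_add]
        refine MemLp.toLp_congr _ _ ?_
        filter_upwards [Lp.coeFn_add (V.fn a) (V.fn b)] with x hx
        rw [V.fn_add, hx]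
        exact outer_add_right _ _ _
      map_smul' := fun c a => by
        rw [RingHom.id_apply, ← MemLp.toLp_const_smul]
        refine MemLp.toLp_congr _ _ ?_
        filter_upwards [Lp.coeFn_smul c (V.fn a)] with x hx
        rw [V.fn_smul, hx]
        exact outer_smul_right _ _ _ }
    ((eLpNorm (y : Lp (E d) 2 (vol O)) 4 (vol O)).toReal * C) fun w => by
      change ‖(memLp_outer hy (H w).1).toLp _‖ ≤ _
      rw [Lp.norm_toLp, mul_assoc]
      refine (ENNReal.toReal_mono (ENNReal.mul_ne_top hy.2.ne (H w).1.2.ne)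
        (eLpNorm_outer_le hy.1 (H w).1.1)).trans ?_
      rw [ENNReal.toReal_mul]
      gcongr
      exact (H w).2
  have hq : ∀ w, trilinear O (y : Lp (E d) 2 (vol O)) (V.grad w) (V.fn w) =
      inner ℝ (L w) (V.grad w) := fun w => trilinear_eq_inner hy (H w).1 _
  have hcont : Continuous fun w => inner ℝ (L w) (V.grad w) := L.continuous.inner V.continuous_grad
  obtain ⟨wk, hk, hlim⟩ := V.exists_seq_isTest w
  rw [hq]
  refine tendsto_nhds_unique ((hcont.tendsto w).comp hlim) ?_
  refine tendsto_const_nhds.congr fun k => ?_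
  obtain ⟨φ, hφ, h1, h2⟩ := hk k
  rw [Function.comp_apply, ← hq, trilinear_congr EventuallyEq.rfl h2 h1,
    trilinear_gradField_eq_zero y hφ]

end

/-! ### Bounds for integrals of powers, and the damping functional. -/

section

variable {d : ℕ} {O : Set (E d)}

theorem lexp_eq {p : ℝ} (hp : 1 ≤ p) : lexp p = ENNReal.ofReal p :=
  max_eq_right (by simpa using hp)

/-- The `s`-th power of `|u|` has an integral over `O` of at most `Q`. -/
structure PowLe (O : Set (E d)) (s : ℝ) (u : E d → E d) (Q : ℝ) : Prop where
  meas : AEStronglyMeasurable u (vol O)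
  integrable : Integrable (fun x => ‖u x‖ ^ s) (vol O)
  le : ∫ x in O, ‖u x‖ ^ s ≤ Q

namespace PowLe

variable {s Q Q' : ℝ} {u u' : E d → E d}

theorem nonneg (h : PowLe O s u Q) : 0 ≤ Q :=
  (integral_nonneg fun _ => by positivity).trans h.le

theorem mono (h : PowLe O s u Q) (hQ : Q ≤ Q') : PowLe O s u Q' := ⟨h.1, h.2, h.3.trans hQ⟩

theorem congr (h : PowLe O s u Q) (hu : u =ᵐ[vol O] u') : PowLe O s u' Q := by
  have : (fun x => ‖u x‖ ^ s) =ᵐ[vol O] fun x => ‖u' x‖ ^ s := by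
    filter_upwards [hu] with x hx; rw [hx]
  exact ⟨h.1.congr hu, h.2.congr this, (integral_congr_ae this).symm.le.trans h.3⟩

theorem of_lintegral (hs : 0 ≤ s) (hQ : 0 ≤ Q) (hu : AEStronglyMeasurable u (vol O))
    (h : ∫⁻ x in O, ‖u x‖ₑ ^ s ≤ ENNReal.ofReal Q) : PowLe O s u Q := by
  have e : ∀ x, ‖‖u x‖ ^ s‖ₑ = ‖u x‖ₑ ^ s := fun x => by
    rw [Real.enorm_rpow_of_nonneg (norm_nonneg _) hs, enorm_norm]
  have hm : AEStronglyMeasurable (fun x => ‖u x‖ ^ s) (vol O) :=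
    (hu.norm.aemeasurable.pow_const s).aestronglyMeasurable
  refine ⟨hu, ⟨hm, ?_⟩, ?_⟩
  · rw [hasFiniteIntegral_iff_enorm]
    simp_rw [e]
    exact h.trans_lt ENNReal.ofReal_lt_top
  · rw [integral_eq_lintegral_of_nonneg_ae (Eventually.of_forall fun x => by positivity) hm]
    refine ENNReal.toReal_le_of_le_ofReal hQ (le_trans (le_of_eq ?_) h)
    refine lintegral_congr fun x => ?_
    rw [← e, Real.enorm_of_nonneg (by positivity)]

theorem memLp (hs : 0 < s) (h : PowLe O s u Q) : MemLp u (ENNReal.ofReal s) (vol O) := by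
  rw [← integrable_norm_rpow_iff h.1 (by simpa using hs) (by simp), ENNReal.toReal_ofReal hs.le]
  exact h.2

theorem memLp_four (h : PowLe O 4 u Q) : MemLp u 4 (vol O) := by
  simpa using h.memLp (by norm_num)

theorem of_ltilde {p : ℝ} (hp : 1 ≤ p) (z : Lp (E d) (lexp p) (vol O)) :
    PowLe O p z (‖z‖ ^ p) := by
  refine of_lintegral (by linarith) (by positivity) (Lp.aestronglyMeasurable z) (le_of_eq ?_)
  have h0 : lexp p ≠ 0 := by rw [lexp_eq hp]; simpa using by linarith
  have ht : lexp p ≠ ⊤ := by rw [lexp_eq hp]; simp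
  have hr : (lexp p).toReal = p := by rw [lexp_eq hp, ENNReal.toReal_ofReal (by linarith)]
  rw [← ENNReal.ofReal_rpow_of_nonneg (norm_nonneg _) (by linarith), ofReal_norm, Lp.enorm_def,
    eLpNorm_eq_lintegral_rpow_enorm_toReal h0 ht, hr, ← ENNReal.rpow_mul,
    one_div_mul_cancel (by linarith), ENNReal.rpow_one]

theorem of_Lp_two (z : Lp (E d) 2 (vol O)) : PowLe O 2 z (‖z‖ ^ 2) := by
  refine of_lintegral (by norm_num) (by positivity) (Lp.aestronglyMeasurable z) (le_of_eq ?_)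
  rw [← lintegral_enorm_sq_eq]
  simp

theorem of_four_le (hu : AEStronglyMeasurable u (vol O)) (hQ : 0 ≤ Q)
    (h : ∫⁻ x in O, ‖u x‖ₑ ^ 4 ≤ ENNReal.ofReal Q) : PowLe O 4 u Q := by
  refine of_lintegral (by norm_num) hQ hu (le_trans (le_of_eq ?_) h)
  refine lintegral_congr fun x => ?_
  exact_mod_cast ENNReal.rpow_natCast _ 4

/-- From `t^s ≤ t² + t^p`, pointwise. This crude form of interpolation keeps the bounds additive, so
their integrability in time is immediate. -/
theorem interp {p : ℝ} (h : PowLe O 2 u Q) (h' : PowLe O p u Q') (hs : 2 ≤ s) (hsp : s ≤ p) :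
    PowLe O s u (Q + Q') := by
  have hb : ∀ x, ‖u x‖ ^ s ≤ ‖u x‖ ^ (2 : ℝ) + ‖u x‖ ^ p := fun x => by
    have := rpow_le_sq_add_rpow (norm_nonneg (u x)) hs hsp
    rwa [← Real.rpow_two] at this
  have hi := h.2.add h'.2
  have hm : AEStronglyMeasurable (fun x => ‖u x‖ ^ s) (vol O) :=
    (h.1.norm.aemeasurable.pow_const s).aestronglyMeasurable
  have hi' : Integrable (fun x => ‖u x‖ ^ s) (vol O) := by
    refine hi.mono' hm (Eventually.of_forall fun x => ?_)
    rw [Real.norm_of_nonneg (by positivity)]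
    exact hb x
  refine ⟨h.1, hi', (integral_mono hi' hi hb).trans ?_⟩
  rw [integral_add' h.2 h'.2]
  exact add_le_add h.3 h'.3

theorem add (hs : 0 ≤ s) (h : PowLe O s u Q) (h' : PowLe O s u' Q') :
    PowLe O s (u + u') (2 ^ s * (Q + Q')) := by
  have hb : ∀ x, ‖(u + u') x‖ ^ s ≤ 2 ^ s * (‖u x‖ ^ s + ‖u' x‖ ^ s) := fun x =>
    (Real.rpow_le_rpow (norm_nonneg _) (norm_add_le _ _) hs).trans
      (add_rpow_le_two_rpow (norm_nonneg _) (norm_nonneg _) hs)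
  have hm := h.1.add h'.1
  have hi := (h.2.add h'.2).const_mul (2 ^ s)
  have hi' : Integrable (fun x => ‖(u + u') x‖ ^ s) (vol O) := by
    refine hi.mono' (hm.norm.aemeasurable.pow_const s).aestronglyMeasurable
      (Eventually.of_forall fun x => ?_)
    rw [Real.norm_of_nonneg (by positivity)]
    exact hb x
  refine ⟨hm, hi', (integral_mono hi' hi hb).trans ?_⟩
  rw [integral_const_mul, integral_add' h.2 h'.2]
  gcongr
  exacts [h.3, h'.3]

theorem eLpNorm_four_sq_le (h : PowLe O 4 u Q) :
    (eLpNorm u 4 (vol O)).toReal * (eLpNorm u 4 (vol O)).toReal ≤ √Q := by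
  have e : (eLpNorm u 4 (vol O)).toReal = (∫ x in O, ‖u x‖ ^ (4 : ℝ)) ^ (4 : ℝ)⁻¹ := by
    rw [h.memLp_four.eLpNorm_eq_integral_rpow_norm (by norm_num) (by norm_num),
      ENNReal.toReal_ofReal (by positivity)]
    simp
  have h0 : 0 ≤ ∫ x in O, ‖u x‖ ^ (4 : ℝ) := integral_nonneg fun _ => by positivity
  rw [e, ← Real.rpow_add_of_nonneg h0 (by norm_num) (by norm_num), Real.sqrt_eq_rpow,
    show (4 : ℝ)⁻¹ + 4⁻¹ = 1 / 2 by norm_num]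
  exact Real.rpow_le_rpow h0 h.3 (by norm_num)

end PowLe

section damp

variable {r Q R : ℝ} {y ψ : E d → E d}

theorem holderConjugate_add_one (hr : 1 ≤ r) : Real.HolderConjugate ((r + 1) / r) (r + 1) := by
  rw [Real.holderConjugate_iff]
  have : 0 < r := by linarith
  constructor
  · rw [lt_div_iff₀ this]; linarith
  · field_simp

theorem memLp_norm_rpow (hr : 1 ≤ r) (hy : PowLe O (r + 1) y Q) :
    MemLp (fun x => ‖y x‖ ^ r) (ENNReal.ofReal ((r + 1) / r)) (vol O) := by
  have h := (hy.memLp (by linarith)).norm_rpow_div (ENNReal.ofReal r)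
  rwa [ENNReal.toReal_ofReal (by linarith), ← ENNReal.ofReal_div_of_pos (by linarith)] at h

theorem integrable_damp (hr : 1 ≤ r) (hy : PowLe O (r + 1) y Q) (hψ : PowLe O (r + 1) ψ R) :
    Integrable (fun x => ‖y x‖ ^ (r - 1) * inner ℝ (y x) (ψ x)) (vol O) := by
  have : ENNReal.HolderConjugate (ENNReal.ofReal ((r + 1) / r)) (ENNReal.ofReal (r + 1)) :=
    (holderConjugate_add_one hr).ennrealOfReal
  have h := (memLp_norm_rpow hr hy).integrable_mul (hψ.memLp (by linarith)).norm
  refine h.mono' ?_ (Eventually.of_forall fun x => abs_damp_le hr _ _)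
  exact ((hy.1.norm.aemeasurable.pow_const _).aestronglyMeasurable).mul (hy.1.inner hψ.1)

theorem abs_dampTerm_le (hr : 1 ≤ r) (hy : PowLe O (r + 1) y Q) (hψ : PowLe O (r + 1) ψ (R ^ (r + 1)))
    (hR : 0 ≤ R) : |dampTerm O r y ψ| ≤ Q ^ (r / (r + 1)) * R := by
  have hc := holderConjugate_add_one hr
  have hr0 : 0 < r := by linarith
  have : ENNReal.HolderConjugate (ENNReal.ofReal ((r + 1) / r)) (ENNReal.ofReal (r + 1)) :=
    hc.ennrealOfReal
  have h := (memLp_norm_rpow hr hy).integrable_mul (hψ.memLp (by linarith)).norm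
  have h1 := integral_mul_le_Lp_mul_Lq_of_nonneg hc
    (Eventually.of_forall fun x => by positivity) (Eventually.of_forall fun x => norm_nonneg _)
    (memLp_norm_rpow hr hy) (hψ.memLp (by linarith)).norm
  have e : ∀ x, (‖y x‖ ^ r) ^ ((r + 1) / r) = ‖y x‖ ^ (r + 1) := fun x => by
    rw [← Real.rpow_mul (norm_nonneg _)]; congr 1; field_simp
  simp_rw [e] at h1
  calc |dampTerm O r y ψ| ≤ ∫ x in O, |‖y x‖ ^ (r - 1) * inner ℝ (y x) (ψ x)| :=
        abs_integral_le_integral_abs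
    _ ≤ ∫ x in O, ‖y x‖ ^ r * ‖ψ x‖ :=
        integral_mono (integrable_damp hr hy hψ).abs h fun x => abs_damp_le hr _ _
    _ ≤ _ := h1
    _ ≤ Q ^ (1 / ((r + 1) / r)) * (R ^ (r + 1)) ^ (1 / (r + 1)) := by
        have hQ := hy.nonneg
        gcongr
        exacts [hy.3, hψ.3]
    _ = _ := by
        rw [← Real.rpow_mul hR, mul_one_div_cancel (by linarith), Real.rpow_one, one_div_div]

theorem dampTerm_congr {y' ψ' : E d → E d} (hy : y =ᵐ[vol O] y') (hψ : ψ =ᵐ[vol O] ψ') :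
    dampTerm O r y ψ = dampTerm O r y' ψ' := by
  refine integral_congr_ae ?_
  filter_upwards [hy, hψ] with x h1 h2
  rw [h1, h2]

/-- The damping as a functional on `L̃^{r+1}`. -/
theorem exists_dampTerm_eq (hr : 1 ≤ r) (hy : PowLe O (r + 1) y Q) :
    ∃ L : StrongDual ℝ (Ltilde O (r + 1)), (∀ z : Ltilde O (r + 1),
      L z = dampTerm O r y (z : Lp (E d) (lexp (r + 1)) (vol O))) ∧
      ∀ z, |L z| ≤ Q ^ (r / (r + 1)) * ‖z‖ := by
  have hz : ∀ z : Ltilde O (r + 1), PowLe O (r + 1) (z : Lp (E d) (lexp (r + 1)) (vol O))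
      (‖z‖ ^ (r + 1)) := fun z => PowLe.of_ltilde (by linarith) _
  refine ⟨LinearMap.mkContinuous
    { toFun := fun z => dampTerm O r y (z : Lp (E d) (lexp (r + 1)) (vol O))
      map_add' := fun a b => ?_
      map_smul' := fun c a => ?_ } (Q ^ (r / (r + 1)))
    fun z => abs_dampTerm_le hr hy (hz z) (norm_nonneg _), fun z => rfl,
    fun z => abs_dampTerm_le hr hy (hz z) (norm_nonneg _)⟩
  · rw [dampTerm, dampTerm, dampTerm, ← integral_add (integrable_damp hr hy (hz a))
      (integrable_damp hr hy (hz b))]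
    refine integral_congr_ae ?_
    filter_upwards [Lp.coeFn_add (a : Lp (E d) (lexp (r + 1)) (vol O)) b] with x hx
    rw [Submodule.coe_add, hx, Pi.add_apply, inner_add_right, mul_add]
  · rw [dampTerm, dampTerm, RingHom.id_apply, smul_eq_mul, ← integral_const_mul]
    refine integral_congr_ae ?_
    filter_upwards [Lp.coeFn_smul c (a : Lp (E d) (lexp (r + 1)) (vol O))] with x hx
    rw [Submodule.coe_smul, hx, Pi.smul_apply, inner_smul_right]
    ring

end damp

end

/-! ### The equation as a functional on `𝕍 ∩ L̃^{r+1}`. -/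

section

variable {d : ℕ} {O : Set (E d)}

/-- An element of `𝕍 ∩ L̃^p` as an element of `L̃^p`. -/
def VL.toL {p : ℝ} (ψ : VL O p) : Ltilde O p := (show VLSub O p from ψ).1.2

/-- `VL.toV` as a continuous linear map. -/
def VL.toVL (O : Set (E d)) (p : ℝ) : VL O p →L[ℝ] V O :=
  (ContinuousLinearMap.fst ℝ (V O) (Ltilde O p)).comp (VLSub O p).subtypeL

/-- `VL.toL` as a continuous linear map. -/
def VL.toLL (O : Set (E d)) (p : ℝ) : VL O p →L[ℝ] Ltilde O p :=
  (ContinuousLinearMap.snd ℝ (V O) (Ltilde O p)).comp (VLSub O p).subtypeL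

theorem VL.toVL_apply {p : ℝ} (ψ : VL O p) : VL.toVL O p ψ = ψ.toV := rfl

theorem VL.toLL_apply {p : ℝ} (ψ : VL O p) : VL.toLL O p ψ = ψ.toL := rfl

theorem VL.fn_ae_eq {p : ℝ} (ψ : VL O p) :
    (V.fn ψ.toV : E d → E d) =ᵐ[vol O] (ψ.toL : Lp (E d) (lexp p) (vol O)) :=
  (show VLSub O p from ψ).2

/-- The right-hand side of the equation, tested with `ψ`. -/
def equationRHS (O : Set (E d)) (μ α β χ r : ℝ) (w : V O) (v Υ : H O) (f : StrongDual ℝ (V O))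
    (ψ : VL O (r + 1)) : ℝ :=
  - μ * inner ℝ (V.grad w) (V.grad ψ.toV)
    - convTerm O ((v + Υ : H O) : Lp (E d) 2 (vol O)) (V.grad ψ.toV)
    - α * inner ℝ (v : Lp (E d) 2 (vol O)) (V.fn ψ.toV)
    - β * dampTerm O r ((v + Υ : H O) : Lp (E d) 2 (vol O)) (V.fn ψ.toV)
    + (χ - α) * inner ℝ (Υ : Lp (E d) 2 (vol O)) (V.fn ψ.toV)
    + f ψ.toV

/-- The bound has the split form required by the chain rule: everything except the damping is
measured in `𝕍`, with the convection contributing `√Q` as the square of an `L⁴` norm, and the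
damping in `L̃^{r+1}` by Hölder. -/
theorem exists_equationRHS_eq {μ α β χ r Q : ℝ} (hμ : 0 ≤ μ) (hα : 0 ≤ α) (hβ : 0 ≤ β)
    (hr : 1 ≤ r) (w : V O) (v Υ : H O) (f : StrongDual ℝ (V O))
    (h4 : PowLe O 4 ((v + Υ : H O) : Lp (E d) 2 (vol O)) Q)
    (hp : PowLe O (r + 1) ((v + Υ : H O) : Lp (E d) 2 (vol O)) Q) :
    ∃ L : StrongDual ℝ (VL O (r + 1)), (∀ ψ, L ψ = equationRHS O μ α β χ r w v Υ f ψ) ∧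
      ∀ ψ, |L ψ| ≤ (μ * ‖V.grad w‖ + √Q + α * ‖v‖ + |χ - α| * ‖Υ‖ + ‖f‖) * ‖VL.toVL O (r + 1) ψ‖ +
        (β * Q ^ (r / (r + 1))) * ‖VL.toLL O (r + 1) ψ‖ := by
  obtain ⟨D, hD, hDb⟩ := exists_dampTerm_eq hr hp
  set k := (memLp_outer h4.memLp_four h4.memLp_four).toLp _
  have hdamp : ∀ ψ : VL O (r + 1), dampTerm O r ((v + Υ : H O) : Lp (E d) 2 (vol O))
      (V.fn ψ.toV) = D (VL.toLL O (r + 1) ψ) := fun ψ => by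
    rw [hD]; exact dampTerm_congr EventuallyEq.rfl ψ.fn_ae_eq
  have htri : ∀ ψ : VL O (r + 1), trilinear O ((v + Υ : H O) : Lp (E d) 2 (vol O))
      (V.grad ψ.toV) ((v + Υ : H O) : Lp (E d) 2 (vol O)) = inner ℝ k (V.grad ψ.toV) := fun ψ =>
    trilinear_eq_inner h4.memLp_four h4.memLp_four _
  refine ⟨((-μ) • (innerSL ℝ (V.grad w)).comp (V.gradL O) + (innerSL ℝ k).comp (V.gradL O)
    - α • (innerSL ℝ (v : Lp (E d) 2 (vol O))).comp (V.fnL O)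
    + (χ - α) • (innerSL ℝ (Υ : Lp (E d) 2 (vol O))).comp (V.fnL O) + f).comp (VL.toVL O (r + 1))
    - β • D.comp (VL.toLL O (r + 1)), ?_⟩
  have heq : ∀ ψ, (((-μ) • (innerSL ℝ (V.grad w)).comp (V.gradL O) + (innerSL ℝ k).comp (V.gradL O)
    - α • (innerSL ℝ (v : Lp (E d) 2 (vol O))).comp (V.fnL O)
    + (χ - α) • (innerSL ℝ (Υ : Lp (E d) 2 (vol O))).comp (V.fnL O) + f).comp (VL.toVL O (r + 1))
    - β • D.comp (VL.toLL O (r + 1))) ψ = equationRHS O μ α β χ r w v Υ f ψ := by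
    intro ψ
    rw [equationRHS, convTerm, htri, hdamp]
    change (-μ) * inner ℝ (V.grad w) (V.grad ψ.toV) + inner ℝ k (V.grad ψ.toV)
      - α * inner ℝ (v : Lp (E d) 2 (vol O)) (V.fn ψ.toV)
      + (χ - α) * inner ℝ (Υ : Lp (E d) 2 (vol O)) (V.fn ψ.toV) + f ψ.toV
      - β * D (VL.toLL O (r + 1) ψ) = _
    ring
  refine ⟨heq, fun ψ => ?_⟩
  rw [heq, equationRHS, convTerm, htri, hdamp, VL.toVL_apply]
  have n1 := V.norm_grad_le ψ.toV
  have n2 := V.norm_fn_le ψ.toV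
  have b1 : |-μ * inner ℝ (V.grad w) (V.grad ψ.toV)| ≤ μ * (‖V.grad w‖ * ‖ψ.toV‖) := by
    rw [abs_mul, abs_neg, abs_of_nonneg hμ]
    gcongr
    exact (abs_real_inner_le_norm _ _).trans (by gcongr)
  have b2 : |inner ℝ k (V.grad ψ.toV)| ≤ √Q * ‖ψ.toV‖ := by
    rw [← htri]
    refine (abs_trilinear_le h4.memLp_four h4.memLp_four _).trans ?_
    gcongr
    exact h4.eLpNorm_four_sq_le
  have b3 : |α * inner ℝ (v : Lp (E d) 2 (vol O)) (V.fn ψ.toV)| ≤ α * (‖v‖ * ‖ψ.toV‖) := by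
    rw [abs_mul, abs_of_nonneg hα]
    gcongr
    exact (abs_real_inner_le_norm _ _).trans (by gcongr; exact le_rfl)
  have b4 : |β * D (VL.toLL O (r + 1) ψ)| ≤ β * (Q ^ (r / (r + 1)) * ‖VL.toLL O (r + 1) ψ‖) := by
    rw [abs_mul, abs_of_nonneg hβ]
    gcongr
    exact hDb _
  have b5 : |(χ - α) * inner ℝ (Υ : Lp (E d) 2 (vol O)) (V.fn ψ.toV)| ≤
      |χ - α| * (‖Υ‖ * ‖ψ.toV‖) := by
    rw [abs_mul]
    gcongr
    exact (abs_real_inner_le_norm _ _).trans (by gcongr; exact le_rfl)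
  have b6 : |f ψ.toV| ≤ ‖f‖ * ‖ψ.toV‖ := f.le_opNorm _
  rw [abs_le] at *
  constructor <;> linarith [b1.1, b1.2, b2.1, b2.2, b3.1, b3.2, b4.1, b4.2, b5.1, b5.2, b6.1, b6.2]

/-- Separability makes it possible to choose one null set of times for all test functions at once.
-/
instance (O : Set (E d)) : SecondCountableTopology (V O) :=
  have : Fact ((2 : ℝ≥0∞) ≠ ⊤) := ⟨by simp⟩
  have : SecondCountableTopology (Lp (E d) 2 (vol O)) := inferInstance
  have : SecondCountableTopology (Lp (M d) 2 (vol O)) := inferInstance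
  have : SecondCountableTopology (Lp (E d) 2 (vol O) × Lp (M d) 2 (vol O)) := inferInstance
  have : SecondCountableTopology (WithLp 2 (Lp (E d) 2 (vol O) × Lp (M d) 2 (vol O))) :=
    (WithLp.prodContinuousLinearEquiv 2 ℝ _ _).toHomeomorph.secondCountableTopology
  inferInstanceAs (SecondCountableTopology (VSub O))

instance (O : Set (E d)) (p : ℝ) : SecondCountableTopology (VL O p) :=
  have : Fact (lexp p ≠ ⊤) := ⟨by simp [lexp]⟩
  inferInstanceAs (SecondCountableTopology (VLSub O p))

end

/-! ### Integrated estimate of the difference of two right-hand sides. -/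

section

variable {d : ℕ} {O : Set (E d)}

theorem V.norm_grad_sq_eq (W : V O) : Integrable (fun x => ‖V.grad W x‖ ^ 2) (vol O) ∧
    ∫ x in O, ‖V.grad W x‖ ^ 2 = ‖V.grad W‖ ^ 2 := by
  have h := L2.integrable_inner (𝕜 := ℝ) (V.grad W) (V.grad W)
  have h' := L2.inner_def (𝕜 := ℝ) (V.grad W) (V.grad W)
  simp_rw [real_inner_self_eq_norm_sq] at h h'
  exact ⟨h, h'.symm⟩

theorem V.integral_sq_le (W : V O) : Integrable (fun x => ‖V.fn W x‖ ^ 2) (vol O) ∧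
    ∫ x in O, ‖V.fn W x‖ ^ 2 ≤ ‖V.fn W‖ ^ 2 := by
  have h := PowLe.of_Lp_two (V.fn W)
  have h2 := h.2
  have h3 := h.3
  simp_rw [Real.rpow_two] at h2 h3
  exact ⟨h2, h3⟩

theorem PowLe.four_nat {u : E d → E d} {Q : ℝ} (h : PowLe O 4 u Q) :
    Integrable (fun x => ‖u x‖ ^ 4) (vol O) ∧ ∫ x in O, ‖u x‖ ^ 4 ≤ Q := by
  have h2 := h.2
  have h3 := h.3
  have e : ∀ a : ℝ, a ^ (4 : ℝ) = a ^ 4 := fun a => by exact_mod_cast Real.rpow_natCast a 4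
  simp_rw [e] at h2 h3
  exact ⟨h2, h3⟩

theorem PowLe.two_nat {u : E d → E d} {Q : ℝ} (h : PowLe O 2 u Q) :
    Integrable (fun x => ‖u x‖ ^ 2) (vol O) ∧ ∫ x in O, ‖u x‖ ^ 2 ≤ Q := by
  have h2 := h.2
  have h3 := h.3
  simp_rw [Real.rpow_two] at h2 h3
  exact ⟨h2, h3⟩

theorem integrable_sq_mul_add {w y η : E d → E d} {Q S R : ℝ} (hw : PowLe O 4 w R)
    (hy : PowLe O 4 y Q) (hη : PowLe O 4 η S) :
    Integrable (fun x => ‖w x‖ ^ 2 * (‖y x‖ ^ 2 + ‖η x‖ ^ 2)) (vol O) ∧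
      ∫ x in O, ‖w x‖ ^ 2 * (‖y x‖ ^ 2 + ‖η x‖ ^ 2) ≤ √R * √(2 * (Q + S)) := by
  have m1 : MemLp (fun x => ‖w x‖ ^ 2) 2 (vol O) := by
    refine (memLp_two_iff_integrable_sq (hw.1.norm.pow 2)).2 ?_
    simpa only [Pi.pow_apply, ← pow_mul] using hw.four_nat.1
  have b : ∀ x, (‖y x‖ ^ 2 + ‖η x‖ ^ 2) ^ 2 ≤ 2 * (‖y x‖ ^ 4 + ‖η x‖ ^ 4) := fun x => by
    nlinarith [sq_nonneg (‖y x‖ ^ 2 - ‖η x‖ ^ 2)]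
  have i2 := (hy.four_nat.1.add hη.four_nat.1).const_mul 2
  have hm : AEStronglyMeasurable (fun x => ‖y x‖ ^ 2 + ‖η x‖ ^ 2) (vol O) :=
    (hy.1.norm.pow 2).add (hη.1.norm.pow 2)
  have i3 : Integrable (fun x => (‖y x‖ ^ 2 + ‖η x‖ ^ 2) ^ 2) (vol O) := by
    refine i2.mono' (hm.pow 2) (Eventually.of_forall fun x => ?_)
    rw [Real.norm_of_nonneg (by positivity)]
    exact b x
  have m2 : MemLp (fun x => ‖y x‖ ^ 2 + ‖η x‖ ^ 2) 2 (vol O) :=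
    (memLp_two_iff_integrable_sq hm).2 i3
  refine ⟨m1.integrable_mul m2, ?_⟩
  have h := integral_mul_le_Lp_mul_Lq_of_nonneg (μ := vol O) (p := 2) (q := 2)
    ((Real.holderConjugate_iff).2 ⟨by norm_num, by norm_num⟩)
    (f := fun x => ‖w x‖ ^ 2) (g := fun x => ‖y x‖ ^ 2 + ‖η x‖ ^ 2)
    (Eventually.of_forall fun x => by positivity) (Eventually.of_forall fun x => by positivity)
    (by simpa using m1) (by simpa using m2)
  simp_rw [← Real.sqrt_eq_rpow, Real.rpow_two] at h
  refine h.trans ?_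
  gcongr
  · simpa only [← pow_mul] using hw.four_nat.2
  · refine (integral_mono i3 i2 b).trans ?_
    rw [integral_const_mul, integral_add' hy.four_nat.1 hη.four_nat.1]
    gcongr
    exacts [hy.four_nat.2, hη.four_nat.2]

/-- Integration of the pointwise difference estimate. -/
theorem difference_le_of_pointwise {μ β r κ c C C₂ ε Cε Q S R R' Q' : ℝ} (hr : 1 ≤ r)
    (hC : 0 ≤ C) (hC₂ : 0 ≤ C₂) (hε : 0 ≤ ε) (hCε : 0 ≤ Cε)
    {yn y η u : E d → E d} {W : V O} (hu : MemLp u 4 (vol O))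
    (hu0 : trilinear O u (V.grad W) (V.fn W) = 0)
    (hP : ∀ᵐ x ∂vol O, tri (yn x) (V.grad W x) (yn x) - tri (y x) (V.grad W x) (y x)
        - tri (u x) (V.grad W x) (V.fn W x)
        - β * (‖yn x‖ ^ (r - 1) * inner ℝ (yn x) (V.fn W x)
          - ‖y x‖ ^ (r - 1) * inner ℝ (y x) (V.fn W x)) ≤
        κ * μ * ‖V.grad W x‖ ^ 2 - c * ‖V.fn W x‖ ^ (r + 1) + C * ‖V.fn W x‖ ^ 2
          + C₂ * (‖V.fn W x‖ ^ 2 * (‖y x‖ ^ 2 + ‖η x‖ ^ 2))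
          + ε * (‖y x‖ ^ 4 + ‖y x‖ ^ (r + 1))
          + Cε * (‖η x‖ ^ 2 + ‖η x‖ ^ 4 + ‖η x‖ ^ (r + 1)))
    (hyn4 : PowLe O 4 yn Q') (hynp : PowLe O (r + 1) yn Q')
    (hy4 : PowLe O 4 y Q) (hyp : PowLe O (r + 1) y Q) (hη2 : PowLe O 2 η S)
    (hη4 : PowLe O 4 η S) (hηp : PowLe O (r + 1) η S) (hW4 : PowLe O 4 (V.fn W) R')
    (hWp : PowLe O (r + 1) (V.fn W) R) :
    trilinear O yn (V.grad W) yn - trilinear O y (V.grad W) y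
        - β * (dampTerm O r yn (V.fn W) - dampTerm O r y (V.fn W)) ≤
      κ * μ * ‖V.grad W‖ ^ 2 - c * (∫ x in O, ‖V.fn W x‖ ^ (r + 1)) + C * ‖V.fn W‖ ^ 2
        + C₂ * (√R' * √(2 * (Q + S))) + ε * (2 * Q) + Cε * (3 * S) := by
  have g2 : MemLp (V.grad W) 2 (vol O) := Lp.memLp _
  have t1 := integrable_tri hyn4.memLp_four hyn4.memLp_four g2
  have t2 := integrable_tri hy4.memLp_four hy4.memLp_four g2
  have t3 := integrable_tri hu hW4.memLp_four g2
  have d1 := integrable_damp hr hynp hWp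
  have d2 := integrable_damp hr hyp hWp
  have lhs := ((t1.sub t2).sub t3).sub ((d1.sub d2).const_mul β)
  have a1 := (V.norm_grad_sq_eq W).1.const_mul (κ * μ)
  have a2 := hWp.2.const_mul c
  have a3 := (V.integral_sq_le W).1.const_mul C
  have a4 := (integrable_sq_mul_add hW4 hy4 hη4).1.const_mul C₂
  have a5 := (hy4.four_nat.1.add hyp.2).const_mul ε
  have a6 := ((hη2.two_nat.1.add hη4.four_nat.1).add hηp.2).const_mul Cε
  have h := integral_mono_ae lhs (((((a1.sub a2).add a3).add a4).add a5).add a6) hP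
  rw [integral_sub' ((t1.sub t2).sub t3) ((d1.sub d2).const_mul β),
    integral_sub' (t1.sub t2) t3, integral_sub' t1 t2, integral_const_mul,
    integral_sub' d1 d2, integral_add' ((((a1.sub a2).add a3).add a4).add a5) a6,
    integral_add' (((a1.sub a2).add a3).add a4) a5, integral_add' ((a1.sub a2).add a3) a4,
    integral_add' (a1.sub a2) a3, integral_sub' a1 a2, integral_const_mul, integral_const_mul,
    integral_const_mul, integral_const_mul, integral_const_mul, integral_const_mul,
    integral_add' hy4.four_nat.1 hyp.2, integral_add' (hη2.two_nat.1.add hη4.four_nat.1) hηp.2,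
    integral_add' hη2.two_nat.1 hη4.four_nat.1, (V.norm_grad_sq_eq W).2] at h
  have hu0' : ∫ x in O, tri (u x) (V.grad W x) (V.fn W x) = 0 := hu0
  rw [hu0', sub_zero] at h
  refine h.trans ?_
  have k3 := mul_le_mul_of_nonneg_left (V.integral_sq_le W).2 hC
  have k4 := mul_le_mul_of_nonneg_left (integrable_sq_mul_add hW4 hy4 hη4).2 hC₂
  have k5 := mul_le_mul_of_nonneg_left (add_le_add hy4.four_nat.2 hyp.3) hε
  have k6 := mul_le_mul_of_nonneg_left
    (add_le_add (add_le_add hη2.two_nat.2 hη4.four_nat.2) hηp.3) hCε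
  linarith

/-- The constants `c` and `C` do not depend on `ε`, and `Q` refers to `y` only; the powers of `yn`
are used for integrability but do not occur in the bound. Both facts are needed to pass to the
limit. -/
theorem exists_nonlinear_le (hO : IsOpen O) {μ β r : ℝ} (hμ : 0 < μ) (hβ : 0 < β)
    (hdr : (d = 2 ∧ 1 ≤ r) ∨ (d = 3 ∧ 3 < r) ∨ (d = 3 ∧ r = 3 ∧ 1 ≤ 2 * β * μ)) :
    ∃ c C, 0 < c ∧ 0 ≤ C ∧ ∀ ε > 0, ∃ Cε, 0 ≤ Cε ∧
      ∀ (yn y η : H O) (W : V O) (Q S R : ℝ),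
      (yn : Lp (E d) 2 (vol O)) - y = V.fn W + η →
      PowLe O 4 (y : Lp (E d) 2 (vol O)) Q → PowLe O (r + 1) (y : Lp (E d) 2 (vol O)) Q →
      PowLe O 2 (η : Lp (E d) 2 (vol O)) S → PowLe O 4 (η : Lp (E d) 2 (vol O)) S →
      PowLe O (r + 1) (η : Lp (E d) 2 (vol O)) S → PowLe O (r + 1) (V.fn W) R →
      trilinear O (yn : Lp (E d) 2 (vol O)) (V.grad W) (yn : Lp (E d) 2 (vol O))
        - trilinear O (y : Lp (E d) 2 (vol O)) (V.grad W) (y : Lp (E d) 2 (vol O))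
        - β * (dampTerm O r (yn : Lp (E d) 2 (vol O)) (V.fn W)
          - dampTerm O r (y : Lp (E d) 2 (vol O)) (V.fn W)) ≤
        7 / 8 * μ * ‖V.grad W‖ ^ 2 - c * (∫ x in O, ‖V.fn W x‖ ^ (r + 1))
          + C * (1 + Q + S) * ‖V.fn W‖ ^ 2 + ε * Q + Cε * S := by
  have hr : 1 ≤ r := by
    rcases hdr with h | h | h
    exacts [h.2, by linarith [h.2], by linarith [h.2.1]]
  have hd : d = 2 ∨ d = 3 := by tauto
  obtain ⟨C4, hC4, H4⟩ := V.exists_lintegral_four_le hd hO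
  -- the sum `y + W + η`
  have key : ∀ (yn y η : H O) (W : V O) (Q S R : ℝ),
      (yn : Lp (E d) 2 (vol O)) - y = V.fn W + η →
      PowLe O 4 (y : Lp (E d) 2 (vol O)) Q → PowLe O (r + 1) (y : Lp (E d) 2 (vol O)) Q →
      PowLe O 4 (η : Lp (E d) 2 (vol O)) S →
      PowLe O (r + 1) (η : Lp (E d) 2 (vol O)) S → PowLe O (r + 1) (V.fn W) R →
      PowLe O 4 (V.fn W) (C4 * ‖W‖ ^ 4) ∧
      (∀ᵐ x ∂vol O, (yn : Lp (E d) 2 (vol O)) x - (y : Lp (E d) 2 (vol O)) x =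
        V.fn W x + (η : Lp (E d) 2 (vol O)) x) ∧
      ∃ Q', PowLe O 4 (yn : Lp (E d) 2 (vol O)) Q' ∧
        PowLe O (r + 1) (yn : Lp (E d) 2 (vol O)) Q' := by
    intro yn y η W Q S R he hy4 hyp hη4 hηp hWp
    have hW4 : PowLe O 4 (V.fn W) (C4 * ‖W‖ ^ 4) :=
      PowLe.of_four_le (Lp.aestronglyMeasurable _) (by positivity) (H4 W)
    have hae : ∀ᵐ x ∂vol O, (yn : Lp (E d) 2 (vol O)) x - (y : Lp (E d) 2 (vol O)) x =
        V.fn W x + (η : Lp (E d) 2 (vol O)) x := by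
      filter_upwards [Lp.coeFn_sub (yn : Lp (E d) 2 (vol O)) y,
        Lp.coeFn_add (V.fn W) (η : Lp (E d) 2 (vol O))] with x h1 h2
      rw [he] at h1
      exact h1.symm.trans h2
    have hs : ((y : Lp (E d) 2 (vol O)) : E d → E d) + ((V.fn W : E d → E d) +
        ((η : Lp (E d) 2 (vol O)) : E d → E d))
        =ᵐ[vol O] (yn : Lp (E d) 2 (vol O)) := by
      filter_upwards [hae] with x hx
      rw [Pi.add_apply, Pi.add_apply, ← hx]; abel
    have A := (hy4.add (by norm_num) (hW4.add (by norm_num) hη4)).congr hs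
    have B := (hyp.add (by linarith) (hWp.add (by linarith) hηp)).congr hs
    exact ⟨hW4, hae, _, A.mono (le_max_left _ _), B.mono (le_max_right _ _)⟩
  -- The first case contains all of `d = 3`; in the second one `d = 2`.
  by_cases hcase : 3 < r ∨ r = 3 ∧ 1 ≤ 2 * β * μ
  · obtain ⟨c, C, hc, hC, HP⟩ := exists_difference_le_of_three_le (d := d) hμ hβ hcase
    refine ⟨c, C, hc, hC, fun ε hε => ?_⟩
    -- Half of `ε`, because `Q` bounds the fourth and the `(r+1)`-th powers separately; likewise `S`
    -- bounds three powers of `η`, whence `Cε * 3`.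
    obtain ⟨Cε, hCε, Hε⟩ := HP (ε / 2) (by positivity)
    refine ⟨Cε * 3, by positivity, fun yn y η W Q S R he hy4 hyp hη2 hη4 hηp hWp => ?_⟩
    obtain ⟨hW4, hae, Q', hyn4, hynp⟩ := key yn y η W Q S R he hy4 hyp hη4 hηp hWp
    set U : H O := y + (1 / 2 : ℝ) • (yn - y)
    have hUe : (U : Lp (E d) 2 (vol O)) =ᵐ[vol O] fun x => (y : Lp (E d) 2 (vol O)) x +
        (1 / 2 : ℝ) • ((yn : Lp (E d) 2 (vol O)) x - (y : Lp (E d) 2 (vol O)) x) := by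
      have h1 := Lp.coeFn_add (y : Lp (E d) 2 (vol O)) 
        ((1 / 2 : ℝ) • ((yn : Lp (E d) 2 (vol O)) - (y : Lp (E d) 2 (vol O))))
      have h2 := Lp.coeFn_smul (1 / 2 : ℝ) ((yn : Lp (E d) 2 (vol O)) - (y : Lp (E d) 2 (vol O)))
      have h3 := Lp.coeFn_sub (yn : Lp (E d) 2 (vol O)) (y : Lp (E d) 2 (vol O))
      filter_upwards [h1, h2, h3] with x h1 h2 h3
      rw [Pi.add_apply, h2, Pi.smul_apply, h3] at h1
      exact h1
    have hU4 : MemLp (U : Lp (E d) 2 (vol O)) 4 (vol O) :=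
      (memLp_congr_ae hUe).2
        (hy4.memLp_four.add ((hyn4.memLp_four.sub hy4.memLp_four).const_smul (1 / 2 : ℝ)))
    have hU0 := trilinear_self_eq_zero hd hO hU4 W
    have h := difference_le_of_pointwise (μ := μ) (β := β) (κ := 7 / 8) (c := c) (C := C) (C₂ := 0)
      (ε := ε / 2) (Cε := Cε) hr hC le_rfl (by positivity) hCε hU4 hU0 (η := (η : Lp (E d) 2 (vol O)))
      (by
        filter_upwards [hae, hUe] with x hx hux
        have := Hε _ _ _ _ (V.grad W x) hx
        rw [hux, zero_mul, add_zero]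
        exact this) hyn4 hynp hy4 hyp hη2 hη4 hηp hW4 hWp
    have : 0 ≤ C * (Q + S) * ‖V.fn W‖ ^ 2 := by
      have := hy4.nonneg; have := hη4.nonneg; positivity
    linarith
  · have hd2 : d = 2 := by tauto
    obtain ⟨CL, hCL, HL⟩ := V.exists_lintegral_four_le_planar hd2 hO
    obtain ⟨c, C, C₂, hc, hC, hC₂, HP⟩ := exists_difference_le (d := d) hμ hβ hr
    -- Ladyzhenskaya turns the leftover term into a multiple of `‖w‖ ‖∇w‖ √(2(Q + S))`. Young with
    -- `μ/8` raises the viscous share from `3/4` to `7/8` and produces this coefficient.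
    set K := (4 * (μ / 8))⁻¹ * (C₂ ^ 2 * CL * 2)
    have hK : 0 ≤ K := by positivity
    refine ⟨c, C + K, hc, by positivity, fun ε hε => ?_⟩
    obtain ⟨Cε, hCε, Hε⟩ := HP (ε / 2) (by positivity)
    refine ⟨Cε * 3, by positivity, fun yn y η W Q S R he hy4 hyp hη2 hη4 hηp hWp => ?_⟩
    obtain ⟨-, hae, Q', hyn4, hynp⟩ := key yn y η W Q S R he hy4 hyp hη4 hηp hWp
    have hQ := hy4.nonneg
    have hS := hη4.nonneg
    have hW4 : PowLe O 4 (V.fn W) (CL * (‖V.fn W‖ ^ 2 * ‖V.grad W‖ ^ 2)) :=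
      PowLe.of_four_le (Lp.aestronglyMeasurable _) (by positivity) (HL W)
    have h := difference_le_of_pointwise (μ := μ) (β := β) (κ := 3 / 4) (c := c) (C := C) (C₂ := C₂)
      (ε := ε / 2) (Cε := Cε) hr hC hC₂ (by positivity) hCε hyn4.memLp_four
      (trilinear_self_eq_zero hd hO hyn4.memLp_four W) (η := (η : Lp (E d) 2 (vol O)))
      (by
        filter_upwards [hae] with x hx
        exact Hε _ _ _ _ (V.grad W x) hx) hyn4 hynp hy4 hyp hη2 hη4 hηp hW4 hWp
    have h2 : C₂ * (√(CL * (‖V.fn W‖ ^ 2 * ‖V.grad W‖ ^ 2)) * √(2 * (Q + S))) ≤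
        μ / 8 * ‖V.grad W‖ ^ 2 + K * (Q + S) * ‖V.fn W‖ ^ 2 := by
      have e : √(CL * (‖V.fn W‖ ^ 2 * ‖V.grad W‖ ^ 2)) = √CL * ‖V.fn W‖ * ‖V.grad W‖ := by
        rw [← mul_pow, Real.sqrt_mul hCL, Real.sqrt_sq (by positivity)]; ring
      have h3 := mul_le_mul_sq_add (ε := μ / 8) (by positivity) ‖V.grad W‖
        (C₂ * √CL * ‖V.fn W‖ * √(2 * (Q + S)))
      have e2 : (C₂ * √CL * ‖V.fn W‖ * √(2 * (Q + S))) ^ 2 =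
          C₂ ^ 2 * CL * ‖V.fn W‖ ^ 2 * (2 * (Q + S)) := by
        rw [mul_pow, mul_pow, mul_pow, Real.sq_sqrt hCL, Real.sq_sqrt (by positivity)]
      rw [e2] at h3
      rw [e]
      calc _ = ‖V.grad W‖ * (C₂ * √CL * ‖V.fn W‖ * √(2 * (Q + S))) := by ring
        _ ≤ _ := h3
        _ = _ := by simp only [K]; ring
    have : 0 ≤ C * (Q + S) * ‖V.fn W‖ ^ 2 := by positivity
    have : 0 ≤ K * ‖V.fn W‖ ^ 2 := by positivity
    linarith

end

section

variable {d : ℕ} {O : Set (E d)}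

theorem integral_norm_rpow_eq {p : ℝ} (hp : 1 ≤ p) (z : Lp (E d) (lexp p) (vol O)) :
    ∫ x in O, ‖z x‖ ^ p = ‖z‖ ^ p := by
  have h0 : lexp p ≠ 0 := by rw [lexp_eq hp]; simpa using by linarith
  have ht : lexp p ≠ ⊤ := by rw [lexp_eq hp]; simp
  have hr : (lexp p).toReal = p := by rw [lexp_eq hp, ENNReal.toReal_ofReal (by linarith)]
  have hnn : 0 ≤ ∫ x in O, ‖z x‖ ^ p := integral_nonneg fun x => by positivity
  rw [Lp.norm_def, (Lp.memLp z).eLpNorm_eq_integral_rpow_norm h0 ht, hr,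
    ENNReal.toReal_ofReal (by positivity), ← Real.rpow_mul hnn, inv_mul_cancel₀ (by linarith),
    Real.rpow_one]

theorem VL.powLe_fn {p : ℝ} (hp : 1 ≤ p) (ψ : VL O p) :
    PowLe O p (V.fn ψ.toV) (‖VL.toLL O p ψ‖ ^ p) ∧
      ∫ x in O, ‖V.fn ψ.toV x‖ ^ p = ‖VL.toLL O p ψ‖ ^ p := by
  refine ⟨(PowLe.of_ltilde hp _).congr ψ.fn_ae_eq.symm, ?_⟩
  rw [VL.toLL_apply, Submodule.coe_norm, ← integral_norm_rpow_eq hp]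
  refine integral_congr_ae ?_
  filter_upwards [ψ.fn_ae_eq] with x hx
  rw [hx]

/-- Adds the linear terms to the nonlinear estimate, with the difference of the solutions as test
function `ψ`. -/
theorem exists_equationRHS_sub_le (hO : IsOpen O) {μ α β r : ℝ} (χ : ℝ) (hμ : 0 < μ) (hα : 0 ≤ α)
    (hβ : 0 < β)
    (hdr : (d = 2 ∧ 1 ≤ r) ∨ (d = 3 ∧ 3 < r) ∨ (d = 3 ∧ r = 3 ∧ 1 ≤ 2 * β * μ)) :
    ∃ c C, 0 < c ∧ 0 ≤ C ∧ ∀ ε > 0, ∃ Cε, 0 ≤ Cε ∧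
      ∀ (wn w : V O) (vn v Υn Υ : H O) (fn f : StrongDual ℝ (V O)) (ψ : VL O (r + 1)) (Q S : ℝ),
      V.fn wn = (vn : Lp (E d) 2 (vol O)) → V.fn w = (v : Lp (E d) 2 (vol O)) →
      VL.toVL O (r + 1) ψ = wn - w →
      PowLe O 4 ((v + Υ : H O) : Lp (E d) 2 (vol O)) Q →
      PowLe O (r + 1) ((v + Υ : H O) : Lp (E d) 2 (vol O)) Q →
      ‖Υn - Υ‖ ^ 2 ≤ S → PowLe O 4 ((Υn - Υ : H O) : Lp (E d) 2 (vol O)) S →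
      PowLe O (r + 1) ((Υn - Υ : H O) : Lp (E d) 2 (vol O)) S →
      equationRHS O μ α β χ r wn vn Υn fn ψ - equationRHS O μ α β χ r w v Υ f ψ ≤
        -c * (‖V.grad (wn - w)‖ ^ 2 + ‖VL.toLL O (r + 1) ψ‖ ^ (r + 1))
          + C * (1 + Q + S) * ‖vn - v‖ ^ 2 + ε * Q + Cε * S + C * ‖fn - f‖ ^ 2 := by
  have hr : 1 ≤ r := by
    rcases hdr with h | h | h
    exacts [h.2, by linarith [h.2], by linarith [h.2.1]]
  obtain ⟨c, C, hc, hC, HP⟩ := exists_nonlinear_le hO hμ hβ hdr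
  -- Of the viscosity, `μ/8` remains after the nonlinear estimate; the forcing takes one half and
  -- the other half is kept as dissipation.
  refine ⟨min (μ / 16) c, C + |χ - α| + μ / 16 + (4 * (μ / 16))⁻¹, by positivity, by positivity,
    fun ε hε => ?_⟩
  obtain ⟨Cε, hCε, Hε⟩ := HP ε hε
  refine ⟨Cε + |χ - α|, by positivity, ?_⟩
  intro wn w vn v Υn Υ fn f ψ Q S hwn hw hψ hy4 hyp hη2 hη4 hηp
  have hψ' : ψ.toV = wn - w := hψ
  obtain ⟨hWp, hWi⟩ := ψ.powLe_fn (by linarith)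
  have hη : PowLe O 2 ((Υn - Υ : H O) : Lp (E d) 2 (vol O)) S := (PowLe.of_Lp_two _).mono hη2
  have hfn : V.fn ψ.toV = ((vn - v : H O) : Lp (E d) 2 (vol O)) := by
    rw [hψ', V.fn_sub, hwn, hw, Submodule.coe_sub]
  have hfnn : ‖V.fn ψ.toV‖ = ‖vn - v‖ := by rw [hfn]; rfl
  have hsum : ((vn + Υn : H O) : Lp (E d) 2 (vol O)) - ((v + Υ : H O) : Lp (E d) 2 (vol O)) =
      V.fn ψ.toV + ((Υn - Υ : H O) : Lp (E d) 2 (vol O)) := by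
    rw [hfn, ← Submodule.coe_sub, ← Submodule.coe_add]
    congr 1; abel
  have h1 := Hε (vn + Υn) (v + Υ) (Υn - Υ) ψ.toV Q S _ hsum hy4 hyp hη hη4 hηp hWp
  rw [hWi, hfnn] at h1
  have hQ := hy4.nonneg
  have hS := hη4.nonneg
  have hg : inner ℝ (V.grad wn) (V.grad ψ.toV) - inner ℝ (V.grad w) (V.grad ψ.toV) =
      ‖V.grad ψ.toV‖ ^ 2 := by
    rw [← inner_sub_left, ← V.grad_sub, ← hψ', real_inner_self_eq_norm_sq]
  have hv : inner ℝ (vn : Lp (E d) 2 (vol O)) (V.fn ψ.toV)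
      - inner ℝ (v : Lp (E d) 2 (vol O)) (V.fn ψ.toV) = ‖vn - v‖ ^ 2 := by
    rw [← inner_sub_left, ← Submodule.coe_sub, ← hfn, real_inner_self_eq_norm_sq, hfnn]
  have hU : (χ - α) * (inner ℝ (Υn : Lp (E d) 2 (vol O)) (V.fn ψ.toV)
      - inner ℝ (Υ : Lp (E d) 2 (vol O)) (V.fn ψ.toV)) ≤ |χ - α| * (S + ‖vn - v‖ ^ 2) := by
    rw [← inner_sub_left, ← Submodule.coe_sub]
    refine (le_abs_self _).trans ?_
    rw [abs_mul]
    gcongr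
    refine (abs_real_inner_le_norm _ _).trans ?_
    rw [hfnn]
    have e : ‖((Υn - Υ : H O) : Lp (E d) 2 (vol O))‖ = ‖Υn - Υ‖ := rfl
    rw [e]
    nlinarith [sq_nonneg (‖Υn - Υ‖ - ‖vn - v‖), sq_nonneg ‖Υn - Υ‖, sq_nonneg ‖vn - v‖]
  -- The `𝕍` norm squared is the sum of the `L²` and gradient parts: the gradient is absorbed, the
  -- `L²` part joins the Grönwall coefficient.
  have hF : fn ψ.toV - f ψ.toV ≤ (μ / 16) * (‖vn - v‖ ^ 2 + ‖V.grad ψ.toV‖ ^ 2)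
      + (4 * (μ / 16))⁻¹ * ‖fn - f‖ ^ 2 := by
    have h2 := mul_le_mul_sq_add (ε := μ / 16) (by positivity) ‖ψ.toV‖ ‖fn - f‖
    rw [V.norm_sq_eq, hfnn] at h2
    refine le_trans ?_ h2
    rw [mul_comm]
    exact (le_abs_self _).trans ((fn - f).le_opNorm ψ.toV)
  have hm1 := min_le_left (μ / 16) c
  have hm2 := min_le_right (μ / 16) c
  have k1 := mul_le_mul_of_nonneg_right hm1 (sq_nonneg ‖V.grad ψ.toV‖)
  have k2 := mul_le_mul_of_nonneg_right hm2
    (show 0 ≤ ‖VL.toLL O (r + 1) ψ‖ ^ (r + 1) by positivity)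
  have k3 : 0 ≤ α * ‖vn - v‖ ^ 2 := by positivity
  have k4 : 0 ≤ (|χ - α| + μ / 16 + (4 * (μ / 16))⁻¹) * (Q + S) * ‖vn - v‖ ^ 2 := by positivity
  have k5 : 0 ≤ (4 * (μ / 16))⁻¹ * ‖vn - v‖ ^ 2 := by positivity
  have k6 : 0 ≤ (C + |χ - α| + μ / 16) * ‖fn - f‖ ^ 2 := by positivity
  rw [← hψ']
  simp only [equationRHS, convTerm]
  have g1 : -μ * inner ℝ (V.grad wn) (V.grad ψ.toV) - -μ * inner ℝ (V.grad w) (V.grad ψ.toV) =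
    -μ * ‖V.grad ψ.toV‖ ^ 2 := by rw [← hg]; ring
  have g2 : α * inner ℝ (vn : Lp (E d) 2 (vol O)) (V.fn ψ.toV)
      - α * inner ℝ (v : Lp (E d) 2 (vol O)) (V.fn ψ.toV) = α * ‖vn - v‖ ^ 2 := by
    rw [← hv]; ring
  linarith

end

/-! ### Measurability and integrability in time. -/

section

variable {d : ℕ} {O : Set (E d)} {T : ℝ}

/-- The pair `(w t, z t)` lies in the subspace for almost every `t`; it is redefined as `0`
elsewhere, and measurability passes through the embedding into the product. -/
theorem exists_VL_lift {p : ℝ} {w : ℝ → V O} {z : ℝ → Ltilde O p}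
    (hw : AEStronglyMeasurable w (timeVol T)) (hz : AEStronglyMeasurable z (timeVol T))
    (h : ∀ᵐ t ∂timeVol T, (V.fn (w t) : E d → E d) =ᵐ[vol O] (z t : Lp (E d) (lexp p) (vol O))) :
    ∃ W : ℝ → VL O p, AEStronglyMeasurable W (timeVol T) ∧
      ∀ᵐ t ∂timeVol T, VL.toVL O p (W t) = w t ∧ VL.toLL O p (W t) = z t := by
  classical
  have hW : ∀ᵐ t ∂timeVol T, (w t, z t) ∈ VLSub O p := h
  obtain ⟨W, hWe⟩ : ∃ W : ℝ → VLSub O p, ∀ t, (w t, z t) ∈ VLSub O p → (W t).1 = (w t, z t) :=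
    ⟨fun t => if ht : (w t, z t) ∈ VLSub O p then ⟨_, ht⟩ else 0, fun t ht => by simp only [dif_pos ht]⟩
  have he : IsEmbedding (Subtype.val : VLSub O p → V O × Ltilde O p) := .subtypeVal
  have hm : AEStronglyMeasurable W (timeVol T) := by
    refine (he.aestronglyMeasurable_comp_iff).1 ((hw.prodMk hz).congr ?_)
    filter_upwards [hW] with t ht
    exact (hWe t ht).symm
  refine ⟨W, hm, ?_⟩
  filter_upwards [hW] with t ht
  exact ⟨congrArg Prod.fst (hWe t ht), congrArg Prod.snd (hWe t ht)⟩

theorem RepV.fn_ae_eq {p : ℝ} {v : ℝ → H O} {w : ℝ → V O} {z : ℝ → Ltilde O p}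
    (hw : RepV O T v w) (hz : RepLtilde O T p v z) :
    ∀ᵐ t ∂timeVol T, (V.fn (w t) : E d → E d) =ᵐ[vol O] (z t : Lp (E d) (lexp p) (vol O)) := by
  filter_upwards [hw.2, hz.2] with t h1 h2
  rw [h1]
  exact h2.symm

/-- Each `ψ` comes with its own exceptional null set. A countable dense family has a common one, and
both sides are continuous in `ψ`. This allows test functions that depend on `t`. -/
theorem ae_forall_eq_of_forall_ae_eq {p : ℝ} {g : ℝ → StrongDual ℝ (VL O p)} {F : ℝ → VL O p → ℝ}
    (hF : ∀ᵐ t ∂timeVol T, ∃ L : StrongDual ℝ (VL O p), ∀ ψ, L ψ = F t ψ)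
    (h : ∀ ψ, ∀ᵐ t ∂timeVol T, g t ψ = F t ψ) : ∀ᵐ t ∂timeVol T, ∀ ψ, g t ψ = F t ψ := by
  have h' : ∀ᵐ t ∂timeVol T, ∀ k, g t (TopologicalSpace.denseSeq (VL O p) k) =
      F t (TopologicalSpace.denseSeq (VL O p) k) := ae_all_iff.2 fun k => h _
  filter_upwards [hF, h'] with t ⟨L, hL⟩ ht ψ
  rw [← hL]
  refine congrFun (Continuous.ext_on (TopologicalSpace.denseRange_denseSeq (VL O p))
    (g t).continuous L.continuous ?_) ψ
  rintro _ ⟨k, rfl⟩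
  rw [ht, hL]

/-- Powers of a field of which an `L^p` representative is known. -/
theorem powLe_of_ltilde {p s : ℝ} (hp : 1 ≤ p) (u : H O) (ζ : Ltilde O p)
    (h : ((ζ : Lp (E d) (lexp p) (vol O)) : E d → E d) =ᵐ[vol O] (u : Lp (E d) 2 (vol O)))
    (hs : 2 ≤ s) (hsp : s ≤ p) :
    PowLe O s (u : Lp (E d) 2 (vol O)) (‖u‖ ^ 2 + ‖ζ‖ ^ p) :=
  PowLe.interp (PowLe.of_Lp_two _) ((PowLe.of_ltilde hp _).congr h) hs hsp

theorem integrable_norm_rpow_of_memLp {X : Type*} [NormedAddCommGroup X] {p : ℝ} (hp : 1 ≤ p)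
    {z : ℝ → X} (hz : MemLp z (ENNReal.ofReal p) (timeVol T)) :
    Integrable (fun t => ‖z t‖ ^ p) (timeVol T) := by
  have := hz.integrable_norm_rpow (by simpa using by linarith) (by simp)
  rwa [ENNReal.toReal_ofReal (by linarith)] at this

theorem integrable_norm_sq_of_memLp {X : Type*} [NormedAddCommGroup X] {z : ℝ → X}
    (hz : MemLp z 2 (timeVol T)) : Integrable (fun t => ‖z t‖ ^ 2) (timeVol T) := by
  simpa using hz.integrable_norm_pow (by norm_num)

/-- Integrability in time of the fourth power of `v` has two sources. In the plane it is
Ladyzhenskaya with `v` bounded in `ℍ` on `[0, T]`; in space `r + 1 ≥ 4`, so `L⁴` lies between `L²`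
and `L^{r+1}`. For `Υ`, the exponents `4` and `r + 1` both lie between `2` and `p`. -/
theorem exists_integrable_powLe (hO : IsOpen O) {r p : ℝ}
    (hdr : (d = 2 ∧ 1 ≤ r) ∨ (d = 3 ∧ 3 ≤ r)) (hp : 4 ≤ p) (hrp : r + 1 ≤ p)
    {v Υ : ℝ → H O} {w : ℝ → V O} {z : ℝ → Ltilde O (r + 1)} {ζ : ℝ → Ltilde O p}
    (hv : ContinuousOn v (Icc 0 T)) (hw : RepV O T v w) (hz : RepLtilde O T (r + 1) v z)
    (hΥ : MemLp Υ 2 (timeVol T)) (hζ : RepLtilde O T p Υ ζ) :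
    ∃ Q : ℝ → ℝ, Integrable Q (timeVol T) ∧ ∀ᵐ t ∂timeVol T,
      PowLe O 4 ((v t + Υ t : H O) : Lp (E d) 2 (vol O)) (Q t) ∧
      PowLe O (r + 1) ((v t + Υ t : H O) : Lp (E d) 2 (vol O)) (Q t) := by
  have hr : 1 ≤ r := by rcases hdr with h | h <;> linarith [h.2]
  have hIz := integrable_norm_rpow_of_memLp (by linarith) hz.1
  have hIw := integrable_norm_sq_of_memLp hw.1
  have hIζ := integrable_norm_rpow_of_memLp (by linarith) hζ.1
  have hIΥ := integrable_norm_sq_of_memLp hΥ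
  -- fourth powers of `v`
  obtain ⟨C, hC, H4⟩ : ∃ C : ℝ, 0 ≤ C ∧ ∀ᵐ t ∂timeVol T, PowLe O 4 (v t : Lp (E d) 2 (vol O))
      (C * ‖w t‖ ^ 2 + ‖z t‖ ^ (r + 1)) := by
    rcases hdr with ⟨hd, -⟩ | ⟨hd, hr3⟩
    · obtain ⟨C, hC, HC⟩ := V.exists_lintegral_four_le_planar hd hO
      obtain ⟨B, hB⟩ := isCompact_Icc.exists_bound_of_continuousOn hv
      refine ⟨C * B ^ 2, by positivity, ?_⟩
      filter_upwards [hw.2, ae_restrict_mem measurableSet_Ioo] with t ht htT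
      have h1 : PowLe O 4 (V.fn (w t)) (C * (‖V.fn (w t)‖ ^ 2 * ‖V.grad (w t)‖ ^ 2)) :=
        PowLe.of_four_le (Lp.aestronglyMeasurable _) (by positivity) (HC _)
      have hb : ‖V.fn (w t)‖ ≤ B := by rw [ht]; exact hB t (Ioo_subset_Icc_self htT)
      have h2 : C * (‖V.fn (w t)‖ ^ 2 * ‖V.grad (w t)‖ ^ 2) ≤
          C * B ^ 2 * ‖w t‖ ^ 2 + ‖z t‖ ^ (r + 1) := by
        calc _ ≤ C * (B ^ 2 * ‖w t‖ ^ 2) := by gcongr; exact V.norm_grad_le _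
          _ ≤ _ := by
            have : 0 ≤ ‖z t‖ ^ (r + 1) := by positivity
            linarith
      rw [← ht]
      exact h1.mono h2
    · refine ⟨1, by norm_num, ?_⟩
      filter_upwards [hw.2, hz.2] with t h1 h2
      refine (powLe_of_ltilde (by linarith) (v t) (z t) h2 (s := 4) (by norm_num)
        (by linarith)).mono ?_
      have : ‖v t‖ ≤ ‖w t‖ := by
        have := V.norm_fn_le (w t)
        rw [h1] at this
        exact this
      rw [one_mul]
      gcongr
  refine ⟨fun t => (2 ^ (4 : ℝ) + 2 ^ (r + 1)) * ((C * ‖w t‖ ^ 2 + ‖z t‖ ^ (r + 1)) +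
    (‖Υ t‖ ^ 2 + ‖ζ t‖ ^ p)), (((hIw.const_mul C).add hIz).add (hIΥ.add hIζ)).const_mul _, ?_⟩
  filter_upwards [H4, hz.2, hζ.2] with t h4 h1 h2
  have a4 := powLe_of_ltilde (by linarith) (Υ t) (ζ t) h2 (s := 4) (by norm_num) hp
  have ap := powLe_of_ltilde (by linarith) (Υ t) (ζ t) h2 (s := r + 1) (by linarith) hrp
  have b : PowLe O (r + 1) (v t : Lp (E d) 2 (vol O)) (C * ‖w t‖ ^ 2 + ‖z t‖ ^ (r + 1)) :=
    ((PowLe.of_ltilde (by linarith) _).congr h1).mono (by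
      have : 0 ≤ C * ‖w t‖ ^ 2 := by positivity
      exact le_add_of_nonneg_left this)
  have hs : ((v t : Lp (E d) 2 (vol O)) : E d → E d) + ((Υ t : Lp (E d) 2 (vol O)) : E d → E d) =ᵐ[vol O]
      ((v t + Υ t : H O) : Lp (E d) 2 (vol O)) :=
    (Lp.coeFn_add (v t : Lp (E d) 2 (vol O)) (Υ t : Lp (E d) 2 (vol O))).symm
  have n1 := h4.nonneg
  have n2 := a4.nonneg
  refine ⟨((h4.add (by norm_num) a4).congr hs).mono ?_,
    ((b.add (by linarith) ap).congr hs).mono ?_⟩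
  · gcongr
    exact le_add_of_nonneg_right (by positivity)
  · gcongr
    exact le_add_of_nonneg_left (by positivity)

/-- The coefficients of the functional have the time exponents dual to `L²(0, T; 𝕍)` and `L^{r+1}(0,
T; L̃^{r+1})`. -/
theorem exists_memLp_bound {μ α β χ r : ℝ} (hr : 1 ≤ r) {v Υ : ℝ → H O} {w : ℝ → V O}
    {f : ℝ → StrongDual ℝ (V O)} {Q : ℝ → ℝ} (hw : RepV O T v w) (hΥ : MemLp Υ 2 (timeVol T))
    (hf : MemLp f 2 (timeVol T)) (hQ : Integrable Q (timeVol T))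
    (hQ0 : ∀ᵐ t ∂timeVol T, 0 ≤ Q t) :
    MemLp (fun t => μ * ‖V.grad (w t)‖ + √(Q t) + α * ‖v t‖ + |χ - α| * ‖Υ t‖ + ‖f t‖) 2
      (timeVol T) ∧ MemLp (fun t => β * Q t ^ (r / (r + 1))) (ENNReal.ofReal ((r + 1) / r))
      (timeVol T) := by
  have hg : MemLp (fun t => ‖V.grad (w t)‖) 2 (timeVol T) :=
    ((V.gradL O).comp_memLp' hw.1).norm
  have hv : MemLp (fun t => ‖v t‖) 2 (timeVol T) := by
    refine (((V.fnL O).comp_memLp' hw.1).norm).ae_eq ?_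
    filter_upwards [hw.2] with t ht
    exact congrArg norm ht
  have hs : MemLp (fun t => √(Q t)) 2 (timeVol T) := by
    refine (memLp_two_iff_integrable_sq
      (Real.continuous_sqrt.comp_aestronglyMeasurable hQ.1)).2 (hQ.congr ?_)
    filter_upwards [hQ0] with t ht
    exact (Real.sq_sqrt ht).symm
  refine ⟨(((hg.const_mul μ).add hs).add (hv.const_mul α)).add (hΥ.norm.const_mul _) |>.add hf.norm,
    MemLp.const_mul ?_ β⟩
  have h := (memLp_one_iff_integrable.2 hQ).norm_rpow_div (ENNReal.ofReal (r / (r + 1)))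
  have h0 : 0 < r := by linarith
  rw [ENNReal.toReal_ofReal (by positivity), ← ENNReal.ofReal_one,
    ← ENNReal.ofReal_div_of_pos (by positivity), one_div_div] at h
  refine h.ae_eq ?_
  filter_upwards [hQ0] with t ht
  rw [Real.norm_of_nonneg ht]

end

/-! ### Energy identity for the difference of two solutions. -/

section

variable {d : ℕ} {O : Set (E d)} {T : ℝ}

theorem ae_restrict_Ioc_of_timeVol {P : ℝ → Prop} {t : ℝ} (ht : t ∈ Icc 0 T)
    (h : ∀ᵐ s ∂timeVol T, P s) : ∀ᵐ s ∂volume.restrict (Ioc 0 t), P s := by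
  rw [timeVol, restrict_Ioo_eq_restrict_Ioc] at h
  exact ae_restrict_of_ae_restrict_of_subset (Ioc_subset_Ioc_right ht.2) h

theorem integral_congr_of_timeVol {F G : ℝ → ℝ} {t : ℝ} (ht : t ∈ Icc 0 T)
    (h : ∀ᵐ s ∂timeVol T, F s = G s) : ∫ s in (0 : ℝ)..t, F s = ∫ s in (0 : ℝ)..t, G s := by
  rw [intervalIntegral.integral_of_le ht.1, intervalIntegral.integral_of_le ht.1]
  exact integral_congr_ae (ae_restrict_Ioc_of_timeVol ht h)

theorem intervalIntegrable_of_timeVol {F : ℝ → ℝ} {t : ℝ} (ht : t ∈ Icc 0 T)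
    (h : Integrable F (timeVol T)) : IntervalIntegrable F volume 0 t := by
  rw [intervalIntegrable_iff_integrableOn_Ioc_of_le ht.1]
  rw [timeVol, restrict_Ioo_eq_restrict_Ioc] at h
  exact h.mono_measure (Measure.restrict_mono (Ioc_subset_Ioc_right ht.2) le_rfl)

/-- What the energy estimates use of a weak solution `v`: representatives `w`, `z` in `𝕍` and
`L̃^{r+1}`, the time derivative `g`, and a bound `Q` of the powers of `v + Υ`. -/
structure SolutionData (O : Set (E d)) (T μ α β χ r : ℝ) (f : ℝ → StrongDual ℝ (V O))
    (Υ v : ℝ → H O) (w : ℝ → V O) (z : ℝ → Ltilde O (r + 1))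
    (g : ℝ → StrongDual ℝ (VL O (r + 1))) (Q a c : ℝ → ℝ) : Prop where
  cont : ContinuousOn v (Icc 0 T)
  repV : RepV O T v w
  repL : RepLtilde O T (r + 1) v z
  meas : AEStronglyMeasurable g (timeVol T)
  integrable_apply : ∀ ψ, IntegrableOn (fun t => g t ψ) (Ioo 0 T)
  integrable : Integrable Q (timeVol T)
  powLe : ∀ᵐ t ∂timeVol T, PowLe O 4 ((v t + Υ t : H O) : Lp (E d) 2 (vol O)) (Q t) ∧
    PowLe O (r + 1) ((v t + Υ t : H O) : Lp (E d) 2 (vol O)) (Q t)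
  eq : ∀ᵐ t ∂timeVol T, ∀ ψ, g t ψ = equationRHS O μ α β χ r (w t) (v t) (Υ t) (f t) ψ
  memLp_a : MemLp a 2 (timeVol T)
  memLp_c : MemLp c (ENNReal.ofReal ((r + 1) / r)) (timeVol T)
  bound : ∀ᵐ t ∂timeVol T, ∀ ψ, |g t ψ| ≤ a t * ‖VL.toVL O (r + 1) ψ‖ +
    c t * ‖VL.toLL O (r + 1) ψ‖
  deriv : ∀ ψ : VL O (r + 1), ∀ s ∈ Icc 0 T, ∀ t ∈ Icc 0 T,
    inner ℝ (v t : Lp (E d) 2 (vol O)) (V.fn ψ.toV) -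
      inner ℝ (v s : Lp (E d) 2 (vol O)) (V.fn ψ.toV) = ∫ τ in s..t, g τ ψ

theorem IsWeakSolution.exists_data (hO : IsOpen O) {μ α β χ r p : ℝ} (hμ : 0 ≤ μ) (hα : 0 ≤ α)
    (hβ : 0 ≤ β) (hdr : (d = 2 ∧ 1 ≤ r) ∨ (d = 3 ∧ 3 ≤ r)) (hp : 4 ≤ p) (hrp : r + 1 ≤ p)
    {x : H O} {f : ℝ → StrongDual ℝ (V O)} {v Υ : ℝ → H O} {ζ : ℝ → Ltilde O p}
    (h : IsWeakSolution O T μ α β χ r x f Υ v) (hf : MemLp f 2 (timeVol T))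
    (hΥ : MemLp Υ 2 (timeVol T)) (hζ : RepLtilde O T p Υ ζ) :
    ∃ w z g Q a c, SolutionData O T μ α β χ r f Υ v w z g Q a c := by
  have hr : 1 ≤ r := by rcases hdr with h | h <;> linarith [h.2]
  obtain ⟨hv, -, w, z, g, hw, hz, hg, hgd, hgeq, -⟩ := h
  obtain ⟨Q, hQ, hpow⟩ := exists_integrable_powLe hO hdr hp hrp hv hw hz hΥ hζ
  have hQ0 : ∀ᵐ t ∂timeVol T, 0 ≤ Q t := by filter_upwards [hpow] with t ht using ht.1.nonneg
  obtain ⟨ha, hc⟩ := exists_memLp_bound (μ := μ) (α := α) (β := β) (χ := χ) hr hw hΥ hf hQ hQ0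
  have hex : ∀ᵐ t ∂timeVol T, ∃ L : StrongDual ℝ (VL O (r + 1)),
      (∀ ψ, L ψ = equationRHS O μ α β χ r (w t) (v t) (Υ t) (f t) ψ) ∧
      ∀ ψ, |L ψ| ≤ (μ * ‖V.grad (w t)‖ + √(Q t) + α * ‖v t‖ + |χ - α| * ‖Υ t‖ + ‖f t‖) *
        ‖VL.toVL O (r + 1) ψ‖ + (β * Q t ^ (r / (r + 1))) * ‖VL.toLL O (r + 1) ψ‖ := by
    filter_upwards [hpow] with t ht
    exact exists_equationRHS_eq hμ hα hβ hr (w t) (v t) (Υ t) (f t) ht.1 ht.2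
  have heq : ∀ᵐ t ∂timeVol T, ∀ ψ,
      g t ψ = equationRHS O μ α β χ r (w t) (v t) (Υ t) (f t) ψ :=
    ae_forall_eq_of_forall_ae_eq (hex.mono fun t ⟨L, hL, _⟩ => ⟨L, hL⟩) hgeq
  have hgi : ∀ ψ, IntegrableOn (fun t => g t ψ) (Ioo 0 T) := by
    intro ψ
    have h1 : Integrable g (timeVol T) := hg.integrable (by
      rw [← ENNReal.ofReal_one]
      refine ENNReal.ofReal_le_ofReal ((one_le_div (by linarith)).2 (by linarith)))
    exact (ContinuousLinearMap.apply ℝ ℝ ψ).integrable_comp h1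
  refine ⟨w, z, g, Q, _, _, hv, hw, hz, hg.1, hgi, hQ, hpow, heq, ha, hc, ?_, ?_⟩
  · filter_upwards [hex, heq] with t ⟨L, hL, hLb⟩ ht ψ
    rw [ht, ← hL]
    exact hLb ψ
  · intro ψ
    refine sub_eq_integral_of_weak_deriv (φ := fun t => inner ℝ (v t : Lp (E d) 2 (vol O))
      (V.fn ψ.toV)) ?_ (hgi ψ) fun θ h1 h2 h3 => hgd θ h1 h2 h3 ψ
    have : ContinuousOn (fun t => (v t : Lp (E d) 2 (vol O))) (Icc 0 T) :=
      continuous_subtype_val.comp_continuousOn hv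
    exact this.inner continuousOn_const

/-- Energy equalities for the two solutions separately say nothing about the mixed term `(v', v)`.
The chain rule is therefore applied to `v' - v` itself, with `W` its lift to `𝕍 ∩ L̃^{r+1}`. -/
theorem SolutionData.exists_energy_eq {μ α β χ r : ℝ} (hr : 1 ≤ r)
    {f f' : ℝ → StrongDual ℝ (V O)} {Υ Υ' v v' : ℝ → H O} {w w' : ℝ → V O}
    {z z' : ℝ → Ltilde O (r + 1)} {g g' : ℝ → StrongDual ℝ (VL O (r + 1))}
    {Q Q' a a' c c' : ℝ → ℝ} (h' : SolutionData O T μ α β χ r f' Υ' v' w' z' g' Q' a' c')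
    (h : SolutionData O T μ α β χ r f Υ v w z g Q a c) :
    ∃ W : ℝ → VL O (r + 1), (∀ᵐ t ∂timeVol T, VL.toVL O (r + 1) (W t) = w' t - w t ∧
        VL.toLL O (r + 1) (W t) = z' t - z t) ∧
      Integrable (fun t => equationRHS O μ α β χ r (w' t) (v' t) (Υ' t) (f' t) (W t)
        - equationRHS O μ α β χ r (w t) (v t) (Υ t) (f t) (W t)) (timeVol T) ∧
      ∀ t ∈ Icc 0 T, ‖v' t - v t‖ ^ 2 - ‖v' 0 - v 0‖ ^ 2 = 2 * ∫ s in (0 : ℝ)..t,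
        (equationRHS O μ α β χ r (w' s) (v' s) (Υ' s) (f' s) (W s)
        - equationRHS O μ α β χ r (w s) (v s) (Υ s) (f s) (W s)) := by
  obtain ⟨W, hWm, hW⟩ := exists_VL_lift (p := r + 1) (h'.repV.1.1.sub h.repV.1.1)
    (h'.repL.1.1.sub h.repL.1.1) (by
      filter_upwards [h'.repV.fn_ae_eq h'.repL, h.repV.fn_ae_eq h.repL] with t h1 h2
      have e1 := Lp.coeFn_sub (V.fn (w' t)) (V.fn (w t))
      have e2 := Lp.coeFn_sub (z' t : Lp (E d) (lexp (r + 1)) (vol O)) (z t)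
      exact e1.trans ((h1.sub h2).trans e2.symm))
  have hr0 : 0 < r := by linarith
  have hconj : ENNReal.HolderTriple (ENNReal.ofReal ((r + 1) / r)) (ENNReal.ofReal (r + 1)) 1 :=
    (holderConjugate_add_one hr).ennrealOfReal
  have key := norm_sq_sub_eq_integral (T := T) (p₁ := 2) (q₁ := 2)
    (p₂ := ENNReal.ofReal (r + 1)) (q₂ := ENNReal.ofReal ((r + 1) / r))
    (((V.fnL O).comp (VL.toVL O (r + 1))).toLinearMap) (VL.toVL O (r + 1)) (VL.toLL O (r + 1))
    (by norm_num) (by simp) (by rw [← ENNReal.ofReal_one]; exact ENNReal.ofReal_le_ofReal (by linarith))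
    (by simp) (w := fun t => ((v' t - v t : H O) : Lp (E d) 2 (vol O))) (W := W)
    (G := fun t => g' t - g t) (a := fun t => a' t + a t) (c := fun t => c' t + c t)
    (continuous_subtype_val.comp_continuousOn (h'.cont.sub h.cont)) hWm
    (by
      filter_upwards [hW, h'.repV.2, h.repV.2] with t ht h1 h2
      change V.fn (VL.toVL O (r + 1) (W t)) = _
      rw [ht.1]
      change V.fn (w' t - w t) = _
      rw [V.fn_sub, h1, h2]; rfl)
    ((h'.repV.1.sub h.repV.1).ae_eq (hW.mono fun t ht => ht.1.symm))
    ((h'.repL.1.sub h.repL.1).ae_eq (hW.mono fun t ht => ht.2.symm))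
    (h'.meas.sub h.meas) (h'.memLp_a.add h.memLp_a) (h'.memLp_c.add h.memLp_c)
    (by
      filter_upwards [h'.bound, h.bound] with t h1 h2 ψ
      have := abs_sub (g' t ψ) (g t ψ)
      have e : (g' t - g t) ψ = g' t ψ - g t ψ := rfl
      rw [e]
      linarith [h1 ψ, h2 ψ])
    (fun ψ => (h'.integrable_apply ψ).sub (h.integrable_apply ψ))
    (by
      intro ψ s hs t ht
      have i1 := (h'.integrable_apply ψ)
      have i2 := (h.integrable_apply ψ)
      have hint : ∀ {F : ℝ → ℝ}, IntegrableOn F (Ioo 0 T) → IntervalIntegrable F volume s t :=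
        fun hF => (intervalIntegrable_of_timeVol hs hF).symm.trans
          (intervalIntegrable_of_timeVol ht hF)
      have e : ∫ τ in s..t, (g' τ - g τ) ψ = (∫ τ in s..t, g' τ ψ) - ∫ τ in s..t, g τ ψ :=
        intervalIntegral.integral_sub (hint i1) (hint i2)
      rw [e, ← h'.deriv ψ s hs t ht, ← h.deriv ψ s hs t ht]
      change inner ℝ ((v' t : Lp (E d) 2 (vol O)) - v t) (V.fn ψ.toV) -
        inner ℝ ((v' s : Lp (E d) 2 (vol O)) - v s) (V.fn ψ.toV) = _
      rw [inner_sub_left, inner_sub_left]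
      ring)
  have hEq : ∀ᵐ t ∂timeVol T, (g' t - g t) (W t) =
      equationRHS O μ α β χ r (w' t) (v' t) (Υ' t) (f' t) (W t)
        - equationRHS O μ α β χ r (w t) (v t) (Υ t) (f t) (W t) := by
    filter_upwards [h'.eq, h.eq] with t h1 h2
    rw [← h1, ← h2]; rfl
  refine ⟨W, hW, key.1.congr hEq, fun t ht => ?_⟩
  rw [← integral_congr_of_timeVol ht hEq]
  exact key.2 t ht

end

/-! ### Grönwall argument for the energy and passage to the limit. -/

section

variable {d : ℕ} {O : Set (E d)} {T : ℝ}

theorem integral_le_of_timeVol {F : ℝ → ℝ} {t : ℝ} (ht : t ∈ Icc 0 T)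
    (hF : Integrable F (timeVol T)) (h0 : ∀ᵐ s ∂timeVol T, 0 ≤ F s) :
    ∫ s in (0 : ℝ)..t, F s ≤ ∫ s, F s ∂timeVol T := by
  rw [intervalIntegral.integral_of_le ht.1]
  rw [timeVol, restrict_Ioo_eq_restrict_Ioc] at h0 hF ⊢
  exact setIntegral_mono_set hF h0 (Ioc_subset_Ioc_right ht.2).eventuallyLE

theorem integral_mono_of_timeVol {F G : ℝ → ℝ} {t : ℝ} (ht : t ∈ Icc 0 T)
    (hF : Integrable F (timeVol T)) (hG : Integrable G (timeVol T))
    (h : ∀ᵐ s ∂timeVol T, F s ≤ G s) : ∫ s in (0 : ℝ)..t, F s ≤ ∫ s in (0 : ℝ)..t, G s :=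
  intervalIntegral.integral_mono_ae_restrict ht.1 (intervalIntegrable_of_timeVol ht hF)
    (intervalIntegrable_of_timeVol ht hG) (by
      rw [restrict_Ioc_eq_restrict_Icc.symm]
      exact ae_restrict_Ioc_of_timeVol ht h)

/-- A Gronwall estimate for `X` whose increments are controlled by the density `D`. -/
theorem add_integral_le_of_density {X D F k R : ℝ → ℝ} (hT : 0 ≤ T) {c : ℝ} (hc : 0 ≤ c)
    (hX : ContinuousOn X (Icc 0 T)) (hX0 : ∀ t, 0 ≤ X t) (hD : Integrable D (timeVol T))
    (hF : Integrable F (timeVol T)) (hF0 : ∀ t, 0 ≤ F t) (hk : Integrable k (timeVol T))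
    (hk0 : ∀ᵐ t ∂timeVol T, 0 ≤ k t) (hR : Integrable R (timeVol T))
    (hR0 : ∀ᵐ t ∂timeVol T, 0 ≤ R t) (hXD : ∀ t ∈ Icc 0 T, X t - X 0 = 2 * ∫ s in (0 : ℝ)..t, D s)
    (h : ∀ᵐ t ∂timeVol T, D t ≤ -c * F t + k t * X t + R t) :
    ∀ t ∈ Icc 0 T, X t + 2 * c * (∫ s in (0 : ℝ)..t, F s) ≤
      (X 0 + 2 * ∫ s, R s ∂timeVol T) * Real.exp (2 * ∫ s, k s ∂timeVol T) := by
  have hkX : Integrable (fun t => k t * X t) (timeVol T) := by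
    have h1 : IntegrableOn k (Icc 0 T) :=
      (integrableOn_Icc_iff_integrableOn_Ioo (by simp) (by simp)).2 hk
    exact (h1.mul_continuousOn hX isCompact_Icc).mono_set Ioo_subset_Icc_self
  have hk2 : Integrable (fun t => 2 * k t) (timeVol T) := hk.const_mul 2
  have hA0 : 0 ≤ X 0 + 2 * ∫ s, R s ∂timeVol T := by
    have := integral_nonneg_of_ae hR0
    have := hX0 0
    positivity
  have main : ∀ t ∈ Icc 0 T, X t + 2 * c * (∫ s in (0 : ℝ)..t, F s) ≤
      (X 0 + 2 * ∫ s, R s ∂timeVol T) + ∫ s in (0 : ℝ)..t, 2 * k s * X s := by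
    intro t ht
    have h1 := integral_mono_of_timeVol ht hD (((hF.const_mul (-c)).add hkX).add hR) h
    have iF := (intervalIntegrable_of_timeVol ht hF).const_mul (-c)
    have ik := intervalIntegrable_of_timeVol ht hkX
    have iR := intervalIntegrable_of_timeVol ht hR
    have e1 : ∫ s in (0 : ℝ)..t, (-c * F s + k s * X s + R s) =
        -c * (∫ s in (0 : ℝ)..t, F s) + (∫ s in (0 : ℝ)..t, k s * X s) +
          ∫ s in (0 : ℝ)..t, R s := by
      rw [intervalIntegral.integral_add (iF.add ik) iR, intervalIntegral.integral_add iF ik,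
        intervalIntegral.integral_const_mul]
    have e2 : ∫ s in (0 : ℝ)..t, 2 * k s * X s = 2 * ∫ s in (0 : ℝ)..t, k s * X s := by
      rw [← intervalIntegral.integral_const_mul]
      simp_rw [mul_assoc]
    have h2 := integral_le_of_timeVol ht hR hR0
    have h3 := hXD t ht
    rw [e2]
    change _ ≤ ∫ s in (0 : ℝ)..t, (-c * F s + k s * X s + R s) at h1
    rw [e1] at h1
    linarith
  have hFt : ∀ t ∈ Icc 0 T, 0 ≤ 2 * c * ∫ s in (0 : ℝ)..t, F s := fun t ht =>
    mul_nonneg (by positivity) (intervalIntegral.integral_nonneg ht.1 fun s _ => hF0 s)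
  -- Grönwall bounds the whole right side of `main`, not only `X`, so the dissipation integral is
  -- controlled at the same time.
  have gr := le_mul_exp_integral hT hX hk2 (hk0.mono fun t ht => by positivity)
    fun t ht => (le_add_of_nonneg_right (hFt t ht)).trans (main t ht)
  intro t ht
  refine (main t ht).trans ((gr t ht).trans ?_)
  gcongr
  rw [← integral_const_mul]
  exact integral_le_of_timeVol ht hk2 (hk0.mono fun t ht => by positivity)

/-- The order of choices matters: `ε` is fixed first, from `I` and `K` alone, and only then does `n`
grow to beat the possibly huge `Cε`. -/
theorem eventually_forall_le_of_forall_eps {α : Type*} {Φ : ℕ → α → ℝ} {s : Set α} {I K C : ℝ}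
    (hI : 0 ≤ I) {a b e : ℕ → ℝ} (ha : Tendsto a atTop (𝓝 0)) (hb : Tendsto b atTop (𝓝 0))
    (he : Tendsto e atTop (𝓝 0))
    (H : ∀ ε > 0, ∃ Cε : ℝ, ∀ n, ∀ t ∈ s, Φ n t ≤
      (a n + 2 * (ε * I + Cε * b n + C * e n)) * Real.exp (K + 2 * C * b n)) :
    ∀ δ > 0, ∀ᶠ n in atTop, ∀ t ∈ s, Φ n t ≤ δ := by
  intro δ hδ
  -- Makes the limit `2 ε I e^K` strictly less than `δ`, also when `I = 0`.
  set ε := δ / (2 * (I * Real.exp K + 1))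
  have hε : 0 < ε := by positivity
  obtain ⟨Cε, HC⟩ := H ε hε
  have hlim : Tendsto (fun n => (a n + 2 * (ε * I + Cε * b n + C * e n)) *
      Real.exp (K + 2 * C * b n)) atTop
      (𝓝 ((0 + 2 * (ε * I + Cε * 0 + C * 0)) * Real.exp (K + 2 * C * 0))) :=
    (ha.add (((hb.const_mul Cε).const_add (ε * I) |>.add (he.const_mul C)).const_mul 2)).mul
      ((Real.continuous_exp.tendsto _).comp ((hb.const_mul (2 * C)).const_add K))
  have hlt : (0 + 2 * (ε * I + Cε * 0 + C * 0)) * Real.exp (K + 2 * C * 0) < δ := by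
    have h1 : ε * (2 * (I * Real.exp K + 1)) = δ := div_mul_cancel₀ _ (by positivity)
    simp only [mul_zero, add_zero, zero_add]
    nlinarith
  filter_upwards [hlim.eventually_lt_const hlt] with n hn t ht
  exact (HC n t ht).trans hn.le

theorem tendsto_eLpNorm_zero_iff {X : Type*} [NormedAddCommGroup X] {p : ℝ} (hp : 1 ≤ p)
    {z : ℕ → ℝ → X} (hz : ∀ n, MemLp (z n) (ENNReal.ofReal p) (timeVol T)) :
    Tendsto (fun n => eLpNorm (z n) (ENNReal.ofReal p) (timeVol T)) atTop (𝓝 0) ↔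
      Tendsto (fun n => ∫ t, ‖z n t‖ ^ p ∂timeVol T) atTop (𝓝 0) := by
  have hp0 : 0 < p := by linarith
  have e : ∀ n, eLpNorm (z n) (ENNReal.ofReal p) (timeVol T) =
      ENNReal.ofReal ((∫ t, ‖z n t‖ ^ p ∂timeVol T) ^ p⁻¹) := fun n => by
    rw [(hz n).eLpNorm_eq_integral_rpow_norm (by simpa using hp0) (by simp),
      ENNReal.toReal_ofReal hp0.le]
  have h0 : ∀ n, 0 ≤ ∫ t, ‖z n t‖ ^ p ∂timeVol T := fun n =>
    integral_nonneg fun t => by positivity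
  simp_rw [e]
  constructor
  · intro h
    have h1 := (ENNReal.tendsto_toReal ENNReal.zero_ne_top).comp h
    have h2 := h1.rpow_const (p := p) (Or.inr hp0.le)
    simp only [ENNReal.toReal_zero, Real.zero_rpow hp0.ne'] at h2
    refine h2.congr fun n => ?_
    rw [Function.comp_apply, ENNReal.toReal_ofReal (by have := h0 n; positivity),
      ← Real.rpow_mul (h0 n), inv_mul_cancel₀ hp0.ne', Real.rpow_one]
  · intro h
    have h2 := h.rpow_const (p := p⁻¹) (Or.inr (by positivity))
    rw [Real.zero_rpow (by positivity)] at h2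
    have h3 := (ENNReal.continuous_ofReal.tendsto 0).comp h2
    rwa [ENNReal.ofReal_zero] at h3

theorem tendsto_eLpNorm_two_zero_iff {X : Type*} [NormedAddCommGroup X]
    {z : ℕ → ℝ → X} (hz : ∀ n, MemLp (z n) 2 (timeVol T)) :
    Tendsto (fun n => eLpNorm (z n) 2 (timeVol T)) atTop (𝓝 0) ↔
      Tendsto (fun n => ∫ t, ‖z n t‖ ^ 2 ∂timeVol T) atTop (𝓝 0) := by
  have h := tendsto_eLpNorm_zero_iff (T := T) (p := 2) (by norm_num) (z := z) (by simpa using hz)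
  simpa using h

end

/-! ### Stability estimate and convergence of the energies. -/

section

variable {d : ℕ} {O : Set (E d)} {T : ℝ}

/-- Apart from differences of data, only `Q`, belonging to the unprimed solution, occurs on the
right. With the limit in that role, no uniform bound on the approximating solutions is required. -/
theorem exists_stability_bound (hO : IsOpen O) {μ α β r p : ℝ} (χ : ℝ) (hT : 0 ≤ T) (hμ : 0 < μ)
    (hα : 0 ≤ α) (hβ : 0 < β)
    (hdr : (d = 2 ∧ 1 ≤ r) ∨ (d = 3 ∧ 3 < r) ∨ (d = 3 ∧ r = 3 ∧ 1 ≤ 2 * β * μ))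
    (hp : 4 ≤ p) (hrp : r + 1 ≤ p) :
    ∃ c C, 0 < c ∧ 0 ≤ C ∧ ∀ ε > 0, ∃ Cε, 0 ≤ Cε ∧
      ∀ {f f' : ℝ → StrongDual ℝ (V O)} {Υ Υ' v v' : ℝ → H O} {w w' : ℝ → V O}
        {z z' : ℝ → Ltilde O (r + 1)} {g g' : ℝ → StrongDual ℝ (VL O (r + 1))}
        {Q Q' a a' b b' : ℝ → ℝ} {ζ ζ' : ℝ → Ltilde O p},
        SolutionData O T μ α β χ r f' Υ' v' w' z' g' Q' a' b' →
        SolutionData O T μ α β χ r f Υ v w z g Q a b →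
        MemLp f' 2 (timeVol T) → MemLp f 2 (timeVol T) →
        MemLp Υ' 2 (timeVol T) → MemLp Υ 2 (timeVol T) →
        RepLtilde O T p Υ' ζ' → RepLtilde O T p Υ ζ → ∀ t ∈ Icc 0 T,
        ‖v' t - v t‖ ^ 2 + 2 * c * (∫ s in (0 : ℝ)..t,
          (‖V.grad (w' s - w s)‖ ^ 2 + ‖z' s - z s‖ ^ (r + 1))) ≤
        (‖v' 0 - v 0‖ ^ 2 + 2 * (ε * (∫ s, Q s ∂timeVol T) + Cε * ((∫ s, ‖Υ' s - Υ s‖ ^ 2 ∂timeVol T)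
            + ∫ s, ‖ζ' s - ζ s‖ ^ p ∂timeVol T) + C * ∫ s, ‖f' s - f s‖ ^ 2 ∂timeVol T)) *
          Real.exp (2 * C * (T + ∫ s, Q s ∂timeVol T) + 2 * C * ((∫ s, ‖Υ' s - Υ s‖ ^ 2 ∂timeVol T)
            + ∫ s, ‖ζ' s - ζ s‖ ^ p ∂timeVol T)) := by
  have hr : 1 ≤ r := by
    rcases hdr with h | h | h
    exacts [h.2, by linarith [h.2], by linarith [h.2.1]]
  obtain ⟨c, C, hc, hC, HP⟩ := exists_equationRHS_sub_le hO χ hμ hα hβ hdr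
  refine ⟨c, C, hc, hC, fun ε hε => ?_⟩
  obtain ⟨Cε, hCε, Hε⟩ := HP ε hε
  refine ⟨Cε, hCε, ?_⟩
  intro f f' Υ Υ' v v' w w' z z' g g' Q Q' a a' b b' ζ ζ' h' h hf' hf hΥ' hΥ hζ' hζ
  obtain ⟨W, hW, hD, hE⟩ := SolutionData.exists_energy_eq hr h' h
  have iΥ : Integrable (fun t => ‖Υ' t - Υ t‖ ^ 2) (timeVol T) :=
    integrable_norm_sq_of_memLp (hΥ'.sub hΥ)
  have iζ : Integrable (fun t => ‖ζ' t - ζ t‖ ^ p) (timeVol T) :=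
    integrable_norm_rpow_of_memLp (by linarith) (hζ'.1.sub hζ.1)
  have iF : Integrable (fun t => ‖f' t - f t‖ ^ 2) (timeVol T) :=
    integrable_norm_sq_of_memLp (hf'.sub hf)
  have ig : Integrable (fun t => ‖V.grad (w' t - w t)‖ ^ 2) (timeVol T) :=
    integrable_norm_sq_of_memLp ((V.gradL O).comp_memLp' (h'.repV.1.sub h.repV.1))
  have iz : Integrable (fun t => ‖z' t - z t‖ ^ (r + 1)) (timeVol T) :=
    integrable_norm_rpow_of_memLp (by linarith) (h'.repL.1.sub h.repL.1)
  have hQ0 : ∀ᵐ t ∂timeVol T, 0 ≤ Q t := h.powLe.mono fun t ht => ht.1.nonneg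
  have iS := iΥ.add iζ
  have iR := ((h.integrable.const_mul ε).add (iS.const_mul Cε)).add (iF.const_mul C)
  have i1 : Integrable (fun _ => (1 : ℝ)) (timeVol T) := integrable_const _
  have ik := ((i1.add h.integrable).add iS).const_mul C
  have S0 : ∀ t, 0 ≤ ‖Υ' t - Υ t‖ ^ 2 + ‖ζ' t - ζ t‖ ^ p := fun t => by positivity
  have gr := add_integral_le_of_density (X := fun t => ‖v' t - v t‖ ^ 2) hT hc.le
    ((h'.cont.sub h.cont).norm.pow 2) (fun t => by positivity) hD (ig.add iz)
    (fun t => by dsimp only [Pi.add_apply]; positivity) ik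
    (by
      filter_upwards [hQ0] with t ht
      have := S0 t
      dsimp only [Pi.add_apply]
      positivity) iR
    (by
      filter_upwards [hQ0] with t ht
      have := S0 t
      dsimp only [Pi.add_apply]
      positivity) hE
    (by
      filter_upwards [hW, h'.repV.2, h.repV.2, h.powLe, hζ'.2, hζ.2]
        with t ht h1 h2 h3 h4 h5
      have hae : ((ζ' t - ζ t : Ltilde O p) : Lp (E d) (lexp p) (vol O)) =ᵐ[vol O]
          ((Υ' t - Υ t : H O) : Lp (E d) 2 (vol O)) := by
        have e1 := Lp.coeFn_sub (ζ' t : Lp (E d) (lexp p) (vol O)) (ζ t)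
        have e2 := Lp.coeFn_sub (Υ' t : Lp (E d) 2 (vol O)) (Υ t)
        exact e1.trans ((h4.sub h5).trans e2.symm)
      have key := Hε (w' t) (w t) (v' t) (v t) (Υ' t) (Υ t) (f' t) (f t) (W t) (Q t)
        (‖Υ' t - Υ t‖ ^ 2 + ‖ζ' t - ζ t‖ ^ p) h1 h2 ht.1 h3.1 h3.2
        (le_add_of_nonneg_right (by positivity))
        (powLe_of_ltilde (by linarith) _ _ hae (by norm_num) hp)
        (powLe_of_ltilde (by linarith) _ _ hae (by linarith) hrp)
      rw [ht.2] at key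
      dsimp only [Pi.add_apply]
      linarith)
  have vT : ∫ _, (1 : ℝ) ∂timeVol T = T := by simp [hT]
  rw [integral_add' ((h.integrable.const_mul ε).add (iS.const_mul Cε)) (iF.const_mul C),
    integral_add' (h.integrable.const_mul ε) (iS.const_mul Cε), integral_const_mul,
    integral_const_mul, integral_const_mul, integral_const_mul,
    integral_add' (i1.add h.integrable) iS, integral_add' i1 h.integrable,
    integral_add' iΥ iζ, vT] at gr
  intro t ht
  refine (gr t ht).trans (le_of_eq ?_)
  congr 2
  ring

theorem eventually_energy_le (hO : IsOpen O) {μ α β r p : ℝ} (χ : ℝ) (hT : 0 ≤ T) (hμ : 0 < μ)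
    (hα : 0 ≤ α) (hβ : 0 < β)
    (hdr : (d = 2 ∧ 1 ≤ r) ∨ (d = 3 ∧ 3 < r) ∨ (d = 3 ∧ r = 3 ∧ 1 ≤ 2 * β * μ))
    (hp : 4 ≤ p) (hrp : r + 1 ≤ p)
    {xn : ℕ → H O} {x : H O} (hx : Tendsto xn atTop (𝓝 x))
    {fn : ℕ → ℝ → StrongDual ℝ (V O)} {f : ℝ → StrongDual ℝ (V O)}
    (hf : TendstoBochner T 2 fn f) {Υn : ℕ → ℝ → H O} {Υ : ℝ → H O}
    (hΥ : TendstoBochner T 2 Υn Υ) (hL : TendstoLtilde O T p Υn Υ)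
    {vn : ℕ → ℝ → H O} {v : ℝ → H O}
    (hvn : ∀ n, IsWeakSolution O T μ α β χ r (xn n) (fn n) (Υn n) (vn n))
    (hv : IsWeakSolution O T μ α β χ r x f Υ v) :
    ∃ (c : ℝ) (wn : ℕ → ℝ → V O) (w : ℝ → V O) (zn : ℕ → ℝ → Ltilde O (r + 1))
      (z : ℝ → Ltilde O (r + 1)), 0 < c ∧ (∀ n, RepV O T (vn n) (wn n)) ∧ RepV O T v w ∧
      (∀ n, RepLtilde O T (r + 1) (vn n) (zn n)) ∧ RepLtilde O T (r + 1) v z ∧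
      ∀ δ > 0, ∀ᶠ n in atTop, ∀ t ∈ Icc 0 T, ‖vn n t - v t‖ ^ 2 + 2 * c * (∫ s in (0 : ℝ)..t,
          (‖V.grad (wn n s - w s)‖ ^ 2 + ‖zn n s - z s‖ ^ (r + 1))) ≤ δ := by
  have hdr' : (d = 2 ∧ 1 ≤ r) ∨ (d = 3 ∧ 3 ≤ r) := by
    rcases hdr with h | h | h
    exacts [Or.inl h, Or.inr ⟨h.1, h.2.le⟩, Or.inr ⟨h.1, h.2.1.ge⟩]
  obtain ⟨ζn, ζ, hζn, hζ, hζt⟩ := hL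
  obtain ⟨w, z, g, Q, a, b, hS⟩ := hv.exists_data hO hμ.le hα hβ.le hdr' hp hrp hf.2.1 hΥ.2.1 hζ
  have hSn := fun n => (hvn n).exists_data hO hμ.le hα hβ.le hdr' hp hrp (hf.1 n) (hΥ.1 n) (hζn n)
  choose wn zn gn Qn an bn hSn using hSn
  obtain ⟨c, C, hc, hC, HP⟩ := exists_stability_bound hO χ hT hμ hα hβ hdr hp hrp
  refine ⟨c, wn, w, zn, z, hc, fun n => (hSn n).repV, hS.repV, fun n => (hSn n).repL, hS.repL, ?_⟩
  have lx : Tendsto (fun n => ‖vn n 0 - v 0‖ ^ 2) atTop (𝓝 0) := by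
    have h1 : Tendsto (fun n => ‖xn n - x‖ ^ 2) atTop (𝓝 (‖x - x‖ ^ 2)) :=
      ((hx.sub_const x).norm).pow 2
    rw [sub_self, norm_zero, zero_pow two_ne_zero] at h1
    refine h1.congr fun n => ?_
    rw [(hvn n).2.1, hv.2.1]
  have lΥ := (tendsto_eLpNorm_two_zero_iff fun n => (hΥ.1 n).sub hΥ.2.1).1 hΥ.2.2
  have lf := (tendsto_eLpNorm_two_zero_iff fun n => (hf.1 n).sub hf.2.1).1 hf.2.2
  have lζ := (tendsto_eLpNorm_zero_iff (by linarith) fun n => (hζt.1 n).sub hζt.2.1).1 hζt.2.2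
  have lS := lΥ.add lζ
  rw [add_zero] at lS
  have hQ0 : 0 ≤ ∫ s, Q s ∂timeVol T :=
    integral_nonneg_of_ae (hS.powLe.mono fun t ht => ht.1.nonneg)
  -- The parameters `I = ∫ Q` and `K` belong to the limit solution and are independent of `n`.
  refine eventually_forall_le_of_forall_eps (K := 2 * C * (T + ∫ s, Q s ∂timeVol T)) (C := C)
    hQ0 lx lS lf fun ε hε => ?_
  obtain ⟨Cε, -, Hε⟩ := HP ε hε
  exact ⟨Cε, fun n t ht => Hε (hSn n) hS (hf.1 n) hf.2.1 (hΥ.1 n) hΥ.2.1 (hζn n) hζ t ht⟩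

end

end CBF

end

/-! ### The theorem: from the energies to the three convergences. -/

theorem mainTheorem3 {d : ℕ} (O : Set (CBF.E d)) (hO : IsOpen O) (hP : CBF.IsPoincareDomain O)
    (T μ α β χ r : ℝ) (hT : 0 < T) (hμ : 0 < μ) (hα : 0 < α) (hβ : 0 < β) (hχ : 0 ≤ χ)
    (hdr : (d = 2 ∧ 1 ≤ r) ∨ (d = 3 ∧ 3 < r) ∨ (d = 3 ∧ r = 3 ∧ 1 ≤ 2 * β * μ))
    (xn : ℕ → CBF.H O) (x : CBF.H O) (hx : Tendsto xn atTop (𝓝 x))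
    (fn : ℕ → ℝ → StrongDual ℝ (CBF.V O)) (f : ℝ → StrongDual ℝ (CBF.V O))
    (hf : CBF.TendstoBochner T 2 fn f)
    (Υn : ℕ → ℝ → CBF.H O) (Υ : ℝ → CBF.H O)
    (hΥ : CBF.TendstoBochner T 2 Υn Υ)
    (hΥ_lt : r < 3 → CBF.TendstoLtilde O T 4 Υn Υ)
    (hΥ_ge : 3 ≤ r → CBF.TendstoLtilde O T (r + 1) Υn Υ)
    (vn : ℕ → ℝ → CBF.H O) (v : ℝ → CBF.H O)
    (hvn : ∀ n, CBF.IsWeakSolution O T μ α β χ r (xn n) (fn n) (Υn n) (vn n))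
    (hv : CBF.IsWeakSolution O T μ α β χ r x f Υ v) :
    TendstoUniformlyOn vn v atTop (Icc 0 T) ∧
      CBF.TendstoV O T vn v ∧
      CBF.TendstoLtilde O T (r + 1) vn v ∧
      Tendsto (fun n => vn n T) atTop (𝓝 (v T)) := by
  have hr : 1 ≤ r := by
    rcases hdr with h | h | h
    exacts [h.2, by linarith [h.2], by linarith [h.2.1]]
  -- In both regimes `p = max 4 (r + 1)`, which controls the convection and the damping together.
  obtain ⟨p, hp, hrp, hL⟩ : ∃ p : ℝ, 4 ≤ p ∧ r + 1 ≤ p ∧ CBF.TendstoLtilde O T p Υn Υ := by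
    rcases lt_or_ge r 3 with h | h
    · exact ⟨4, le_rfl, by linarith, hΥ_lt h⟩
    · exact ⟨r + 1, by linarith, le_rfl, hΥ_ge h⟩
  obtain ⟨c, wn, w, zn, z, hc, hwn, hw, hzn, hz, key⟩ :=
    CBF.eventually_energy_le hO χ hT.le hμ hα.le hβ hdr hp hrp hx hf hΥ hL hvn hv
  have ig : ∀ n, Integrable (fun t => ‖CBF.V.grad (wn n t - w t)‖ ^ 2) (CBF.timeVol T) := fun n =>
    CBF.integrable_norm_sq_of_memLp ((CBF.V.gradL O).comp_memLp' ((hwn n).1.sub hw.1))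
  have iz : ∀ n, Integrable (fun t => ‖zn n t - z t‖ ^ (r + 1)) (CBF.timeVol T) := fun n =>
    CBF.integrable_norm_rpow_of_memLp (by linarith) ((hzn n).1.sub hz.1)
  have hTT : T ∈ Icc 0 T := right_mem_Icc.2 hT.le
  have hpt : ∀ δ > 0, ∀ᶠ n in atTop, ∀ t ∈ Icc 0 T, ‖vn n t - v t‖ ^ 2 ≤ δ := fun δ hδ => by
    filter_upwards [key δ hδ] with n hn t ht
    refine le_trans (le_add_of_nonneg_right (mul_nonneg (by positivity) ?_)) (hn t ht)
    exact intervalIntegral.integral_nonneg ht.1 fun s _ => by positivity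
  have hint : ∀ δ > 0, ∀ᶠ n in atTop, (∫ t, ‖CBF.V.grad (wn n t - w t)‖ ^ 2 ∂CBF.timeVol T) +
      (∫ t, ‖zn n t - z t‖ ^ (r + 1) ∂CBF.timeVol T) ≤ δ := fun δ hδ => by
    -- The factor `2c` of the dissipation cancels.
    filter_upwards [key (2 * c * δ) (by positivity)] with n hn
    have h1 := hn T hTT
    rw [intervalIntegral.integral_of_le hT.le, ← restrict_Ioo_eq_restrict_Ioc,
      integral_add (ig n) (iz n)] at h1
    exact le_of_mul_le_mul_left ((le_add_of_nonneg_left (by positivity)).trans h1) (by positivity)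
  have hunif : TendstoUniformlyOn vn v atTop (Icc 0 T) := by
    rw [Metric.tendstoUniformlyOn_iff]
    intro δ hδ
    filter_upwards [hpt ((δ / 2) ^ 2) (by positivity)] with n hn t ht
    rw [dist_comm, dist_eq_norm]
    have := abs_le_of_sq_le_sq' (hn t ht) (by positivity)
    linarith [this.2]
  have hw0 : Tendsto (fun n => ∫ t, ‖(wn n - w) t‖ ^ 2 ∂CBF.timeVol T) atTop (𝓝 0) := by
    refine Metric.tendsto_atTop'.2 fun δ hδ => ?_
    -- The `𝕍` norm contains the `L²` part as well; the uniform bound `δ/(4T)` integrates to `δ/4`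
    -- over `(0, T)`, and the gradient adds another `δ/4`.
    have h1 := (hpt (δ / (4 * T)) (by positivity)).and (hint (δ / 4) (by positivity))
    obtain ⟨N, hN⟩ := eventually_atTop.1 h1
    refine ⟨N, fun n hn => ?_⟩
    obtain ⟨h2, h3⟩ := hN n hn.le
    have h4 : 0 ≤ ∫ t, ‖zn n t - z t‖ ^ (r + 1) ∂CBF.timeVol T :=
      integral_nonneg fun t => by positivity
    rw [Real.dist_0_eq_abs, abs_of_nonneg (integral_nonneg fun t => by positivity)]
    have h5 : ∫ t, ‖(wn n - w) t‖ ^ 2 ∂CBF.timeVol T ≤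
        ∫ t, (δ / (4 * T) + ‖CBF.V.grad (wn n t - w t)‖ ^ 2) ∂CBF.timeVol T := by
      refine integral_mono_ae (CBF.integrable_norm_sq_of_memLp ((hwn n).1.sub hw.1))
        ((integrable_const _).add (ig n)) ?_
      filter_upwards [(hwn n).2, hw.2, ae_restrict_mem measurableSet_Ioo] with t e1 e2 htT
      have h6 := h2 t (Ioo_subset_Icc_self htT)
      have e3 : ‖CBF.V.fn (wn n t - w t)‖ = ‖vn n t - v t‖ := by
        rw [CBF.V.fn_sub, e1, e2]; rfl
      rw [Pi.sub_apply, CBF.V.norm_sq_eq, e3]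
      linarith
    rw [integral_add (integrable_const _) (ig n)] at h5
    have h7 : ∫ _, δ / (4 * T) ∂CBF.timeVol T = δ / 4 := by
      simp [hT.le]
      field_simp
    linarith
  have hz0 : Tendsto (fun n => ∫ t, ‖(zn n - z) t‖ ^ (r + 1) ∂CBF.timeVol T) atTop (𝓝 0) := by
    refine Metric.tendsto_atTop'.2 fun δ hδ => ?_
    obtain ⟨N, hN⟩ := eventually_atTop.1 (hint (δ / 2) (by positivity))
    refine ⟨N, fun n hn => ?_⟩
    have h3 := hN n hn.le
    have h4 : 0 ≤ ∫ t, ‖CBF.V.grad (wn n t - w t)‖ ^ 2 ∂CBF.timeVol T :=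
      integral_nonneg fun t => by positivity
    rw [Real.dist_0_eq_abs, abs_of_nonneg (integral_nonneg fun t => by positivity)]
    simp only [Pi.sub_apply]
    linarith
  refine ⟨hunif, ⟨wn, w, hwn, hw, fun n => (hwn n).1, hw.1, ?_⟩,
    ⟨zn, z, hzn, hz, fun n => (hzn n).1, hz.1, ?_⟩, hunif.tendsto_at hTT⟩
  · exact (CBF.tendsto_eLpNorm_two_zero_iff fun n => (hwn n).1.sub hw.1).2 hw0
  · exact (CBF.tendsto_eLpNorm_zero_iff (by linarith) fun n => (hzn n).1.sub hz.1).2 hz0
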